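/- **Setting.** Write $\mathbf R^3=\mathbf R^2\times\mathbf R$ with points $(x,y)$, and let $\sigma(x,y)=(x,-y)$. A lattice in $\mathbf R^k$ is the $\mathbf Z$-span of $k$ linearly independent vectors; $\{\cdot\}_{\mathbf Z}$ denotes $\mathbf Z$-span. A subgroup $\Gamma$ of the Euclidean group $\mathbf E(3)$ (elements $(v,\delta)$ acting by $z\mapsto v+\delta z$) is crystallographic if $\mathcal L=\{v:(v,\mathrm{Id})\in\Gamma\}$ is a lattice in $\mathbf R^3$; put $\mathcal L_\sigma=\{v:(v,\sigma)\in\Gamma\}$ (possibly empty). For $y_0>0$ let $\widetilde{\mathcal L}_{y_0}$ be the group of all $p\in\mathbf R^2$ that are periods of $x\mapsto\int_0^{y_0}f(x,y)\,dy$ for every $\Gamma$-invariant $C^1$ function $f:\mathbf R^3\to\mathbf R$. A module $A$ is rationally compatible with $B$ if $mA\subset B$ for some integer $m\neq0$. Let $\mathcal M\subset\mathbf R^2$ be a lattice. **(I)** For a crystallographic group $\Gamma$, one has $\widetilde{\mathcal L}_{y_0}=\mathcal M$ for some $y_0>0$ if and only if there are generators $a_0,b_0$ of $\mathcal M$ such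 that $(\mathcal L,\mathcal L_\sigma)$ is in one of the cases below. **(II)** For all generators $a_0,b_0$ of $\mathcal M$, each pair $(\mathcal L,\mathcal L_\sigma)$ in the list is that of some crystallographic group. **(III)** For all generators $a_0,b_0$ of $\mathcal M$ and every $\Gamma$ in one of the cases, $\widetilde{\mathcal L}_{y_0}$ is, for every $y_0>0$, as stated in that case. Except in case 2.1, $\widetilde{\mathcal L}_{y_0}$ is always a lattice, and $\widetilde{\mathcal L}_{y_0}$ and $\mathcal M$ are each rationally compatible with the other. **The list.** Put $\mathcal L(\hat a,a_3;\hat b,b_3;c)=\{(\hat a,a_3),(\hat b,b_3),(0,c)\}_{\mathbf Z}$ with $c>0$, and $D=\{(m,n)\in\mathbf Z^2: ma_3+nb_3\in c\mathbf Z\}$. The widths are divided into the sets $A=\{nc\}$; $B=\{nc+y_1\}$ without $A$; $C=\{nc+\frac c2+y_1\}$ without $A\cup B$ ($n\in\mathbf Z$); and $O$, all other widths. *Case 1.* $\mathcal L=\{(a_0,0),(b_0,0),(c_0,c_3)\}_{\mathbf Z}$ with $c_3\ne0$ and $nc_0\notin\mathcal M$ for all integers $n\neq0$; $\mathcal L_\sigma=\emptyset$.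 Then $\widetilde{\mathcal L}_{y_0}=\mathcal M$ for all $y_0$. *Case 2.* $\sigma\mathcal L\not\subset\mathcal L$, $\mathcal L_\sigma=\emptyset$, and $a_3,b_3\in[0,c)$. - 2.1: $\mathcal L=\mathcal L(a_0,a_3;b_0,b_3;c)$. Then $\widetilde{\mathcal L}_{y_0}=\mathcal M$ on $A$. For other $y_0$, $\widetilde{\mathcal L}_{y_0}=\{ma_0+nb_0:(m,n)\in D\}$, a proper subset of $\mathcal M$; it is a lattice if and only if $D$ contains two linearly independent pairs, and then $\mathcal M$ is rationally compatible with it. - 2.2: $\mathcal L=\mathcal L(\hat a,a_3;\hat b,b_3;c)$ with $\hat a,\hat b$ linearly independent, $D=\{(m_1,m_2),(n_1,n_2)\}_{\mathbf Z}$ with linearly independent generators, $a_0=m_1\hat a+m_2\hat b$, $b_0=n_1\hat a+n_2\hat b$. Then $\widetilde{\mathcal L}_{y_0}=\{\hat a,\hat b\}_{\mathbf Z}\supsetneq\mathcal M$ on $A$, and $\mathcal M$ for other $y_0$. *Case 3.* $\mathcal L_\sigma=\emptyset$ or $\mathcal L_\sigma=\mathcal L$. Let $W=\{nc\}$ if $\mathcal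 L_\sigma=\emptyset$ and $W=\{nc/2\}$ if $\mathcal L_\sigma=\mathcal L$ ($n\in\mathbf Z$). - 3.1: $\mathcal L=\mathcal L(a_0,0;b_0,0;c)$. Then $\widetilde{\mathcal L}_{y_0}=\mathcal M$ for all $y_0$. - 3.2: $\mathcal L=\mathcal L(a_0,\frac c2;b_0,0;c)$. Then $\mathcal M$ on $W$, and $\{2a_0,b_0\}_{\mathbf Z}$ for other $y_0$. - 3.3: $\mathcal L=\mathcal L(\frac12a_0,\frac c2;b_0,0;c)$. Then $\{\frac12a_0,b_0\}_{\mathbf Z}$ on $W$, and $\mathcal M$ for other $y_0$. In cases 4 and 5, $\mathcal L_\sigma=(v_1,y_1)+\mathcal L$ with $0\le y_1<c$ and $(v_1,y_1)\notin\mathcal L$. *Case 4.* - 4.1: $\mathcal L=\mathcal L(a_0,0;b_0,0;c)$. If $v_1=0$: $\mathcal M$ for all $y_0$. If $v_1=\frac12a_0$, $\frac12b_0$ or $\frac12(a_0+b_0)$: respectively $\{\frac12a_0,b_0\}_{\mathbf Z}$, $\{a_0,\frac12b_0\}_{\mathbf Z}$ or $\{a_0,\frac12(a_0+b_0)\}_{\mathbf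 Z}$ on $A\cup B$, and $\mathcal M$ for other $y_0$. - 4.2: $\mathcal L=\mathcal L(2a_0,0;b_0,0;c)$, $v_1=a_0$: $\mathcal M$ on $A\cup B$, $\{2a_0,b_0\}_{\mathbf Z}$ for other $y_0$. - 4.3: $\mathcal L=\mathcal L(a_0,0;2b_0,0;c)$, $v_1=b_0$: $\mathcal M$ on $A\cup B$, $\{a_0,2b_0\}_{\mathbf Z}$ for other $y_0$. *Case 5.* $\mathcal L=\mathcal L(\hat a,\frac c2;\hat b,0;c)$, and $\widetilde{\mathcal L}_{y_0}$ on $A$, $B$, $C$, $O$ is the $\mathbf Z$-span of: | case | $\hat a$ | $\hat b$ | $v_1$ | condition | $A$ | $B$ | $C$ | $O$ | |---|---|---|---|---|---|---|---|---| | 5.1 | $a_0$ | $b_0$ | $0$ | | $a_0,b_0$ | $2a_0,b_0$ | $a_0,b_0$ | $2a_0,b_0$ | | 5.1 | $a_0$ | $b_0$ | $a_0$ | | $a_0,b_0$ | $a_0,b_0$ | $2a_0,b_0$ | $2a_0,b_0$ | | 5.2 | $a_0$ | $2b_0$ | $b_0$ | | $a_0,b_0$ | $2a_0,b_0$ | $2a_0,a_0+b_0$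 | $2a_0,2b_0$ | | 5.2 | $a_0$ | $2b_0$ | $a_0+b_0$ | | $a_0,b_0$ | $2a_0,a_0+b_0$ | $2a_0,b_0$ | $2a_0,2b_0$ | | 5.3 | $a_0-\frac12b_0$ | $b_0$ | $\frac12b_0$ | $y_1\ne\frac c2$ | $a_0,\frac12b_0$ | $2a_0,\frac12b_0$ | $a_0,b_0$ | $2a_0,b_0$ | | 5.3 | $a_0-\frac12b_0$ | $b_0$ | $a_0$ | $y_1\ne0$ | $a_0,\frac12b_0$ | $a_0,b_0$ | $2a_0,\frac12b_0$ | $2a_0,b_0$ | | 5.4 | $\frac12a_0$ | $2b_0$ | $b_0$ | $y_1\ne0$ | $\frac12a_0,b_0$ | $a_0,b_0$ | $a_0,\frac12a_0+b_0$ | $a_0,2b_0$ | | 5.4 | $\frac12a_0$ | $2b_0$ | $\frac12a_0+b_0$ | $y_1\ne\frac c2$ | $\frac12a_0,b_0$ | $a_0,\frac12a_0+b_0$ | $a_0,b_0$ | $a_0,2b_0$ | | 5.5 | $\frac12a_0$ | $b_0$ | $0$ | | $\frac12a_0,b_0$ | $a_0,b_0$ | $\frac12a_0,b_0$ | $a_0,b_0$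 | | 5.5 | $\frac12a_0$ | $b_0$ | $\frac12a_0$ | | $\frac12a_0,b_0$ | $\frac12a_0,b_0$ | $a_0,b_0$ | $a_0,b_0$ | | 5.5 | $\frac12a_0$ | $b_0$ | $\frac12b_0$ | | $\frac12a_0,\frac12b_0$ | $a_0,\frac12b_0$ | $a_0,\frac12(a_0+b_0)$ | $a_0,b_0$ | | 5.5 | $\frac12a_0$ | $b_0$ | $\frac12(a_0+b_0)$ | | $\frac12a_0,\frac12b_0$ | $a_0,\frac12(a_0+b_0)$ | $a_0,\frac12b_0$ | $a_0,b_0$ | -/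

import Mathlib

noncomputable section

/-- The Euclidean plane, the space of the variable `x`. -/
abbrev Plane : Type := EuclideanSpace ℝ (Fin 2)

/-- Euclidean three-space, written as pairs `(x, y)` with `x` in the plane and `y` real. -/
abbrev Space : Type := WithLp 2 (Plane × ℝ)

/-- The point `(x, y)` of three-space. -/
def pt (x : Plane) (y : ℝ) : Space := WithLp.toLp 2 (x, y)

/-- A lattice: the integer span of linearly independent vectors, as many as the dimension. -/
def IsLattice {E : Type*} [AddCommGroup E] [Module ℝ E] (L : AddSubgroup E) : Prop :=
  ∃ l : Fin (Module.finrank ℝ E) → E, LinearIndependent ℝ l ∧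
    L = AddSubgroup.closure (Set.range l)

/-- The module generated over the integers by two vectors. -/
def gen2 {E : Type*} [AddCommGroup E] (a b : E) : AddSubgroup E :=
  AddSubgroup.closure {a, b}

/-- The module generated over the integers by three vectors. -/
def gen3 {E : Type*} [AddCommGroup E] (a b c : E) : AddSubgroup E :=
  AddSubgroup.closure {a, b, c}

/-- `a` and `b` are linearly independent generators of the planar lattice `M`. -/
def AreGenerators (a b : Plane) (M : AddSubgroup Plane) : Prop :=
  LinearIndependent ℝ ![a, b] ∧ M = gen2 a b

/-- `A` is rationally compatible with `B`: a nonzero integer multiple of `A` lies in `B`. -/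
def RationallyCompatible (A B : AddSubgroup Plane) : Prop :=
  ∃ m : ℤ, m ≠ 0 ∧ ∀ x ∈ A, m • x ∈ B

/-! ### The Euclidean group, crystallographic groups -/

/-- The Euclidean group of three-space. -/
abbrev EuclideanGroup : Type := Space ≃ᵃⁱ[ℝ] Space

/-- The Euclidean motion `(v, δ)`, acting by `z ↦ v + δ z`. -/
def motion (v : Space) (δ : Space ≃ₗᵢ[ℝ] Space) : EuclideanGroup :=
  AffineIsometryEquiv.constVAdd ℝ Space v * δ.toAffineIsometryEquiv

theorem motion_apply (v : Space) (δ : Space ≃ₗᵢ[ℝ] Space) (z : Space) :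
    motion v δ z = v + δ z := rfl

/-- The reflection `(x, y) ↦ (x, -y)`. -/
def sigma : Space ≃ₗᵢ[ℝ] Space :=
  LinearIsometryEquiv.withLpProdCongr 2 (LinearIsometryEquiv.refl ℝ Plane)
    (LinearIsometryEquiv.neg ℝ)

theorem sigma_pt (x : Plane) (y : ℝ) : sigma (pt x y) = pt x (-y) := rfl

/-- The translation subgroup of `Γ`, as a subgroup of three-space. -/
def latticeOf (Γ : Subgroup EuclideanGroup) : AddSubgroup Space where
  carrier := {v | motion v (LinearIsometryEquiv.refl ℝ Space) ∈ Γ}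
  zero_mem' := by
    have h : motion 0 (LinearIsometryEquiv.refl ℝ Space) = 1 := by
      ext z : 1
      rw [motion_apply]
      exact zero_add z
    rw [Set.mem_ofPred_eq, h]
    exact Γ.one_mem
  add_mem' := by
    intro v w hv hw
    have h : motion (v + w) (LinearIsometryEquiv.refl ℝ Space) =
        motion v (LinearIsometryEquiv.refl ℝ Space) *
          motion w (LinearIsometryEquiv.refl ℝ Space) := by
      ext z : 1
      rw [motion_apply]
      exact add_assoc v w z
    rw [Set.mem_ofPred_eq, h]
    exact Γ.mul_mem hv hw
  neg_mem' := by
    intro v hv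
    have h : motion (-v) (LinearIsometryEquiv.refl ℝ Space) =
        (motion v (LinearIsometryEquiv.refl ℝ Space))⁻¹ := by
      refine eq_inv_of_mul_eq_one_left ?_
      ext z : 1
      exact neg_add_cancel_left v z
    rw [Set.mem_ofPred_eq, h]
    exact Γ.inv_mem hv

/-- `Γ` is a crystallographic group: its translations form a lattice. -/
def IsCrystallographic (Γ : Subgroup EuclideanGroup) : Prop :=
  IsLattice (latticeOf Γ)

/-- The `σ`-coset of `Γ`: all `v` with `(v, σ) ∈ Γ`; it is empty when `σ` is not in the point
group of `Γ`, and otherwise it is a translate of the lattice of `Γ`. -/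
def sigmaCoset (Γ : Subgroup EuclideanGroup) : Set Space :=
  {v | motion v sigma ∈ Γ}

/-! ### Invariant functions and their projections -/

/-- The `Γ`-invariant functions of class `C¹`. -/
def invariantFunctions (Γ : Subgroup EuclideanGroup) : Set (Space → ℝ) :=
  {f | ContDiff ℝ 1 f ∧ ∀ γ ∈ Γ, ∀ z : Space, f (γ⁻¹ z) = f z}

/-- The projection of `f` over the band `0 ≤ y ≤ y₀`. -/
def bandProjection (y₀ : ℝ) (f : Space → ℝ) (x : Plane) : ℝ :=
  ∫ y in (0 : ℝ)..y₀, f (pt x y)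

/-- The group of common periods of the projections of all `Γ`-invariant functions. -/
def commonPeriods (Γ : Subgroup EuclideanGroup) (y₀ : ℝ) : AddSubgroup Plane where
  carrier := {p | ∀ f ∈ invariantFunctions Γ, ∀ x : Plane,
    bandProjection y₀ f (x + p) = bandProjection y₀ f x}
  zero_mem' := by
    intro f _ x
    rw [add_zero]
  add_mem' := by
    intro p q hp hq f hf x
    rw [← add_assoc, hq f hf, hp f hf]
  neg_mem' := by
    intro p hp f hf x
    have h := hp f hf (x + -p)
    rw [neg_add_cancel_right] at h
    exact h.symm

/-! ### The list of cases -/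

/-- The pairs `(m, n)` of integers with `m a₃ + n b₃ ≡ 0` modulo `c`. -/
def diophantineModule (a₃ b₃ c : ℝ) : AddSubgroup (ℤ × ℤ) where
  carrier := {d | ∃ k : ℤ, (d.1 : ℝ) * a₃ + (d.2 : ℝ) * b₃ = (k : ℝ) * c}
  zero_mem' := ⟨0, by simp⟩
  add_mem' := by
    rintro d e ⟨k, hk⟩ ⟨l, hl⟩
    refine ⟨k + l, ?_⟩
    push_cast [Prod.fst_add, Prod.snd_add]
    linear_combination hk + hl
  neg_mem' := by
    rintro d ⟨k, hk⟩
    refine ⟨-k, ?_⟩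
    push_cast [Prod.fst_neg, Prod.snd_neg]
    linear_combination -hk

/-- The combinations `m a + n b` with `(m, n)` in a given module of pairs of integers. -/
def combinations (a b : Plane) (D : AddSubgroup (ℤ × ℤ)) : AddSubgroup Plane :=
  D.map (((zmultiplesHom Plane) a).coprod ((zmultiplesHom Plane) b))

/-- The lattice generated by `(a, a₃)`, `(b, b₃)` and `(0, c)`. -/
def adaptedLattice (a : Plane) (a₃ : ℝ) (b : Plane) (b₃ : ℝ) (c : ℝ) : AddSubgroup Space :=
  gen3 (pt a a₃) (pt b b₃) (pt 0 c)

/-- The coset `(v₁, y₁) + L`. -/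
def cosetAt (L : AddSubgroup Space) (v₁ : Plane) (y₁ : ℝ) : Set Space :=
  {z | ∃ l ∈ L, z = pt v₁ y₁ + l}

/-- The reflection `σ` does not map `L` into `L`. -/
def SigmaBreaks (L : AddSubgroup Space) : Prop :=
  ¬ ∀ z ∈ L, sigma z ∈ L

/-- Standing conditions on the position `(v₁, y₁)` of a `σ`-coset different from `L`. -/
def IsShift (L : AddSubgroup Space) (c : ℝ) (v₁ : Plane) (y₁ : ℝ) : Prop :=
  0 ≤ y₁ ∧ y₁ < c ∧ pt v₁ y₁ ∉ L

open Classical in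
/-- The value `A` when `y₀` is an integer multiple of `d`, and `O` for other widths. -/
def atMultiples (d : ℝ) (A O : AddSubgroup Plane) (y₀ : ℝ) : AddSubgroup Plane :=
  if ∃ n : ℤ, y₀ = n * d then A else O

open Classical in
/-- The value `A` when `y₀ = n c` for an integer `n`; otherwise `B` when `y₀ = n c + y₁`;
otherwise `C` when `y₀ = n c + c / 2 + y₁`; and `O` for all other widths. -/
def bandTable (c y₁ : ℝ) (A B C O : AddSubgroup Plane) (y₀ : ℝ) : AddSubgroup Plane :=
  if ∃ n : ℤ, y₀ = n * c then A
  else if ∃ n : ℤ, y₀ = n * c + y₁ then B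
  else if ∃ n : ℤ, y₀ = n * c + c / 2 + y₁ then C
  else O

/-- Case 1: no nonzero vector `(0, z)` lies in the lattice. -/
def Case1 (a₀ b₀ c₀ : Plane) (c₃ : ℝ) (L : AddSubgroup Space) (S : Set Space) : Prop :=
  c₃ ≠ 0 ∧ (∀ n : ℤ, n ≠ 0 → n • c₀ ∉ gen2 a₀ b₀) ∧
    L = gen3 (pt a₀ 0) (pt b₀ 0) (pt c₀ c₃) ∧ S = ∅

/-- Case 2.1: `L` is not `σ`-invariant and projects onto the given lattice. -/
def Case21 (a₀ b₀ : Plane) (a₃ b₃ c : ℝ) (L : AddSubgroup Space) (S : Set Space) : Prop :=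
  0 < c ∧ a₃ ∈ Set.Ico 0 c ∧ b₃ ∈ Set.Ico 0 c ∧
    L = adaptedLattice a₀ a₃ b₀ b₃ c ∧ SigmaBreaks L ∧ S = ∅

/-- Case 2.2: `L` is not `σ`-invariant and meets the plane `y = 0` in the given lattice. -/
def Case22 (a₀ b₀ a b : Plane) (a₃ b₃ c : ℝ) (L : AddSubgroup Space) (S : Set Space) : Prop :=
  0 < c ∧ a₃ ∈ Set.Ico 0 c ∧ b₃ ∈ Set.Ico 0 c ∧ LinearIndependent ℝ ![a, b] ∧
    L = adaptedLattice a a₃ b b₃ c ∧ SigmaBreaks L ∧ S = ∅ ∧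
    ∃ m₁ m₂ n₁ n₂ : ℤ, m₁ * n₂ - m₂ * n₁ ≠ 0 ∧
      diophantineModule a₃ b₃ c = gen2 (m₁, m₂) (n₁, n₂) ∧
      a₀ = m₁ • a + m₂ • b ∧ b₀ = n₁ • a + n₂ • b

/-- The names of the cases. -/
inductive CaseName : Type
  | case1 | case21 | case22 | case31 | case32 | case33 | case41 | case42 | case43
  | case51 | case52 | case53 | case54 | case55

/-- The list of cases for the planar lattice with generators `a₀`, `b₀`.
`ListedCase a₀ b₀ name L S P` says that the lattice `L` and the `σ`-coset `S` are in the case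
`name`, and that the list gives the lattice of periods `P y₀` at the width `y₀`. -/
inductive ListedCase (a₀ b₀ : Plane) :
    CaseName → AddSubgroup Space → Set Space → (ℝ → AddSubgroup Plane) → Prop
  | c1 (c₀ : Plane) (c₃ : ℝ) (L : AddSubgroup Space) (S : Set Space)
      (h : Case1 a₀ b₀ c₀ c₃ L S) :
      ListedCase a₀ b₀ .case1 L S (fun _ => gen2 a₀ b₀)
  | c21 (a₃ b₃ c : ℝ) (L : AddSubgroup Space) (S : Set Space)
      (h : Case21 a₀ b₀ a₃ b₃ c L S) :
      ListedCase a₀ b₀ .case21 L S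
        (atMultiples c (gen2 a₀ b₀) (combinations a₀ b₀ (diophantineModule a₃ b₃ c)))
  | c22 (a b : Plane) (a₃ b₃ c : ℝ) (L : AddSubgroup Space) (S : Set Space)
      (h : Case22 a₀ b₀ a b a₃ b₃ c L S) :
      ListedCase a₀ b₀ .case22 L S (atMultiples c (gen2 a b) (gen2 a₀ b₀))
  -- in cases 3.1 to 3.3 the `σ`-coset is empty or equal to `L`
  | c31 (c : ℝ) (hc : 0 < c) (L : AddSubgroup Space) (S : Set Space)
      (hL : L = adaptedLattice a₀ 0 b₀ 0 c) (hS : S = ∅ ∨ S = L) :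
      ListedCase a₀ b₀ .case31 L S (fun _ => gen2 a₀ b₀)
  | c32_empty (c : ℝ) (hc : 0 < c) (L : AddSubgroup Space) (S : Set Space)
      (hL : L = adaptedLattice a₀ (c / 2) b₀ 0 c) (hS : S = ∅) :
      ListedCase a₀ b₀ .case32 L S
        (atMultiples c (gen2 a₀ b₀) (gen2 ((2 : ℝ) • a₀) b₀))
  | c32_full (c : ℝ) (hc : 0 < c) (L : AddSubgroup Space) (S : Set Space)
      (hL : L = adaptedLattice a₀ (c / 2) b₀ 0 c) (hS : S = L) :
      ListedCase a₀ b₀ .case32 L S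
        (atMultiples (c / 2) (gen2 a₀ b₀) (gen2 ((2 : ℝ) • a₀) b₀))
  | c33_empty (c : ℝ) (hc : 0 < c) (L : AddSubgroup Space) (S : Set Space)
      (hL : L = adaptedLattice ((1 / 2 : ℝ) • a₀) (c / 2) b₀ 0 c) (hS : S = ∅) :
      ListedCase a₀ b₀ .case33 L S
        (atMultiples c (gen2 ((1 / 2 : ℝ) • a₀) b₀) (gen2 a₀ b₀))
  | c33_full (c : ℝ) (hc : 0 < c) (L : AddSubgroup Space) (S : Set Space)
      (hL : L = adaptedLattice ((1 / 2 : ℝ) • a₀) (c / 2) b₀ 0 c) (hS : S = L) :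
      ListedCase a₀ b₀ .case33 L S
        (atMultiples (c / 2) (gen2 ((1 / 2 : ℝ) • a₀) b₀) (gen2 a₀ b₀))
  -- case 4.1, with `v₁` equal to `0`, `a₀ / 2`, `b₀ / 2` or `(a₀ + b₀) / 2`
  | c41_zero (c y₁ : ℝ) (L : AddSubgroup Space) (S : Set Space)
      (hL : L = adaptedLattice a₀ 0 b₀ 0 c)
      (hv : IsShift L c 0 y₁) (hS : S = cosetAt L 0 y₁) :
      ListedCase a₀ b₀ .case41 L S (fun _ => gen2 a₀ b₀)
  | c41_a (c y₁ : ℝ) (L : AddSubgroup Space) (S : Set Space)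
      (hL : L = adaptedLattice a₀ 0 b₀ 0 c)
      (hv : IsShift L c ((1 / 2 : ℝ) • a₀) y₁) (hS : S = cosetAt L ((1 / 2 : ℝ) • a₀) y₁) :
      ListedCase a₀ b₀ .case41 L S
        (bandTable c y₁ (gen2 ((1 / 2 : ℝ) • a₀) b₀) (gen2 ((1 / 2 : ℝ) • a₀) b₀)
          (gen2 a₀ b₀) (gen2 a₀ b₀))
  | c41_b (c y₁ : ℝ) (L : AddSubgroup Space) (S : Set Space)
      (hL : L = adaptedLattice a₀ 0 b₀ 0 c)
      (hv : IsShift L c ((1 / 2 : ℝ) • b₀) y₁) (hS : S = cosetAt L ((1 / 2 : ℝ) • b₀) y₁) :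
      ListedCase a₀ b₀ .case41 L S
        (bandTable c y₁ (gen2 a₀ ((1 / 2 : ℝ) • b₀)) (gen2 a₀ ((1 / 2 : ℝ) • b₀))
          (gen2 a₀ b₀) (gen2 a₀ b₀))
  | c41_ab (c y₁ : ℝ) (L : AddSubgroup Space) (S : Set Space)
      (hL : L = adaptedLattice a₀ 0 b₀ 0 c)
      (hv : IsShift L c ((1 / 2 : ℝ) • (a₀ + b₀)) y₁)
      (hS : S = cosetAt L ((1 / 2 : ℝ) • (a₀ + b₀)) y₁) :
      ListedCase a₀ b₀ .case41 L S
        (bandTable c y₁ (gen2 a₀ ((1 / 2 : ℝ) • (a₀ + b₀))) (gen2 a₀ ((1 / 2 : ℝ) • (a₀ + b₀)))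
          (gen2 a₀ b₀) (gen2 a₀ b₀))
  | c42 (c y₁ : ℝ) (L : AddSubgroup Space) (S : Set Space)
      (hL : L = adaptedLattice ((2 : ℝ) • a₀) 0 b₀ 0 c)
      (hv : IsShift L c a₀ y₁) (hS : S = cosetAt L a₀ y₁) :
      ListedCase a₀ b₀ .case42 L S
        (bandTable c y₁ (gen2 a₀ b₀) (gen2 a₀ b₀)
          (gen2 ((2 : ℝ) • a₀) b₀) (gen2 ((2 : ℝ) • a₀) b₀))
  | c43 (c y₁ : ℝ) (L : AddSubgroup Space) (S : Set Space)
      (hL : L = adaptedLattice a₀ 0 ((2 : ℝ) • b₀) 0 c)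
      (hv : IsShift L c b₀ y₁) (hS : S = cosetAt L b₀ y₁) :
      ListedCase a₀ b₀ .case43 L S
        (bandTable c y₁ (gen2 a₀ b₀) (gen2 a₀ b₀)
          (gen2 a₀ ((2 : ℝ) • b₀)) (gen2 a₀ ((2 : ℝ) • b₀)))
  -- case 5.1, with `v₁` equal to `0` or `a₀`
  | c51_zero (c y₁ : ℝ) (L : AddSubgroup Space) (S : Set Space)
      (hL : L = adaptedLattice a₀ (c / 2) b₀ 0 c)
      (hv : IsShift L c 0 y₁) (hS : S = cosetAt L 0 y₁) :
      ListedCase a₀ b₀ .case51 L S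
        (bandTable c y₁ (gen2 a₀ b₀) (gen2 ((2 : ℝ) • a₀) b₀)
          (gen2 a₀ b₀) (gen2 ((2 : ℝ) • a₀) b₀))
  | c51_a (c y₁ : ℝ) (L : AddSubgroup Space) (S : Set Space)
      (hL : L = adaptedLattice a₀ (c / 2) b₀ 0 c)
      (hv : IsShift L c a₀ y₁) (hS : S = cosetAt L a₀ y₁) :
      ListedCase a₀ b₀ .case51 L S
        (bandTable c y₁ (gen2 a₀ b₀) (gen2 a₀ b₀)
          (gen2 ((2 : ℝ) • a₀) b₀) (gen2 ((2 : ℝ) • a₀) b₀))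
  -- case 5.2, with `v₁` equal to `b₀` or `a₀ + b₀`
  | c52_b (c y₁ : ℝ) (L : AddSubgroup Space) (S : Set Space)
      (hL : L = adaptedLattice a₀ (c / 2) ((2 : ℝ) • b₀) 0 c)
      (hv : IsShift L c b₀ y₁) (hS : S = cosetAt L b₀ y₁) :
      ListedCase a₀ b₀ .case52 L S
        (bandTable c y₁ (gen2 a₀ b₀) (gen2 ((2 : ℝ) • a₀) b₀)
          (gen2 ((2 : ℝ) • a₀) (a₀ + b₀)) (gen2 ((2 : ℝ) • a₀) ((2 : ℝ) • b₀)))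
  | c52_ab (c y₁ : ℝ) (L : AddSubgroup Space) (S : Set Space)
      (hL : L = adaptedLattice a₀ (c / 2) ((2 : ℝ) • b₀) 0 c)
      (hv : IsShift L c (a₀ + b₀) y₁) (hS : S = cosetAt L (a₀ + b₀) y₁) :
      ListedCase a₀ b₀ .case52 L S
        (bandTable c y₁ (gen2 a₀ b₀) (gen2 ((2 : ℝ) • a₀) (a₀ + b₀))
          (gen2 ((2 : ℝ) • a₀) b₀) (gen2 ((2 : ℝ) • a₀) ((2 : ℝ) • b₀)))
  -- case 5.3, with `v₁` equal to `b₀ / 2` or `a₀`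
  | c53_b (c y₁ : ℝ) (L : AddSubgroup Space) (S : Set Space)
      (hL : L = adaptedLattice (a₀ - (1 / 2 : ℝ) • b₀) (c / 2) b₀ 0 c)
      (hv : IsShift L c ((1 / 2 : ℝ) • b₀) y₁) (hS : S = cosetAt L ((1 / 2 : ℝ) • b₀) y₁)
      (hy : y₁ ≠ c / 2) :
      ListedCase a₀ b₀ .case53 L S
        (bandTable c y₁ (gen2 a₀ ((1 / 2 : ℝ) • b₀)) (gen2 ((2 : ℝ) • a₀) ((1 / 2 : ℝ) • b₀))
          (gen2 a₀ b₀) (gen2 ((2 : ℝ) • a₀) b₀))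
  | c53_a (c y₁ : ℝ) (L : AddSubgroup Space) (S : Set Space)
      (hL : L = adaptedLattice (a₀ - (1 / 2 : ℝ) • b₀) (c / 2) b₀ 0 c)
      (hv : IsShift L c a₀ y₁) (hS : S = cosetAt L a₀ y₁)
      (hy : y₁ ≠ 0) :
      ListedCase a₀ b₀ .case53 L S
        (bandTable c y₁ (gen2 a₀ ((1 / 2 : ℝ) • b₀)) (gen2 a₀ b₀)
          (gen2 ((2 : ℝ) • a₀) ((1 / 2 : ℝ) • b₀)) (gen2 ((2 : ℝ) • a₀) b₀))
  -- case 5.4, with `v₁` equal to `b₀` or `a₀ / 2 + b₀`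
  | c54_b (c y₁ : ℝ) (L : AddSubgroup Space) (S : Set Space)
      (hL : L = adaptedLattice ((1 / 2 : ℝ) • a₀) (c / 2) ((2 : ℝ) • b₀) 0 c)
      (hv : IsShift L c b₀ y₁) (hS : S = cosetAt L b₀ y₁)
      (hy : y₁ ≠ 0) :
      ListedCase a₀ b₀ .case54 L S
        (bandTable c y₁ (gen2 ((1 / 2 : ℝ) • a₀) b₀) (gen2 a₀ b₀)
          (gen2 a₀ ((1 / 2 : ℝ) • a₀ + b₀)) (gen2 a₀ ((2 : ℝ) • b₀)))
  | c54_ab (c y₁ : ℝ) (L : AddSubgroup Space) (S : Set Space)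
      (hL : L = adaptedLattice ((1 / 2 : ℝ) • a₀) (c / 2) ((2 : ℝ) • b₀) 0 c)
      (hv : IsShift L c ((1 / 2 : ℝ) • a₀ + b₀) y₁)
      (hS : S = cosetAt L ((1 / 2 : ℝ) • a₀ + b₀) y₁)
      (hy : y₁ ≠ c / 2) :
      ListedCase a₀ b₀ .case54 L S
        (bandTable c y₁ (gen2 ((1 / 2 : ℝ) • a₀) b₀) (gen2 a₀ ((1 / 2 : ℝ) • a₀ + b₀))
          (gen2 a₀ b₀) (gen2 a₀ ((2 : ℝ) • b₀)))
  -- case 5.5, with `v₁` equal to `0`, `a₀ / 2`, `b₀ / 2` or `(a₀ + b₀) / 2`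
  | c55_zero (c y₁ : ℝ) (L : AddSubgroup Space) (S : Set Space)
      (hL : L = adaptedLattice ((1 / 2 : ℝ) • a₀) (c / 2) b₀ 0 c)
      (hv : IsShift L c 0 y₁) (hS : S = cosetAt L 0 y₁) :
      ListedCase a₀ b₀ .case55 L S
        (bandTable c y₁ (gen2 ((1 / 2 : ℝ) • a₀) b₀) (gen2 a₀ b₀)
          (gen2 ((1 / 2 : ℝ) • a₀) b₀) (gen2 a₀ b₀))
  | c55_a (c y₁ : ℝ) (L : AddSubgroup Space) (S : Set Space)
      (hL : L = adaptedLattice ((1 / 2 : ℝ) • a₀) (c / 2) b₀ 0 c)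
      (hv : IsShift L c ((1 / 2 : ℝ) • a₀) y₁) (hS : S = cosetAt L ((1 / 2 : ℝ) • a₀) y₁) :
      ListedCase a₀ b₀ .case55 L S
        (bandTable c y₁ (gen2 ((1 / 2 : ℝ) • a₀) b₀) (gen2 ((1 / 2 : ℝ) • a₀) b₀)
          (gen2 a₀ b₀) (gen2 a₀ b₀))
  | c55_b (c y₁ : ℝ) (L : AddSubgroup Space) (S : Set Space)
      (hL : L = adaptedLattice ((1 / 2 : ℝ) • a₀) (c / 2) b₀ 0 c)
      (hv : IsShift L c ((1 / 2 : ℝ) • b₀) y₁) (hS : S = cosetAt L ((1 / 2 : ℝ) • b₀) y₁) :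
      ListedCase a₀ b₀ .case55 L S
        (bandTable c y₁ (gen2 ((1 / 2 : ℝ) • a₀) ((1 / 2 : ℝ) • b₀))
          (gen2 a₀ ((1 / 2 : ℝ) • b₀)) (gen2 a₀ ((1 / 2 : ℝ) • (a₀ + b₀))) (gen2 a₀ b₀))
  | c55_ab (c y₁ : ℝ) (L : AddSubgroup Space) (S : Set Space)
      (hL : L = adaptedLattice ((1 / 2 : ℝ) • a₀) (c / 2) b₀ 0 c)
      (hv : IsShift L c ((1 / 2 : ℝ) • (a₀ + b₀)) y₁)
      (hS : S = cosetAt L ((1 / 2 : ℝ) • (a₀ + b₀)) y₁) :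
      ListedCase a₀ b₀ .case55 L S
        (bandTable c y₁ (gen2 ((1 / 2 : ℝ) • a₀) ((1 / 2 : ℝ) • b₀))
          (gen2 a₀ ((1 / 2 : ℝ) • (a₀ + b₀))) (gen2 a₀ ((1 / 2 : ℝ) • b₀)) (gen2 a₀ b₀))

end

section

/-! ### Coordinates in three-space -/

/-! The periods can be read off the group. By `mem_commonPeriods_iff`, `p` is a common period at
width `y₀` exactly when `(p, 0)` is a translation of `Γ`, or `(p, y₀)` lies in the `σ`-coset, or
`(0, y₀)` is a translation and some `(p, q)` lies in the lattice or in the `σ`-coset. Sufficiency is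
a change of variables: the first two motions map the band over `x` onto the band over `x + p`, and
in the third case `f` has vertical period `y₀`, so the integral over every interval of length `y₀`
is the same.

Necessity is tested on orbit sums of small bumps. Summing a bump centred at height `y₀ / 2` shows
that some `(p, q)` belongs to the lattice or to the `σ`-coset (`exists_mem_of_mem_commonPeriods`).
Summing the vertical derivative of a bump at `(x, t)` makes the band integral collapse to boundary
values: for a small radius it counts, with signs, the motions carrying `(x, t)` to the bottom and
the top of the band. For generic `x` only motions with linear part `1` or `σ` are counted, so a
period `p` satisfies `jump Γ y₀ t 0 = jump Γ y₀ t p` for all `t`. Evaluating this identity at three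
heights `t` gives the criterion (`mem_or_mem_of_jump_eq`).

The rest is lattice theory. The vertical translations form a cyclic group `cℤ`. If `c = 0`, the
`σ`-coset is empty and a lattice of periods leads to case 1. If `c > 0`, the lattice projects onto a
planar lattice and has an adapted basis with heights in `[0, c)`. Without `σ`-invariance the
`σ`-coset is empty, and cases 2.1 and 2.2 correspond to widths in and outside `cℤ`. With
`σ`-invariance each height is `0` or `c / 2`, since `z - σ z` is vertical, so the lattice is
straight or centred; and `s + σ s` is a lattice vector for `s` in the `σ`-coset, so the coset sits
at a half period. This leaves the six families of `NormalCase`, whose tables follow from the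
criterion.

A listed case is a normal case together with a choice of the row of its table that is called `M`.
Hence the list is complete (`isListed_commonPeriods`), realizable (`ListedCase.exists_group`) and
has the stated periods (`ListedCase.commonPeriods_eq`). Compatibility with `M` follows because all
rows of a table are commensurable and `M` is one of them. -/

@[simp] theorem pt_fst (x : Plane) (y : ℝ) : (pt x y).fst = x := rfl

@[simp] theorem pt_snd (x : Plane) (y : ℝ) : (pt x y).snd = y := rfl

theorem pt_eta (z : Space) : pt z.fst z.snd = z := rfl

theorem space_ext {z w : Space} (h₁ : z.fst = w.fst) (h₂ : z.snd = w.snd) : z = w := by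
  rw [← pt_eta z, ← pt_eta w, h₁, h₂]

theorem pt_inj {x x' : Plane} {y y' : ℝ} : pt x y = pt x' y' ↔ x = x' ∧ y = y' :=
  ⟨fun h => ⟨congrArg WithLp.fst h, congrArg WithLp.snd h⟩, by rintro ⟨rfl, rfl⟩; rfl⟩

theorem pt_add (x x' : Plane) (y y' : ℝ) : pt x y + pt x' y' = pt (x + x') (y + y') := rfl

theorem pt_sub (x x' : Plane) (y y' : ℝ) : pt x y - pt x' y' = pt (x - x') (y - y') := rfl

theorem pt_neg (x : Plane) (y : ℝ) : -pt x y = pt (-x) (-y) := rfl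

theorem pt_zero : pt 0 0 = 0 := rfl

theorem pt_smul (r : ℝ) (x : Plane) (y : ℝ) : r • pt x y = pt (r • x) (r * y) := rfl

theorem norm_pt_sq (x : Plane) (y : ℝ) : ‖pt x y‖ ^ 2 = ‖x‖ ^ 2 + y ^ 2 := by
  rw [WithLp.prod_norm_sq_eq_of_L2]; simp

theorem dist_fst_le (z w : Space) : dist z.fst w.fst ≤ dist z w := by
  rw [dist_eq_norm, dist_eq_norm, ← WithLp.sub_fst]; apply WithLp.norm_fst_le

theorem dist_pt_pt (x : Plane) (y y' : ℝ) : dist (pt x y) (pt x y') = |y - y'| := by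
  rw [dist_eq_norm, pt_sub, sub_self, ← abs_of_nonneg (norm_nonneg (pt 0 (y - y'))),
    ← sq_eq_sq_iff_abs_eq_abs, norm_pt_sq]
  simp

theorem pt_eq_add_smul (x : Plane) (y : ℝ) : pt x y = pt x 0 + y • pt 0 1 := by
  simp [pt_smul, pt_add]

theorem contDiff_pt {n : WithTop ℕ∞} (x : Plane) : ContDiff ℝ n (pt x) := by
  rw [funext (pt_eq_add_smul x)]
  exact contDiff_const.add (contDiff_id.smul (contDiff_const (c := pt 0 1)))

instance continuousSMul_space : ContinuousSMul ℝ Space := IsBoundedSMul.continuousSMul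

theorem hasDerivAt_pt (x : Plane) (y : ℝ) : HasDerivAt (pt x) (pt 0 1) y := by
  rw [funext (pt_eq_add_smul x)]
  have h := (HasDerivAt.smul_const (hasDerivAt_id' y) (pt 0 1)).const_add (pt x 0)
  rwa [one_smul] at h

theorem finrank_space : Module.finrank ℝ Space = 3 := by
  rw [(WithLp.linearEquiv 2 ℝ (Plane × ℝ)).finrank_eq]; simp

theorem sigma_apply (z : Space) : sigma z = pt z.fst (-z.snd) := rfl

theorem sigma_sigma (z : Space) : sigma (sigma z) = z := by
  simp [sigma_apply, pt_eta]

theorem sigma_symm : sigma.symm = sigma := by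
  ext1 z; rw [LinearIsometryEquiv.symm_apply_eq, sigma_sigma]

theorem sigma_trans_sigma : sigma.trans sigma = LinearIsometryEquiv.refl ℝ Space := by
  ext1 z; exact sigma_sigma z

theorem sigma_ne_refl : sigma ≠ LinearIsometryEquiv.refl ℝ Space := by
  intro h
  have := congrArg WithLp.snd (DFunLike.congr_fun h (pt 0 1))
  rw [sigma_pt] at this
  norm_num at this

/-! ### Euclidean motions -/

theorem motion_mul (v w : Space) (δ ε : Space ≃ₗᵢ[ℝ] Space) :
    motion v δ * motion w ε = motion (v + δ w) (ε.trans δ) := by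
  ext z : 1
  change v + δ (w + ε z) = v + δ w + δ (ε z)
  rw [map_add, add_assoc]

theorem motion_zero_refl : motion 0 (LinearIsometryEquiv.refl ℝ Space) = 1 := by
  ext z : 1; exact zero_add z

theorem motion_inv (v : Space) (δ : Space ≃ₗᵢ[ℝ] Space) :
    (motion v δ)⁻¹ = motion (-δ.symm v) δ.symm := by
  refine inv_eq_of_mul_eq_one_left ?_
  rw [motion_mul, neg_add_cancel, LinearIsometryEquiv.self_trans_symm, motion_zero_refl]

theorem motion_inj {v w : Space} {δ ε : Space ≃ₗᵢ[ℝ] Space} :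
    motion v δ = motion w ε ↔ v = w ∧ δ = ε := by
  refine ⟨fun h => ?_, by rintro ⟨rfl, rfl⟩; rfl⟩
  have h0 : v = w := by
    have := DFunLike.congr_fun h 0
    simpa [motion_apply] using this
  subst h0
  refine ⟨rfl, ?_⟩
  ext1 z
  have := DFunLike.congr_fun h z
  simpa [motion_apply] using this

theorem eq_motion (γ : EuclideanGroup) : γ = motion (γ 0) γ.linearIsometryEquiv := by
  ext z : 1
  have := γ.map_vadd 0 z
  simp only [vadd_eq_add, add_zero] at this
  rw [motion_apply, this, add_comm]

variable {Γ : Subgroup EuclideanGroup}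

theorem mem_latticeOf {v : Space} :
    v ∈ latticeOf Γ ↔ motion v (LinearIsometryEquiv.refl ℝ Space) ∈ Γ := Iff.rfl

theorem mem_sigmaCoset {v : Space} : v ∈ sigmaCoset Γ ↔ motion v sigma ∈ Γ := Iff.rfl

/-- Conjugating the translation by `l` with `γ` gives the translation by the linear part of `γ`
applied to `l`. -/
theorem linear_mem_latticeOf {γ : EuclideanGroup} (hγ : γ ∈ Γ) {l : Space}
    (hl : l ∈ latticeOf Γ) : γ.linearIsometryEquiv l ∈ latticeOf Γ := by
  rw [mem_latticeOf] at *
  have := Γ.mul_mem (Γ.mul_mem hγ hl) (Γ.inv_mem hγ)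
  convert this using 1
  rw [eq_mul_inv_iff_mul_eq]
  conv_lhs => rw [eq_motion γ]
  conv_rhs => rw [eq_motion γ]
  rw [motion_mul, motion_mul]
  exact motion_inj.2 ⟨add_comm _ _, by ext1; rfl⟩

theorem sub_mem_latticeOf_of_linear_eq {γ γ' : EuclideanGroup} (hγ : γ ∈ Γ) (hγ' : γ' ∈ Γ)
    (h : γ.linearIsometryEquiv = γ'.linearIsometryEquiv) : γ 0 - γ' 0 ∈ latticeOf Γ := by
  rw [mem_latticeOf]
  have := Γ.mul_mem hγ (Γ.inv_mem hγ')
  convert this using 1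
  rw [eq_mul_inv_iff_mul_eq]
  conv_lhs => rw [eq_motion γ']
  conv_rhs => rw [eq_motion γ]
  rw [motion_mul, h]
  exact motion_inj.2 ⟨by simp [motion_apply], by ext1; rfl⟩

theorem sub_mem_latticeOf {s s' : Space} (hs : s ∈ sigmaCoset Γ) (hs' : s' ∈ sigmaCoset Γ) :
    s - s' ∈ latticeOf Γ := by
  have h := Γ.mul_mem hs (Γ.inv_mem hs')
  rw [motion_inv, motion_mul, sigma_symm, map_neg, sigma_sigma, sigma_trans_sigma,
    ← sub_eq_add_neg] at h
  exact h

/-- The product `(s, σ)(s', σ)` is the translation by `s + σ s'`. For `s = s'` this is twice the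
horizontal part of `s`, the origin of all the halves in the list. -/
theorem add_sigma_mem_latticeOf {s s' : Space} (hs : s ∈ sigmaCoset Γ)
    (hs' : s' ∈ sigmaCoset Γ) : s + sigma s' ∈ latticeOf Γ := by
  have h := Γ.mul_mem hs hs'
  rwa [motion_mul, sigma_trans_sigma] at h

theorem add_mem_sigmaCoset {l s : Space} (hl : l ∈ latticeOf Γ) (hs : s ∈ sigmaCoset Γ) :
    l + s ∈ sigmaCoset Γ := by
  have h := Γ.mul_mem hl hs
  rwa [motion_mul] at h

theorem sigma_mem_latticeOf {s l : Space} (hs : s ∈ sigmaCoset Γ) (hl : l ∈ latticeOf Γ) :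
    sigma l ∈ latticeOf Γ := by
  have h := Γ.mul_mem hs hl
  rw [motion_mul] at h
  have h' : s + sigma l ∈ sigmaCoset Γ := h
  simpa using sub_mem_latticeOf h' hs

theorem sigmaCoset_eq_cosetAt {v : Plane} {y : ℝ} (h : pt v y ∈ sigmaCoset Γ) :
    sigmaCoset Γ = cosetAt (latticeOf Γ) v y := by
  ext z
  constructor
  · exact fun hz => ⟨z - pt v y, sub_mem_latticeOf hz h, by abel⟩
  · rintro ⟨l, hl, rfl⟩
    rw [add_comm]
    exact add_mem_sigmaCoset hl h

/-! ### Modules with two and three generators -/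

theorem mem_gen2 {E : Type*} [AddCommGroup E] [Module ℝ E] {a b z : E} :
    z ∈ gen2 a b ↔ ∃ m n : ℤ, z = (m : ℝ) • a + (n : ℝ) • b := by
  simp only [gen2, AddSubgroup.mem_closure_pair, Int.cast_smul_eq_zsmul, eq_comm]

theorem mem_gen3 {E : Type*} [AddCommGroup E] [Module ℝ E] {a b c z : E} :
    z ∈ gen3 a b c ↔ ∃ m n k : ℤ, z = (m : ℝ) • a + (n : ℝ) • b + (k : ℝ) • c := by
  have : gen3 a b c = (Submodule.span ℤ {a, b, c}).toAddSubgroup := by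
    rw [Submodule.span_int_eq_addSubgroupClosure]; rfl
  rw [this, Submodule.mem_toAddSubgroup, Submodule.mem_span_triple]
  simp only [Int.cast_smul_eq_zsmul, eq_comm]

theorem mem_adaptedLattice {a b x : Plane} {a₃ b₃ c y : ℝ} :
    pt x y ∈ adaptedLattice a a₃ b b₃ c ↔
      ∃ m n k : ℤ, x = (m : ℝ) • a + (n : ℝ) • b ∧ y = m * a₃ + n * b₃ + k * c := by
  simp only [adaptedLattice, mem_gen3, pt_smul, pt_add, pt_inj, smul_zero, add_zero]

theorem left_mem_gen2 {E : Type*} [AddCommGroup E] (a b : E) : a ∈ gen2 a b :=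
  AddSubgroup.subset_closure (by simp)

theorem right_mem_gen2 {E : Type*} [AddCommGroup E] (a b : E) : b ∈ gen2 a b :=
  AddSubgroup.subset_closure (by simp)

theorem gen2_le {E : Type*} [AddCommGroup E] {a b : E} {H : AddSubgroup E} (ha : a ∈ H)
    (hb : b ∈ H) : gen2 a b ≤ H := by
  rw [gen2, AddSubgroup.closure_le]
  rintro _ (rfl | rfl) <;> assumption

theorem gen3_le {E : Type*} [AddCommGroup E] {a b c : E} {H : AddSubgroup E} (ha : a ∈ H)
    (hb : b ∈ H) (hc : c ∈ H) : gen3 a b c ≤ H := by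
  rw [gen3, AddSubgroup.closure_le]
  rintro _ (rfl | rfl | rfl) <;> assumption

theorem gen2_eq {E : Type*} [AddCommGroup E] {a b a' b' : E} (ha : a ∈ gen2 a' b')
    (hb : b ∈ gen2 a' b') (ha' : a' ∈ gen2 a b) (hb' : b' ∈ gen2 a b) :
    gen2 a b = gen2 a' b' :=
  le_antisymm (gen2_le ha hb) (gen2_le ha' hb')

/-! ### Lattices -/

theorem IsLattice.finite_inter {E : Type*} [NormedAddCommGroup E] [NormedSpace ℝ E]
    [FiniteDimensional ℝ E] {L : AddSubgroup E} (hL : IsLattice L) {s : Set E}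
    (hs : Bornology.IsBounded s) : (s ∩ L).Finite := by
  obtain ⟨l, hl, rfl⟩ := hL
  have : ProperSpace E := FiniteDimensional.proper ℝ E
  let b := basisOfLinearIndependentOfCardEqFinrank' l hl (Fintype.card_fin _)
  have hb : ⇑b = l := by simp [b]
  have h := ZSpan.setFinite_inter b hs
  rw [hb] at h
  convert h using 2
  ext z
  rw [SetLike.mem_coe, SetLike.mem_coe, ← Submodule.mem_toAddSubgroup,
    Submodule.span_int_eq_addSubgroupClosure]

theorem isLattice_iff {E : Type*} [AddCommGroup E] [Module ℝ E] {L : AddSubgroup E} {n : ℕ}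
    (hn : Module.finrank ℝ E = n) :
    IsLattice L ↔ ∃ l : Fin n → E, LinearIndependent ℝ l ∧
      L = AddSubgroup.closure (Set.range l) := by
  subst hn; rfl

theorem finrank_plane : Module.finrank ℝ Plane = 2 := by simp

theorem isLattice_gen2 {a b : Plane} (h : LinearIndependent ℝ ![a, b]) :
    IsLattice (gen2 a b) := by
  rw [isLattice_iff finrank_plane]
  refine ⟨![a, b], h, ?_⟩
  rw [gen2, Matrix.range_cons, Matrix.range_cons, Matrix.range_empty, Set.union_empty]
  rfl

theorem isLattice_gen3 {a b c : Space} (h : LinearIndependent ℝ ![a, b, c]) :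
    IsLattice (gen3 a b c) := by
  rw [isLattice_iff finrank_space]
  refine ⟨![a, b, c], h, ?_⟩
  rw [gen3, Matrix.range_cons, Matrix.range_cons, Matrix.range_cons, Matrix.range_empty,
    Set.union_empty]
  rfl

theorem IsLattice.exists_areGenerators {M : AddSubgroup Plane} (hM : IsLattice M) :
    ∃ a b, AreGenerators a b M := by
  obtain ⟨l, hl, h⟩ := (isLattice_iff finrank_plane).1 hM
  have e : l = ![l 0, l 1] := by ext1 i; fin_cases i <;> rfl
  refine ⟨l 0, l 1, e ▸ hl, ?_⟩
  rw [h, e, gen2, Matrix.range_cons, Matrix.range_cons, Matrix.range_empty, Set.union_empty]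
  rfl

/-- The vertical translations in a lattice form a cyclic group. -/
theorem IsLattice.exists_vertical {L : AddSubgroup Space} (hL : IsLattice L) :
    ∃ c : ℝ, 0 ≤ c ∧ ∀ q : ℝ, pt 0 q ∈ L ↔ ∃ n : ℤ, q = n * c := by
  let V : AddSubgroup ℝ :=
    { carrier := {q | pt 0 q ∈ L}
      zero_mem' := L.zero_mem
      add_mem' := fun {a b} ha hb => by
        have := L.add_mem ha hb
        rwa [pt_add, add_zero] at this
      neg_mem' := fun {a} ha => by
        have := L.neg_mem ha
        rwa [pt_neg, neg_zero] at this }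
  have hV : ∀ q, q ∈ V ↔ pt 0 q ∈ L := fun q => Iff.rfl
  -- A lattice meets the unit ball in a finite set, so the vertical translations cannot accumulate
  -- at `0`.
  have hfin : {q | q ∈ V ∧ 0 < q ∧ q < 1}.Finite := by
    refine ((hL.finite_inter (Metric.isBounded_closedBall (x := (0 : Space)) (r := 1))).image
      WithLp.snd).subset ?_
    rintro q ⟨hq, h0, h1⟩
    refine ⟨pt 0 q, ⟨?_, hq⟩, rfl⟩
    rw [Metric.mem_closedBall, ← pt_zero, dist_pt_pt, sub_zero, abs_of_pos h0]
    exact h1.le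
  obtain ⟨a, ha, hd⟩ : ∃ a : ℝ, 0 < a ∧ Disjoint (V : Set ℝ) (Set.Ioo 0 a) := by
    have h1 : ∀ᶠ a : ℝ in nhdsWithin 0 (Set.Ioi 0), ∀ q ∈ {q | q ∈ V ∧ 0 < q ∧ q < 1}, a < q :=
      (Filter.eventually_all_finite hfin).2 fun q hq =>
        Filter.Eventually.filter_mono nhdsWithin_le_nhds (eventually_lt_nhds hq.2.1)
    have h2 : ∀ᶠ a : ℝ in nhdsWithin 0 (Set.Ioi 0), a < 1 :=
      Filter.Eventually.filter_mono nhdsWithin_le_nhds (eventually_lt_nhds one_pos)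
    obtain ⟨a, ⟨h1, h2⟩, h3⟩ := ((h1.and h2).and self_mem_nhdsWithin).exists
    refine ⟨a, h3, Set.disjoint_left.2 fun q hq hqa => ?_⟩
    exact absurd (h1 q ⟨hq, hqa.1, hqa.2.trans h2⟩) (not_lt.2 hqa.2.le)
  obtain ⟨b, hb⟩ := AddSubgroup.cyclic_of_isolated_zero ha hd
  have key : ∀ q : ℝ, pt 0 q ∈ L ↔ ∃ n : ℤ, q = n * b := fun q => by
    rw [← hV, hb, AddSubgroup.mem_closure_singleton]
    simp only [zsmul_eq_mul, eq_comm]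
  -- The generator may have either sign; it is `0` when there are no vertical translations.
  rcases le_total 0 b with h | h
  · exact ⟨b, h, key⟩
  · refine ⟨-b, neg_nonneg.2 h, fun q => (key q).trans ⟨?_, ?_⟩⟩
    · rintro ⟨n, rfl⟩; exact ⟨-n, by push_cast; ring⟩
    · rintro ⟨n, rfl⟩; exact ⟨-n, by push_cast; ring⟩

/-! ### Discreteness of crystallographic groups and generic points -/

/-- A motion is determined by its linear part and its value at `0`. Linear parts send each generator
of the lattice to one of finitely many lattice vectors of the same length or shorter; two elements
with equal linear parts differ by a lattice vector, of length at most `2 * R` here. -/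
theorem IsCrystallographic.finite_near (hΓ : IsCrystallographic Γ) (z w : Space) (R : ℝ) :
    {γ | γ ∈ Γ ∧ dist (γ z) w ≤ R}.Finite := by
  obtain ⟨l, hl, hL⟩ := id hΓ
  have hmem : ∀ i, l i ∈ latticeOf Γ := fun i => by
    rw [hL]; exact AddSubgroup.subset_closure ⟨i, rfl⟩
  have hspan : Submodule.span ℝ (Set.range l) = ⊤ :=
    hl.span_eq_top_of_card_eq_finrank' (Fintype.card_fin _)
  refine Set.Finite.of_finite_fibers AffineIsometryEquiv.linearIsometryEquiv ?_ ?_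
  · have hfin : (Set.univ.pi fun i =>
        Metric.closedBall (0 : Space) ‖l i‖ ∩ latticeOf Γ).Finite :=
      Set.Finite.pi fun i => hΓ.finite_inter Metric.isBounded_closedBall
    refine Set.Finite.of_finite_image (f := fun δ i => δ (l i)) (hfin.subset ?_) ?_
    · rintro _ ⟨_, ⟨γ, hγ, rfl⟩, rfl⟩ i -
      refine ⟨?_, linear_mem_latticeOf hγ.1 (hmem i)⟩
      rw [mem_closedBall_zero_iff, LinearIsometryEquiv.norm_map]
    · intro δ _ ε _ h
      have : δ.toLinearEquiv.toLinearMap = ε.toLinearEquiv.toLinearMap := by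
        refine LinearMap.ext_on hspan ?_
        rintro _ ⟨i, rfl⟩
        exact congrFun h i
      ext1 v
      exact LinearMap.congr_fun this v
  · rintro _ ⟨γ₁, hγ₁, rfl⟩
    have hfin := hΓ.finite_inter (Metric.isBounded_closedBall (x := (0 : Space)) (r := 2 * R))
    refine Set.Finite.of_finite_image (f := fun γ : EuclideanGroup => γ 0 - γ₁ 0)
      (hfin.subset ?_) ?_
    · rintro _ ⟨γ, ⟨hγ, hlin⟩, rfl⟩
      refine ⟨?_, sub_mem_latticeOf_of_linear_eq hγ.1 hγ₁.1 hlin⟩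
      -- Motions with the same linear part differ by a constant, which can be measured at `z`
      -- instead of `0`.
      have e : γ 0 - γ₁ 0 = γ z - γ₁ z := by
        rw [eq_motion γ, eq_motion γ₁, show γ.linearIsometryEquiv = _ from hlin]
        simp [motion_apply]
      rw [mem_closedBall_zero_iff]
      dsimp only
      rw [e, ← dist_eq_norm]
      calc dist (γ z) (γ₁ z) ≤ dist (γ z) w + dist (γ₁ z) w := dist_triangle_right _ _ _
        _ ≤ 2 * R := by linarith [hγ.2, hγ₁.2]
    · rintro γ ⟨-, hγ⟩ γ' ⟨-, hγ'⟩ h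
      rw [eq_motion γ, eq_motion γ', motion_inj]
      exact ⟨by simpa using h, hγ.trans hγ'.symm⟩

/-- Exhaustion by the finite sets of elements moving `0` by at most `n`. Countability allows null
sets attached to the elements of `Γ` to be united. -/
theorem IsCrystallographic.countable (hΓ : IsCrystallographic Γ) :
    (Γ : Set EuclideanGroup).Countable := by
  refine (Set.countable_iUnion fun n : ℕ => (hΓ.finite_near 0 0 n).countable).mono ?_
  intro γ hγ
  obtain ⟨n, hn⟩ := exists_nat_ge (dist (γ 0) 0)
  exact Set.mem_iUnion.2 ⟨n, hγ, hn⟩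

/-- Comparing norms, `δ` fixes every horizontal vector; then it sends the vertical unit vector to a
vertical unit vector, which leaves only the sign. -/
theorem eq_refl_or_eq_sigma (δ : Space ≃ₗᵢ[ℝ] Space) (h : ∀ x, (δ (pt x 0)).fst = x) :
    δ = LinearIsometryEquiv.refl ℝ Space ∨ δ = sigma := by
  have h1 : ∀ x, δ (pt x 0) = pt x 0 := fun x => by
    have hn : ‖δ (pt x 0)‖ ^ 2 = ‖pt x 0‖ ^ 2 := by rw [δ.norm_map]
    rw [← pt_eta (δ (pt x 0)), norm_pt_sq, norm_pt_sq, h] at hn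
    refine space_ext (h x) ?_
    have : (δ (pt x 0)).snd ^ 2 = 0 := by linarith
    simpa using this
  -- With `w` the image of the vertical unit vector, comparing norms for `(0, 1)` and for `(0, 1) -
  -- (w.fst, 0)` gives `‖w.fst‖² + w.snd² = 1` and `w.snd² = ‖w.fst‖² + 1`.
  have h2 : (δ (pt 0 1)).fst = 0 := by
    set w := δ (pt 0 1)
    have hn : ‖δ (pt 0 1 - pt w.fst 0)‖ ^ 2 = ‖pt 0 1 - pt w.fst 0‖ ^ 2 := by rw [δ.norm_map]
    have hw : ‖w‖ ^ 2 = ‖pt 0 1‖ ^ 2 := by rw [δ.norm_map]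
    rw [map_sub, h1, ← pt_eta (δ (pt 0 1)), pt_sub, pt_sub, norm_pt_sq, norm_pt_sq] at hn
    rw [← pt_eta w, norm_pt_sq, norm_pt_sq] at hw
    change ‖w.fst - w.fst‖ ^ 2 + (w.snd - 0) ^ 2 = _ at hn
    simp only [sub_self, norm_zero, zero_sub, norm_neg, sub_zero] at hn hw
    have : ‖w.fst‖ ^ 2 = 0 := by nlinarith
    simpa using this
  have h3 : (δ (pt 0 1)).snd = 1 ∨ (δ (pt 0 1)).snd = -1 := by
    have hn : ‖δ (pt 0 1)‖ ^ 2 = ‖pt 0 1‖ ^ 2 := by rw [δ.norm_map]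
    rw [← pt_eta (δ (pt 0 1)), norm_pt_sq, norm_pt_sq, h2] at hn
    rw [norm_zero] at hn
    exact sq_eq_one_iff.1 (by linarith)
  have key : ∀ z, δ z = pt z.fst 0 + z.snd • δ (pt 0 1) := fun z => by
    conv_lhs => rw [← pt_eta z, pt_eq_add_smul, map_add, map_smul, h1]
  rcases h3 with h3 | h3
  · left
    ext1 z
    rw [key, ← pt_eta (δ (pt 0 1)), h2, h3, ← pt_eq_add_smul]
    rfl
  · right
    ext1 z
    rw [key, ← pt_eta (δ (pt 0 1)), h2, h3, pt_smul, pt_add, sigma_apply]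
    simp

/-- The set is empty or a translate of the kernel of `x ↦ (δ (x, 0)).fst - x`, with `δ` the linear
part of `γ`; by `eq_refl_or_eq_sigma` this kernel is a proper subspace, hence null. -/
theorem volume_fst_eq_zero {γ : EuclideanGroup} (t : ℝ) (p : Plane)
    (hγ : ¬ (γ.linearIsometryEquiv = LinearIsometryEquiv.refl ℝ Space ∨
      γ.linearIsometryEquiv = sigma)) :
    MeasureTheory.volume {x : Plane | (γ (pt x t)).fst = x + p} = 0 := by
  rcases Set.eq_empty_or_nonempty {x : Plane | (γ (pt x t)).fst = x + p} with h | ⟨x₁, hx₁⟩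
  · rw [h, MeasureTheory.measure_empty]
  let N : Plane →ₗ[ℝ] Plane :=
    { toFun := fun x => (γ.linearIsometryEquiv (pt x 0)).fst - x
      map_add' := fun x y => by
        rw [← add_zero (0 : ℝ), ← pt_add, map_add, WithLp.add_fst, add_zero]; abel
      map_smul' := fun r x => by
        rw [← mul_zero r, ← pt_smul, map_smul, WithLp.smul_fst, mul_zero, smul_sub]; rfl }
  have hN : LinearMap.ker N ≠ ⊤ := fun h => hγ <| eq_refl_or_eq_sigma _ fun x => by
    have : N x = 0 := by rw [← LinearMap.mem_ker, h]; trivial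
    exact sub_eq_zero.1 this
  have e : {x : Plane | (γ (pt x t)).fst = x + p} =
      (fun x => x + -x₁) ⁻¹' (LinearMap.ker N : Set Plane) := by
    ext x
    have h1 : (γ (pt x t)).fst - (γ (pt x₁ t)).fst =
        (γ.linearIsometryEquiv (pt (x + -x₁) 0)).fst := by
      rw [← WithLp.sub_fst, eq_motion γ, motion_apply, motion_apply, add_sub_add_left_eq_sub,
        ← map_sub, pt_sub, sub_self, ← sub_eq_add_neg, ← eq_motion γ]
    have h2 : (γ (pt x₁ t)).fst = x₁ + p := hx₁
    rw [h2] at h1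
    rw [Set.mem_preimage, SetLike.mem_coe, LinearMap.mem_ker]
    change _ ↔ (γ.linearIsometryEquiv (pt (x + -x₁) 0)).fst - (x + -x₁) = 0
    rw [← h1, Set.mem_ofPred_eq, ← sub_eq_zero]
    have : (γ (pt x t)).fst - (x + p) = (γ (pt x t)).fst - (x₁ + p) - (x + -x₁) := by abel
    rw [this]
  rw [e, MeasureTheory.measure_preimage_add_right]
  exact MeasureTheory.Measure.addHaar_submodule _ _ hN

/-- A motion of the group that moves a generic point within its vertical line, or into the line
translated by `p`, has linear part `1` or `σ`. -/
theorem IsCrystallographic.exists_generic (hΓ : IsCrystallographic Γ) (t : ℝ) (p : Plane) :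
    ∃ x : Plane, ∀ γ ∈ Γ, ((γ (pt x t)).fst = x + 0 ∨ (γ (pt x t)).fst = x + p) →
      γ.linearIsometryEquiv = LinearIsometryEquiv.refl ℝ Space ∨
        γ.linearIsometryEquiv = sigma := by
  have h : ∀ᵐ x : Plane, ∀ γ ∈ Γ, ((γ (pt x t)).fst = x + 0 ∨ (γ (pt x t)).fst = x + p) →
      γ.linearIsometryEquiv = LinearIsometryEquiv.refl ℝ Space ∨
        γ.linearIsometryEquiv = sigma := by
    refine (MeasureTheory.ae_ball_iff hΓ.countable).2 fun γ _ => ?_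
    by_cases hγ : γ.linearIsometryEquiv = LinearIsometryEquiv.refl ℝ Space ∨
        γ.linearIsometryEquiv = sigma
    · exact Filter.Eventually.of_forall fun _ _ => hγ
    · have h1 := volume_fst_eq_zero t 0 hγ
      have h2 := volume_fst_eq_zero t p hγ
      filter_upwards [MeasureTheory.measure_eq_zero_iff_ae_notMem.1 h1,
        MeasureTheory.measure_eq_zero_iff_ae_notMem.1 h2] with x hx1 hx2 hx
      exact absurd hx (not_or.2 ⟨hx1, hx2⟩)
  exact h.exists

/-! ### Sums over the group -/

/-- The sum of the translates of a function by the elements of a group. -/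
noncomputable def orbitSum (Γ : Subgroup EuclideanGroup) (ψ : Space → ℝ) (z : Space) : ℝ :=
  ∑ᶠ g : Γ, ψ ((g : EuclideanGroup)⁻¹ z)

theorem dist_inv_apply (g : EuclideanGroup) (z w : Space) : dist (g⁻¹ z) w = dist (g w) z := by
  rw [← g.dist_map (g⁻¹ z) w, AffineIsometryEquiv.coe_inv, AffineIsometryEquiv.apply_symm_apply,
    dist_comm]

theorem contDiff_inv_apply {n : WithTop ℕ∞} (g : EuclideanGroup) :
    ContDiff ℝ n fun z => g⁻¹ z :=
  (g⁻¹).toContinuousAffineEquiv.toContinuousAffineMap.contDiff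

/-- Near `z` only the finitely many elements carrying `z₀` to within `ε + 1` of `z` contribute, so
the sum is locally finite and inherits the regularity of `ψ`. Left multiplication by `γ` merely
reindexes it. -/
theorem orbitSum_mem_invariantFunctions (hΓ : IsCrystallographic Γ) {ψ : Space → ℝ}
    (hψ : ContDiff ℝ 1 ψ) {z₀ : Space} {ε : ℝ} (hs : ∀ w, ψ w ≠ 0 → dist w z₀ ≤ ε) :
    orbitSum Γ ψ ∈ invariantFunctions Γ := by
  constructor
  · rw [← contMDiff_iff_contDiff]
    refine contMDiff_finsum (fun g : Γ => (hψ.comp (contDiff_inv_apply _)).contMDiff) ?_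
    intro z
    refine ⟨Metric.ball z 1, Metric.ball_mem_nhds z one_pos, ?_⟩
    refine Set.Finite.of_finite_image (f := ((↑) : Γ → EuclideanGroup))
      ((hΓ.finite_near z₀ z (ε + 1)).subset ?_) Subtype.val_injective.injOn
    rintro _ ⟨g, ⟨w, hw, hwz⟩, rfl⟩
    refine ⟨g.2, ?_⟩
    have h1 := hs _ hw
    rw [dist_inv_apply] at h1
    calc dist ((g : EuclideanGroup) z₀) z ≤ dist ((g : EuclideanGroup) z₀) w + dist w z :=
          dist_triangle _ _ _
      _ ≤ ε + 1 := add_le_add h1 (Metric.mem_ball.1 hwz).le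
  · intro γ hγ z
    refine finsum_eq_of_bijective (fun g : Γ => (⟨γ, hγ⟩ : Γ) * g)
      (Group.mulLeft_bijective _) fun g => ?_
    simp only [Subgroup.coe_mul, mul_inv_rev]
    rfl

/-- The segment over `x` stays within `y₀` of `(x, 0)`, so elements outside `T` contribute nothing
along it and the integral may be taken termwise. -/
theorem bandProjection_orbitSum {ψ : Space → ℝ}
    (hψ : Continuous ψ) {z₀ : Space} {ε y₀ : ℝ} (hs : ∀ w, ψ w ≠ 0 → dist w z₀ ≤ ε)
    (hy : 0 < y₀) (x : Plane) (T : Finset Γ)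
    (hT : ∀ g : Γ, dist ((g : EuclideanGroup) z₀) (pt x 0) ≤ ε + y₀ → g ∈ T) :
    bandProjection y₀ (orbitSum Γ ψ) x =
      ∑ g ∈ T, ∫ y in (0 : ℝ)..y₀, ψ ((g : EuclideanGroup)⁻¹ (pt x y)) := by
  rw [← intervalIntegral.integral_finsetSum]
  · refine intervalIntegral.integral_congr fun y hyI => ?_
    rw [Set.uIcc_of_le hy.le] at hyI
    refine finsum_eq_sum_of_support_subset _ fun g hg => hT g ?_
    have h1 := hs _ hg
    rw [dist_inv_apply] at h1
    refine (dist_triangle _ (pt x y) _).trans (add_le_add h1 ?_)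
    rw [dist_pt_pt, sub_zero, abs_of_nonneg hyI.1]
    exact hyI.2
  · intro g _
    refine Continuous.intervalIntegrable ?_ _ _
    exact hψ.comp ((contDiff_inv_apply (n := 0) _).continuous.comp
      (contDiff_pt (n := 0) x).continuous)

/-! ### The jump relation -/

open Classical in
/-- The indicator of a proposition. -/
noncomputable def truthValue (P : Prop) : ℝ := if P then 1 else 0

theorem truthValue_pos {P : Prop} (h : P) : truthValue P = 1 := if_pos h

theorem truthValue_neg {P : Prop} (h : ¬ P) : truthValue P = 0 := if_neg h

theorem truthValue_nonneg (P : Prop) : 0 ≤ truthValue P := by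
  unfold truthValue; split_ifs <;> norm_num

theorem truthValue_congr {P Q : Prop} (h : P ↔ Q) : truthValue P = truthValue Q := by
  rw [propext h]

theorem sum_truthValue_eq {T : Finset Γ} (m : EuclideanGroup) (h : ∀ g : Γ, ↑g = m → g ∈ T) :
    ∑ g ∈ T, truthValue ((g : EuclideanGroup) = m) = truthValue (m ∈ Γ) := by
  classical
  by_cases hm : m ∈ Γ
  · rw [Finset.sum_eq_single_of_mem (⟨m, hm⟩ : Γ) (h _ rfl)
      fun g _ hg => truthValue_neg fun h => hg (Subtype.ext h), truthValue_pos rfl,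
      truthValue_pos hm]
  · rw [truthValue_neg hm]
    exact Finset.sum_eq_zero fun g _ => truthValue_neg fun h => hm (h ▸ g.2)

/-- The vertical derivative. -/
noncomputable def verticalDeriv (Φ : Space → ℝ) (w : Space) : ℝ := fderiv ℝ Φ w (pt 0 1)

theorem contDiff_verticalDeriv {Φ : Space → ℝ} (hΦ : ContDiff ℝ 2 Φ) :
    ContDiff ℝ 1 (verticalDeriv Φ) :=
  (hΦ.fderiv_right (m := 1) (by norm_num)).clm_apply contDiff_const

theorem verticalDeriv_bump_ne_zero {z₀ : Space} (Φ : ContDiffBump z₀) (w : Space)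
    (hw : verticalDeriv Φ w ≠ 0) : dist w z₀ ≤ Φ.rOut := by
  have h : w ∈ Function.support (fderiv ℝ Φ) := fun h => hw (by rw [verticalDeriv, h]; rfl)
  have := support_fderiv_subset ℝ h
  rwa [Φ.tsupport_eq] at this

theorem hasDerivAt_comp_pt {Φ : Space → ℝ} (hΦ : ContDiff ℝ 2 Φ) (x : Plane) (y : ℝ) :
    HasDerivAt (fun y => Φ (pt x y)) (verticalDeriv Φ (pt x y)) y :=
  ((hΦ.differentiable (by norm_num)) (pt x y)).hasFDerivAt.comp_hasDerivAt y (hasDerivAt_pt x y)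

theorem continuous_verticalDeriv_pt {Φ : Space → ℝ} (hΦ : ContDiff ℝ 2 Φ) (x : Plane) :
    Continuous fun y => verticalDeriv Φ (pt x y) :=
  (contDiff_verticalDeriv hΦ).continuous.comp (contDiff_pt (n := 0) x).continuous

theorem integral_verticalDeriv {Φ : Space → ℝ} (hΦ : ContDiff ℝ 2 Φ) (x : Plane) (a b : ℝ) :
    ∫ y in a..b, verticalDeriv Φ (pt x y) = Φ (pt x b) - Φ (pt x a) :=
  intervalIntegral.integral_eq_sub_of_hasDerivAt (fun y _ => hasDerivAt_comp_pt hΦ x y)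
    ((continuous_verticalDeriv_pt hΦ x).intervalIntegrable _ _)

theorem integral_verticalDeriv_translation {Φ : Space → ℝ} (hΦ : ContDiff ℝ 2 Φ) (v : Space)
    (x : Plane) (y₀ : ℝ) :
    ∫ y in (0 : ℝ)..y₀, verticalDeriv Φ ((motion v (LinearIsometryEquiv.refl ℝ Space))⁻¹ (pt x y))
      = Φ ((motion v (LinearIsometryEquiv.refl ℝ Space))⁻¹ (pt x y₀)) -
        Φ ((motion v (LinearIsometryEquiv.refl ℝ Space))⁻¹ (pt x 0)) := by
  have e : ∀ y, (motion v (LinearIsometryEquiv.refl ℝ Space))⁻¹ (pt x y) =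
      pt (x - v.fst) (y - v.snd) := fun y => by
    rw [motion_inv, motion_apply, neg_add_eq_sub]; rfl
  simp only [e]
  rw [intervalIntegral.integral_comp_sub_right fun y => verticalDeriv Φ (pt (x - v.fst) y),
    integral_verticalDeriv hΦ]

/-- A reflection reverses the segment, so the two end values exchange signs compared with a
translation; hence the opposite signs of the `σ`-terms in `jump`. -/
theorem integral_verticalDeriv_reflection {Φ : Space → ℝ} (hΦ : ContDiff ℝ 2 Φ) (v : Space)
    (x : Plane) (y₀ : ℝ) :
    ∫ y in (0 : ℝ)..y₀, verticalDeriv Φ ((motion v sigma)⁻¹ (pt x y))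
      = Φ ((motion v sigma)⁻¹ (pt x 0)) - Φ ((motion v sigma)⁻¹ (pt x y₀)) := by
  have e : ∀ y, (motion v sigma)⁻¹ (pt x y) = pt (x - v.fst) (v.snd - y) := fun y => by
    rw [motion_inv, motion_apply, sigma_symm, neg_add_eq_sub, ← map_sub, ← pt_eta v, pt_sub,
      sigma_pt]
    simp
  simp only [e]
  rw [intervalIntegral.integral_comp_sub_left fun y => verticalDeriv Φ (pt (x - v.fst) y),
    integral_verticalDeriv hΦ]

theorem bump_eq_truthValue {z₀ w : Space} (Φ : ContDiffBump z₀)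
    (h : w ≠ z₀ → Φ.rOut < dist w z₀) : Φ w = truthValue (w = z₀) := by
  by_cases hw : w = z₀
  · rw [truthValue_pos hw, hw]; exact Φ.one_of_mem_closedBall (Metric.mem_closedBall_self Φ.rIn_pos.le)
  · rw [truthValue_neg hw]; exact Φ.zero_of_le_dist (h hw).le

/-- Among the motions with linear part `δ` exactly one carries `z` to `w`. -/
theorem eq_motion_iff {g : EuclideanGroup} {z w : Space} {δ : Space ≃ₗᵢ[ℝ] Space}
    (h : g.linearIsometryEquiv = δ) : g = motion (w - δ z) δ ↔ g⁻¹ w = z := by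
  rw [AffineIsometryEquiv.coe_inv, AffineIsometryEquiv.symm_apply_eq, eq_motion g, h, motion_inj,
    motion_apply]
  constructor
  · rintro ⟨h, -⟩; rw [h, sub_add_cancel]
  · intro h; exact ⟨by rw [h, add_sub_cancel_right], rfl⟩

theorem ne_motion {g : EuclideanGroup} {v : Space} {δ : Space ≃ₗᵢ[ℝ] Space}
    (h : g.linearIsometryEquiv ≠ δ) : g ≠ motion v δ := by
  rw [eq_motion g, Ne, motion_inj]; exact fun h' => h h'.2

/-- The jumps of the projected orbit of a point at height `t`, on the line translated by `p`. -/
noncomputable def jump (Γ : Subgroup EuclideanGroup) (y₀ t : ℝ) (p : Plane) : ℝ :=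
  truthValue (pt p (y₀ - t) ∈ latticeOf Γ) - truthValue (pt p (-t) ∈ latticeOf Γ) +
    truthValue (pt p t ∈ sigmaCoset Γ) - truthValue (pt p (y₀ + t) ∈ sigmaCoset Γ)

theorem eventually_lt_of_pos {ι : Type*} (T : Finset ι) (f : ι → ℝ) :
    ∀ᶠ ε : ℝ in nhdsWithin 0 (Set.Ioi 0), ∀ i ∈ T, 0 < f i → ε < f i :=
  (Filter.eventually_all_finset T).2 fun i _ => by
    by_cases h : 0 < f i
    · exact Filter.Eventually.filter_mono nhdsWithin_le_nhds
        ((eventually_lt_nhds h).mono fun _ h _ => h)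
    · exact Filter.Eventually.of_forall fun _ h' => absurd h' h

/-- Only finitely many elements of `Γ` move `z` into a given ball. -/
theorem IsCrystallographic.exists_finset (hΓ : IsCrystallographic Γ) (z w : Space) (R : ℝ) :
    ∃ T : Finset Γ, ∀ g : Γ, dist ((g : EuclideanGroup) z) w ≤ R → g ∈ T := by
  have hfin : {g : Γ | dist ((g : EuclideanGroup) z) w ≤ R}.Finite :=
    Set.Finite.of_finite_image (f := ((↑) : Γ → EuclideanGroup))
      ((hΓ.finite_near z w R).subset (by rintro _ ⟨g, hg, rfl⟩; exact ⟨g.2, hg⟩))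
      Subtype.val_injective.injOn
  exact ⟨hfin.toFinset, fun g hg => hfin.mem_toFinset.2 hg⟩

theorem pt_sub_refl (x p : Plane) (y t : ℝ) :
    pt (x + p) y - LinearIsometryEquiv.refl ℝ Space (pt x t) = pt p (y - t) := by
  rw [LinearIsometryEquiv.coe_refl, id, pt_sub, add_sub_cancel_left]

theorem pt_sub_sigma (x p : Plane) (y t : ℝ) :
    pt (x + p) y - sigma (pt x t) = pt p (y + t) := by
  rw [sigma_pt, pt_sub, add_sub_cancel_left, sub_neg_eq_add]

/-- When the radius is below every positive distance involved, the integral reduces to the values of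
`Φ` at the preimages of the two end points, and each value is `1` or `0` according to whether `g`
carries `(x, t)` to that end point. At most the two terms with the linear part of `g` survive. -/
theorem integral_verticalDeriv_bump {y₀ t : ℝ} {x p : Plane} (Φ : ContDiffBump (pt x t))
    (g : EuclideanGroup)
    (hx : (g (pt x t)).fst = x + p →
      g.linearIsometryEquiv = LinearIsometryEquiv.refl ℝ Space ∨ g.linearIsometryEquiv = sigma)
    (hfib : 0 < dist (g (pt x t)).fst (x + p) → Φ.rOut < dist (g (pt x t)).fst (x + p))
    (h0 : 0 < dist (g⁻¹ (pt (x + p) 0)) (pt x t) → Φ.rOut < dist (g⁻¹ (pt (x + p) 0)) (pt x t))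
    (hy0 : 0 < dist (g⁻¹ (pt (x + p) y₀)) (pt x t) →
      Φ.rOut < dist (g⁻¹ (pt (x + p) y₀)) (pt x t)) :
    ∫ y in (0 : ℝ)..y₀, verticalDeriv Φ (g⁻¹ (pt (x + p) y)) =
      truthValue (g = motion (pt p (y₀ - t)) (LinearIsometryEquiv.refl ℝ Space)) -
      truthValue (g = motion (pt p (0 - t)) (LinearIsometryEquiv.refl ℝ Space)) +
      truthValue (g = motion (pt p (0 + t)) sigma) -
      truthValue (g = motion (pt p (y₀ + t)) sigma) := by
  have hC : ContDiff ℝ 2 Φ := Φ.contDiff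
  rw [← pt_sub_refl x, ← pt_sub_refl x, ← pt_sub_sigma x, ← pt_sub_sigma x]
  replace h0 := bump_eq_truthValue Φ fun h => h0 (dist_pos.2 h)
  replace hy0 := bump_eq_truthValue Φ fun h => hy0 (dist_pos.2 h)
  by_cases hf : (g (pt x t)).fst = x + p
  · rcases hx hf with h | h
    · have h' : g.linearIsometryEquiv ≠ sigma := by rw [h]; exact sigma_ne_refl.symm
      rw [truthValue_congr (eq_motion_iff h), truthValue_congr (eq_motion_iff h),
        truthValue_neg (ne_motion h'), truthValue_neg (ne_motion h'), ← h0, ← hy0, eq_motion g, h,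
        integral_verticalDeriv_translation hC]
      ring
    · have h' : g.linearIsometryEquiv ≠ LinearIsometryEquiv.refl ℝ Space := by
        rw [h]; exact sigma_ne_refl
      rw [truthValue_congr (eq_motion_iff h), truthValue_congr (eq_motion_iff h),
        truthValue_neg (ne_motion h'), truthValue_neg (ne_motion h'), ← h0, ← hy0, eq_motion g, h,
        integral_verticalDeriv_reflection hC]
      ring
  -- If `g` does not carry `(x, t)` into the line over `x + p`, the support of the translated bump
  -- misses that line, so both sides vanish.
  · have hne : ∀ y δ, g ≠ motion (pt (x + p) y - δ (pt x t)) δ := by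
      rintro y δ rfl
      apply hf
      rw [motion_apply, sub_add_cancel, pt_fst]
    rw [truthValue_neg (hne _ _), truthValue_neg (hne _ _), truthValue_neg (hne _ _),
      truthValue_neg (hne _ _), intervalIntegral.integral_congr (g := fun _ => (0 : ℝ))]
    · simp
    · intro y _
      by_contra hne
      have h2 := verticalDeriv_bump_ne_zero Φ _ hne
      rw [dist_inv_apply] at h2
      have h3 := dist_fst_le (g (pt x t)) (pt (x + p) y)
      exact absurd (hfib (dist_pos.2 hf)) (not_lt.2 (h3.trans h2))

/-- The radius has to be small only for the finitely many elements of `T`. Each of the four motions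
is met at most once in the sum, so the sums of truth values become membership in the lattice and in
the `σ`-coset. -/
theorem bandProjection_eq_jump (hΓ : IsCrystallographic Γ) {y₀ t : ℝ} (hy : 0 < y₀)
    {x p : Plane}
    (hx : ∀ γ ∈ Γ, (γ (pt x t)).fst = x + p →
      γ.linearIsometryEquiv = LinearIsometryEquiv.refl ℝ Space ∨ γ.linearIsometryEquiv = sigma) :
    ∀ᶠ ε : ℝ in nhdsWithin 0 (Set.Ioi 0), ∀ Φ : ContDiffBump (pt x t), Φ.rOut = ε →
      bandProjection y₀ (orbitSum Γ (verticalDeriv Φ)) (x + p) = jump Γ y₀ t p := by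
  obtain ⟨T, hT⟩ := hΓ.exists_finset (pt x t) (pt (x + p) 0) (1 + y₀)
  have h1 : ∀ᶠ ε : ℝ in nhdsWithin 0 (Set.Ioi 0), ε < 1 :=
    Filter.Eventually.filter_mono nhdsWithin_le_nhds (eventually_lt_nhds one_pos)
  filter_upwards [h1,
    eventually_lt_of_pos T fun g => dist ((g : EuclideanGroup) (pt x t)).fst (x + p),
    eventually_lt_of_pos T fun g => dist ((g : EuclideanGroup)⁻¹ (pt (x + p) 0)) (pt x t),
    eventually_lt_of_pos T fun g => dist ((g : EuclideanGroup)⁻¹ (pt (x + p) y₀)) (pt x t)]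
    with ε hε1 hfib h0 hy0 Φ hΦ
  subst hΦ
  have hC : ContDiff ℝ 2 Φ := Φ.contDiff
  rw [bandProjection_orbitSum (contDiff_verticalDeriv hC).continuous
    (verticalDeriv_bump_ne_zero Φ) hy (x + p) T fun g hg => hT g (hg.trans (by linarith))]
  rw [Finset.sum_congr rfl fun (g : Γ) hg => integral_verticalDeriv_bump Φ (g : EuclideanGroup)
    (hx g g.2) (hfib g hg) (h0 g hg) (hy0 g hg)]
  -- A motion of `Γ` carrying `(x, t)` to a point of the segment is among those collected in `T`, so
  -- no term is lost.
  have hmem : ∀ y δ, 0 ≤ y → y ≤ y₀ →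
      ∀ g : Γ, (g : EuclideanGroup) = motion (pt (x + p) y - δ (pt x t)) δ → g ∈ T := by
    intro y δ hy1 hy2 g hg
    refine hT g ?_
    rw [hg, motion_apply, sub_add_cancel, dist_pt_pt, sub_zero, abs_of_nonneg hy1]
    linarith
  simp only [Finset.sum_add_distrib, Finset.sum_sub_distrib]
  rw [sum_truthValue_eq _ (by rw [← pt_sub_refl x]; exact hmem _ _ hy.le le_rfl),
    sum_truthValue_eq _ (by rw [← pt_sub_refl x]; exact hmem _ _ le_rfl hy.le),
    sum_truthValue_eq _ (by rw [← pt_sub_sigma x]; exact hmem _ _ le_rfl hy.le),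
    sum_truthValue_eq _ (by rw [← pt_sub_sigma x]; exact hmem _ _ hy.le le_rfl), zero_sub, zero_add]
  simp only [jump, mem_latticeOf, mem_sigmaCoset]


/-- One generic `x` and one radius serve both lines, over `x` and over `x + p`; the orbit sum of the
vertical derivative of the bump is the test function. -/
theorem jump_eq_of_mem_commonPeriods (hΓ : IsCrystallographic Γ) {y₀ : ℝ} (hy : 0 < y₀)
    {p : Plane} (hp : p ∈ commonPeriods Γ y₀) (t : ℝ) : jump Γ y₀ t 0 = jump Γ y₀ t p := by
  obtain ⟨x, hx⟩ := hΓ.exists_generic t p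
  have h0 := bandProjection_eq_jump hΓ hy fun γ hγ h => hx γ hγ (Or.inl h)
  have h1 := bandProjection_eq_jump hΓ hy fun γ hγ h => hx γ hγ (Or.inr h)
  obtain ⟨ε, ⟨h0, h1⟩, hε⟩ := ((h0.and h1).and self_mem_nhdsWithin).exists
  let Φ : ContDiffBump (pt x t) := ⟨ε / 2, ε, half_pos hε, half_lt_self hε⟩
  rw [← h0 Φ rfl, ← h1 Φ rfl, add_zero]
  exact (hp _ (orbitSum_mem_invariantFunctions hΓ (contDiff_verticalDeriv Φ.contDiff)
    (verticalDeriv_bump_ne_zero Φ)) x).symm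

/-- Otherwise the orbit of a generic point at height `y₀ / 2` avoids the line over `x + p`. The
orbit sum of a small bump then projects to `0` at `x + p` and to a positive number at `x`. -/
theorem exists_mem_of_mem_commonPeriods (hΓ : IsCrystallographic Γ) {y₀ : ℝ} (hy : 0 < y₀)
    {p : Plane} (hp : p ∈ commonPeriods Γ y₀) :
    ∃ q, pt p q ∈ latticeOf Γ ∨ pt p q ∈ sigmaCoset Γ := by
  by_contra! hne
  obtain ⟨x, hx⟩ := hΓ.exists_generic (y₀ / 2) p
  have hfib : ∀ g : Γ, ((g : EuclideanGroup) (pt x (y₀ / 2))).fst ≠ x + p := by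
    rintro ⟨g, hg⟩ hf
    change (g (pt x (y₀ / 2))).fst = x + p at hf
    rcases hx g hg (Or.inr hf) with h | h <;>
      rw [eq_motion g, h] at hf hg <;>
      change (g 0).fst + x = x + p at hf <;>
      rw [add_comm, add_left_cancel_iff] at hf
    · refine (hne (g 0).snd).1 ?_
      rw [← hf]; exact hg
    · refine (hne (g 0).snd).2 ?_
      rw [← hf]; exact hg
  obtain ⟨T, hT⟩ := hΓ.exists_finset (pt x (y₀ / 2)) (pt (x + p) 0) (1 + y₀)
  obtain ⟨T', hT'⟩ := hΓ.exists_finset (pt x (y₀ / 2)) (pt x 0) (1 + y₀)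
  have h1 : ∀ᶠ ε : ℝ in nhdsWithin 0 (Set.Ioi 0), ε < 1 :=
    Filter.Eventually.filter_mono nhdsWithin_le_nhds (eventually_lt_nhds one_pos)
  obtain ⟨ε, ⟨hε1, hεT⟩, hε⟩ := ((h1.and (eventually_lt_of_pos T fun g =>
    dist ((g : EuclideanGroup) (pt x (y₀ / 2))).fst (x + p))).and self_mem_nhdsWithin).exists
  let Φ : ContDiffBump (pt x (y₀ / 2)) := ⟨ε / 2, ε, half_pos hε, half_lt_self hε⟩
  have hs : ∀ w, Φ w ≠ 0 → dist w (pt x (y₀ / 2)) ≤ ε := fun w hw => by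
    by_contra h
    exact hw (Φ.zero_of_le_dist (not_le.1 h).le)
  have hC : ContDiff ℝ 1 Φ := Φ.contDiff
  have e := hp _ (orbitSum_mem_invariantFunctions hΓ hC hs) x
  rw [bandProjection_orbitSum hC.continuous hs hy (x + p) T fun g hg => hT g (hg.trans (by linarith)),
    bandProjection_orbitSum hC.continuous hs hy x T' fun g hg => hT' g (hg.trans (by linarith)),
    Finset.sum_eq_zero] at e
  · have hcont : ∀ g : EuclideanGroup, Continuous fun y => Φ (g⁻¹ (pt x y)) := fun g =>
      hC.continuous.comp ((contDiff_inv_apply (n := 0) _).continuous.comp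
        (contDiff_pt (n := 0) x).continuous)
    -- All terms are nonnegative, and the identity contributes the integral of a bump centred in the
    -- interior of the segment.
    have hpos : 0 < ∑ g ∈ T', ∫ y in (0 : ℝ)..y₀, Φ ((g : EuclideanGroup)⁻¹ (pt x y)) := by
      refine Finset.sum_pos' (fun g _ => intervalIntegral.integral_nonneg hy.le
        fun y _ => Φ.nonneg) ⟨1, hT' 1 ?_, ?_⟩
      · change dist (pt x (y₀ / 2)) (pt x 0) ≤ _
        rw [dist_pt_pt, sub_zero, abs_of_pos (half_pos hy)]
        linarith
      · refine intervalIntegral.integral_pos hy (hcont _).continuousOn (fun y _ => Φ.nonneg)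
          ⟨y₀ / 2, ⟨by linarith, by linarith⟩, ?_⟩
        refine Φ.pos_of_mem_ball ?_
        rw [Subgroup.coe_one, inv_one]
        exact Metric.mem_ball_self hε
    exact hpos.ne e
  · intro g hg
    rw [intervalIntegral.integral_congr (g := fun _ => (0 : ℝ))]
    · simp
    · intro y _
      by_contra hne
      have h2 := hs _ hne
      rw [dist_inv_apply] at h2
      have h3 := dist_fst_le ((g : EuclideanGroup) (pt x (y₀ / 2))) (pt (x + p) y)
      exact absurd (hεT g hg (dist_pos.2 (hfib g))) (not_lt.2 (h3.trans h2))

/-! ### The common periods in terms of the group -/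

theorem of_truthValue_pos {P : Prop} (h : 0 < truthValue P) : P := by
  by_contra hP; rw [truthValue_neg hP] at h; exact lt_irrefl _ h

theorem pt_mem_sub {L : AddSubgroup Space} {x x' : Plane} {y y' : ℝ} (h : pt x y ∈ L)
    (h' : pt x' y' ∈ L) : pt (x - x') (y - y') ∈ L := L.sub_mem h h'

theorem pt_mem_add {L : AddSubgroup Space} {x x' : Plane} {y y' : ℝ} (h : pt x y ∈ L)
    (h' : pt x' y' ∈ L) : pt (x + x') (y + y') ∈ L := L.add_mem h h'

/-- Suppose both alternatives fail. The jump identity at `t = 0`, `t = y₀` and `t = q` then forces,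
in turn, that the `σ`-coset is the lattice, that `2 y₀` is a vertical period, and that `2 q` is one.
A parity argument modulo the generator of the vertical periods gives a contradiction. -/
theorem mem_or_mem_of_jump_eq (hΓ : IsCrystallographic Γ) {y₀ : ℝ} {p : Plane}
    (hj : ∀ t, jump Γ y₀ t 0 = jump Γ y₀ t p) (hy : pt 0 y₀ ∉ latticeOf Γ)
    (hne : ∃ q, pt p q ∈ latticeOf Γ ∨ pt p q ∈ sigmaCoset Γ) :
    pt p 0 ∈ latticeOf Γ ∨ pt p y₀ ∈ sigmaCoset Γ := by
  by_contra! hcon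
  obtain ⟨hp0, hpy⟩ := hcon
  have h00 : pt 0 0 ∈ latticeOf Γ := (latticeOf Γ).zero_mem
  -- The left side is at most `-1 + [0 ∈ sigmaCoset Γ]` and the right side is nonnegative, so the
  -- `σ`-coset contains `0`.
  have j0 := hj 0
  simp only [jump, sub_zero, add_zero, neg_zero] at j0
  rw [truthValue_neg hy, truthValue_neg hp0, truthValue_neg hpy, truthValue_pos h00] at j0
  have hS0 : pt 0 0 ∈ sigmaCoset Γ := by
    refine of_truthValue_pos ?_
    linarith [truthValue_nonneg (pt 0 y₀ ∈ sigmaCoset Γ), truthValue_nonneg (pt p y₀ ∈ latticeOf Γ),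
      truthValue_nonneg (pt p 0 ∈ sigmaCoset Γ)]
  have hS : ∀ z, z ∈ sigmaCoset Γ ↔ z ∈ latticeOf Γ := fun z =>
    ⟨fun hz => by simpa [pt_zero] using sub_mem_latticeOf hz hS0,
      fun hz => by simpa [pt_zero] using add_mem_sigmaCoset hz hS0⟩
  simp only [jump, hS] at hj hne
  rw [hS] at hpy
  obtain ⟨q, hq⟩ := hne
  rw [or_self] at hq
  have hneg : ∀ y, pt 0 (-y) ∈ latticeOf Γ ↔ pt 0 y ∈ latticeOf Γ := fun y => by
    rw [← neg_zero, ← pt_neg, neg_mem_iff, neg_zero]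
  -- At `t = y₀` the left side is `1 - [(0, 2 y₀) ∈ L]`, since the terms at `±y₀` cancel, and the
  -- right side is at most `0`.
  have h2y : pt 0 (y₀ + y₀) ∈ latticeOf Γ := by
    have j := hj y₀
    rw [sub_self, truthValue_pos h00, truthValue_congr (hneg y₀), truthValue_neg hp0] at j
    refine of_truthValue_pos ?_
    rw [truthValue_neg hpy] at j
    linarith [truthValue_nonneg (pt p (-y₀) ∈ latticeOf Γ),
      truthValue_nonneg (pt p (y₀ + y₀) ∈ latticeOf Γ)]
  -- At `t = q` the left side vanishes by the symmetry under negation and the period `2 y₀`. On the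
  -- right, `(p, q)` contributes `1` and `(p, y₀ + q)` contributes `0`, so `(p, -q)` must be present
  -- to cancel.
  have h2q : pt 0 (q + q) ∈ latticeOf Γ := by
    have j := hj q
    have e : pt 0 (y₀ - q) ∈ latticeOf Γ ↔ pt 0 (y₀ + q) ∈ latticeOf Γ := by
      rw [← hneg]
      constructor
      · intro h
        convert pt_mem_add h h2y using 2
        · simp
        · ring
      · intro h
        convert pt_mem_sub h h2y using 2
        · simp
        · ring
    have hyq : pt p (y₀ + q) ∉ latticeOf Γ := fun h => hy (by simpa using pt_mem_sub h hq)
    rw [truthValue_congr e, truthValue_congr (hneg q), truthValue_pos hq, truthValue_neg hyq] at j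
    have : pt p (-q) ∈ latticeOf Γ := by
      refine of_truthValue_pos ?_
      linarith [truthValue_nonneg (pt p (y₀ - q) ∈ latticeOf Γ)]
    simpa using pt_mem_sub hq this
  obtain ⟨c, -, hc⟩ := hΓ.exists_vertical
  obtain ⟨k, hk⟩ := (hc _).1 h2y
  obtain ⟨m, hm⟩ := (hc _).1 h2q
  -- Since `y₀` is not a period, `k` is odd. If `m` is even, `q` is a period and `(p, 0)` is in the
  -- lattice; if `m` is odd, `q - y₀` is a period and `(p, y₀)` is in the lattice, which is the
  -- `σ`-coset.
  rcases Int.even_or_odd' k with ⟨k', rfl | rfl⟩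
  · refine hy ((hc _).2 ⟨k', ?_⟩)
    push_cast at hk; linarith
  · rcases Int.even_or_odd' m with ⟨m', rfl | rfl⟩
    · have : pt 0 q ∈ latticeOf Γ := (hc _).2 ⟨m', by push_cast at hm; linarith⟩
      exact hp0 (by simpa using pt_mem_sub hq this)
    · have : pt 0 (q - y₀) ∈ latticeOf Γ :=
        (hc _).2 ⟨m' - k', by push_cast at hm hk ⊢; linarith⟩
      exact hpy (by simpa using pt_mem_sub hq this)

theorem invariantFunctions.apply_eq {f : Space → ℝ} (hf : f ∈ invariantFunctions Γ)
    {γ : EuclideanGroup} (hγ : γ ∈ Γ) (z : Space) : f (γ z) = f z := by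
  have h := hf.2 γ⁻¹ (Γ.inv_mem hγ) z
  rwa [inv_inv] at h

theorem invariantFunctions.apply_add {f : Space → ℝ} (hf : f ∈ invariantFunctions Γ)
    {p x : Plane} {q y : ℝ} (h : pt p q ∈ latticeOf Γ) : f (pt (x + p) (y + q)) = f (pt x y) := by
  rw [← apply_eq hf h (pt x y), motion_apply, add_comm x, add_comm y]
  rfl

theorem invariantFunctions.apply_sub {f : Space → ℝ} (hf : f ∈ invariantFunctions Γ)
    {p x : Plane} {q y : ℝ} (h : pt p q ∈ sigmaCoset Γ) : f (pt (x + p) (q - y)) = f (pt x y) := by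
  rw [← apply_eq hf h (pt x y), motion_apply, sigma_pt, pt_add, add_comm x, sub_eq_add_neg]

theorem mem_commonPeriods_iff (hΓ : IsCrystallographic Γ) {y₀ : ℝ} (hy : 0 < y₀) {p : Plane} :
    p ∈ commonPeriods Γ y₀ ↔ pt p 0 ∈ latticeOf Γ ∨ pt p y₀ ∈ sigmaCoset Γ ∨
      (pt 0 y₀ ∈ latticeOf Γ ∧ ∃ q, pt p q ∈ latticeOf Γ ∨ pt p q ∈ sigmaCoset Γ) := by
  constructor
  · intro hp
    have hne := exists_mem_of_mem_commonPeriods hΓ hy hp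
    by_cases h : pt 0 y₀ ∈ latticeOf Γ
    · exact Or.inr (Or.inr ⟨h, hne⟩)
    · rcases mem_or_mem_of_jump_eq hΓ (jump_eq_of_mem_commonPeriods hΓ hy hp) h hne with h | h
      · exact Or.inl h
      · exact Or.inr (Or.inl h)
  · intro h f hf x
    unfold bandProjection
    rcases h with h | h | ⟨h0, q, h | h⟩
    · refine intervalIntegral.integral_congr fun y _ => ?_
      have := invariantFunctions.apply_add hf (x := x) (y := y) h
      rwa [add_zero] at this
    · have e : ∀ y, f (pt (x + p) y) = f (pt x (y₀ - y)) := fun y => by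
        rw [← invariantFunctions.apply_sub hf (x := x) (y := y₀ - y) h, sub_sub_cancel]
      simp only [e]
      rw [intervalIntegral.integral_comp_sub_left fun y => f (pt x y), sub_self, sub_zero]
    all_goals
      -- The integral over an interval of length `y₀` does not depend on its position, so `q` is
      -- irrelevant in the two remaining cases.
      have hper : Function.Periodic (fun y => f (pt x y)) y₀ := fun y => by
        have := invariantFunctions.apply_add hf (x := x) (y := y) h0
        rwa [add_zero] at this
    · have e : ∀ y, f (pt (x + p) y) = f (pt x (y - q)) := fun y => by
        rw [← invariantFunctions.apply_add hf (x := x) (y := y - q) h, sub_add_cancel]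
      simp only [e]
      rw [intervalIntegral.integral_comp_sub_right fun y => f (pt x y), zero_sub,
        sub_eq_neg_add, hper.intervalIntegral_add_eq (-q) 0, zero_add]
    · have e : ∀ y, f (pt (x + p) y) = f (pt x (q - y)) := fun y => by
        rw [← invariantFunctions.apply_sub hf (x := x) (y := q - y) h, sub_sub_cancel]
      simp only [e]
      rw [intervalIntegral.integral_comp_sub_left fun y => f (pt x y), sub_zero]
      have := hper.intervalIntegral_add_eq (q - y₀) 0
      rwa [sub_add_cancel, zero_add] at this

/-! ### Planar modules with two generators -/

theorem gen2_comm {E : Type*} [AddCommGroup E] (a b : E) : gen2 a b = gen2 b a := by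
  rw [gen2, gen2, Set.pair_comm]

/-- Cramer's rule. A determinant `±1` is its own inverse, so one computation covers both signs. -/
theorem gen2_eq_of_det {E : Type*} [AddCommGroup E] [Module ℝ E] {a b a' b' : E} (m n k l : ℤ)
    (hdet : m * l - n * k = 1 ∨ m * l - n * k = -1) (ha : a = (m : ℝ) • a' + (n : ℝ) • b')
    (hb : b = (k : ℝ) • a' + (l : ℝ) • b') : gen2 a b = gen2 a' b' := by
  have key : ∀ d : ℤ, d * d = 1 → m * l - n * k = d → gen2 a b = gen2 a' b' := by
    intro d hd h
    have hd' : (d : ℝ) * (m * l - n * k) = 1 := by rw [← h] at hd ⊢; exact_mod_cast hd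
    refine gen2_eq (mem_gen2.2 ⟨m, n, ha⟩) (mem_gen2.2 ⟨k, l, hb⟩)
      (mem_gen2.2 ⟨d * l, -(d * n), ?_⟩) (mem_gen2.2 ⟨-(d * k), d * m, ?_⟩)
    · rw [ha, hb]
      push_cast
      calc a' = ((d : ℝ) * (m * l - n * k)) • a' := by rw [hd', one_smul]
        _ = _ := by module
    · rw [ha, hb]
      push_cast
      calc b' = ((d : ℝ) * (m * l - n * k)) • b' := by rw [hd', one_smul]
        _ = _ := by module
  rcases hdet with h | h
  · exact key 1 (by norm_num) h
  · exact key (-1) (by norm_num) h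

/-- Sorting by the parity of the first coefficient gives two cosets. This turns conditions of the
form "`p` or `p - v` lies in the module" into membership in a module. -/
theorem mem_gen2_iff_two_smul_left {E : Type*} [AddCommGroup E] [Module ℝ E] (h w p : E) :
    p ∈ gen2 h w ↔ p ∈ gen2 ((2 : ℝ) • h) w ∨ p - h ∈ gen2 ((2 : ℝ) • h) w := by
  simp only [mem_gen2]
  constructor
  · rintro ⟨m, n, rfl⟩
    rcases Int.even_or_odd' m with ⟨k, rfl | rfl⟩
    · exact Or.inl ⟨k, n, by push_cast; module⟩
    · exact Or.inr ⟨k, n, by push_cast; module⟩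
  · rintro (⟨m, n, hp⟩ | ⟨m, n, hp⟩)
    · exact ⟨2 * m, n, by rw [hp]; push_cast; module⟩
    · exact ⟨2 * m + 1, n, by rw [sub_eq_iff_eq_add.1 hp]; push_cast; module⟩

theorem mem_gen2_iff_two_smul_right {E : Type*} [AddCommGroup E] [Module ℝ E] (w h p : E) :
    p ∈ gen2 w h ↔ p ∈ gen2 w ((2 : ℝ) • h) ∨ p - h ∈ gen2 w ((2 : ℝ) • h) := by
  rw [gen2_comm w h, gen2_comm w, mem_gen2_iff_two_smul_left]

theorem half_smul_two_smul {E : Type*} [AddCommGroup E] [Module ℝ E] (v : E) :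
    (1 / 2 : ℝ) • (2 : ℝ) • v = v := by module

theorem two_smul_half_smul {E : Type*} [AddCommGroup E] [Module ℝ E] (v : E) :
    (2 : ℝ) • (1 / 2 : ℝ) • v = v := by module

/-! ### The adapted lattices -/

theorem linearIndependent_adapted {a b : Plane} (h : LinearIndependent ℝ ![a, b]) {c : ℝ}
    (hc : c ≠ 0) (a₃ b₃ : ℝ) : LinearIndependent ℝ ![pt a a₃, pt b b₃, pt 0 c] := by
  rw [Fintype.linearIndependent_iff]
  intro g hg
  simp only [Fin.sum_univ_three, Matrix.cons_val_zero, Matrix.cons_val_one, Matrix.cons_val_two,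
    Matrix.head_cons, Matrix.tail_cons, pt_smul, pt_add, ← pt_zero, pt_inj] at hg
  obtain ⟨h1, h2⟩ := hg
  rw [smul_zero, add_zero] at h1
  obtain ⟨e0, e1⟩ := h.eq_zero_of_pair h1
  rw [e0, e1] at h2
  have e2 : g 2 = 0 := by simpa [hc] using h2
  intro i
  fin_cases i <;> assumption

theorem isLattice_adaptedLattice {a b : Plane} (h : LinearIndependent ℝ ![a, b]) {c : ℝ}
    (hc : c ≠ 0) (a₃ b₃ : ℝ) : IsLattice (adaptedLattice a a₃ b b₃ c) :=
  isLattice_gen3 (linearIndependent_adapted h hc a₃ b₃)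

theorem isLattice_oblique {a b c₀ : Plane} (h : LinearIndependent ℝ ![a, b]) {c₃ : ℝ}
    (hc : c₃ ≠ 0) : IsLattice (gen3 (pt a 0) (pt b 0) (pt c₀ c₃)) := by
  refine isLattice_gen3 ?_
  rw [Fintype.linearIndependent_iff]
  intro g hg
  simp only [Fin.sum_univ_three, Matrix.cons_val_zero, Matrix.cons_val_one, Matrix.cons_val_two,
    Matrix.head_cons, Matrix.tail_cons, pt_smul, pt_add, ← pt_zero, pt_inj] at hg
  obtain ⟨h1, h2⟩ := hg
  have e2 : g 2 = 0 := by simpa [hc] using h2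
  rw [e2, zero_smul, add_zero] at h1
  obtain ⟨e0, e1⟩ := h.eq_zero_of_pair h1
  intro i
  fin_cases i <;> assumption

theorem exists_pt_mem_adaptedLattice {a b x : Plane} {a₃ b₃ c : ℝ} :
    (∃ q, pt x q ∈ adaptedLattice a a₃ b b₃ c) ↔ x ∈ gen2 a b := by
  simp only [mem_adaptedLattice, mem_gen2]
  constructor
  · rintro ⟨q, m, n, k, h, -⟩; exact ⟨m, n, h⟩
  · rintro ⟨m, n, h⟩; exact ⟨_, m, n, 0, h, rfl⟩

theorem vertical_mem_adaptedLattice {a b : Plane} (h : LinearIndependent ℝ ![a, b])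
    {a₃ b₃ c y : ℝ} : pt 0 y ∈ adaptedLattice a a₃ b b₃ c ↔ ∃ n : ℤ, y = n * c := by
  rw [mem_adaptedLattice]
  constructor
  · rintro ⟨m, n, k, h0, hy⟩
    obtain ⟨h1, h2⟩ := h.eq_zero_of_pair h0.symm
    rw [h1, h2] at hy
    exact ⟨k, by linarith⟩
  · rintro ⟨n, rfl⟩; exact ⟨0, 0, n, by simp, by simp⟩

theorem mem_straightLattice {a b p : Plane} {c y : ℝ} :
    pt p y ∈ adaptedLattice a 0 b 0 c ↔ (∃ n : ℤ, y = n * c) ∧ p ∈ gen2 a b := by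
  rw [mem_adaptedLattice, mem_gen2]
  constructor
  · rintro ⟨m, n, k, h, hy⟩; exact ⟨⟨k, by linarith⟩, m, n, h⟩
  · rintro ⟨⟨k, hk⟩, m, n, h⟩; exact ⟨m, n, k, h, by linarith⟩

/-- Sorting by the parity of the coefficient of `(a, c / 2)`: even multiples lie at the levels `n
c`, odd multiples at the levels `n c + c / 2`. -/
theorem mem_centredLattice {a b p : Plane} {c y : ℝ} :
    pt p y ∈ adaptedLattice a (c / 2) b 0 c ↔
      ((∃ n : ℤ, y = n * c) ∧ p ∈ gen2 ((2 : ℝ) • a) b) ∨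
      ((∃ n : ℤ, y = n * c + c / 2) ∧ p - a ∈ gen2 ((2 : ℝ) • a) b) := by
  simp only [mem_adaptedLattice, mem_gen2]
  constructor
  · rintro ⟨m, n, k, rfl, rfl⟩
    rcases Int.even_or_odd' m with ⟨j, rfl | rfl⟩
    · exact Or.inl ⟨⟨j + k, by push_cast; ring⟩, j, n, by push_cast; module⟩
    · exact Or.inr ⟨⟨j + k, by push_cast; ring⟩, j, n, by push_cast; module⟩
  · rintro (⟨⟨k, rfl⟩, m, n, hp⟩ | ⟨⟨k, rfl⟩, m, n, hp⟩)
    · exact ⟨2 * m, n, k - m, by rw [hp]; push_cast; module, by push_cast; ring⟩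
    · exact ⟨2 * m + 1, n, k - m, by rw [sub_eq_iff_eq_add.1 hp]; push_cast; module,
        by push_cast; ring⟩

theorem pt_mem_cosetAt {L : AddSubgroup Space} {v p : Plane} {y₁ y : ℝ} :
    pt p y ∈ cosetAt L v y₁ ↔ pt (p - v) (y - y₁) ∈ L := by
  constructor
  · rintro ⟨l, hl, h⟩
    rwa [← pt_sub, h, add_sub_cancel_left]
  · intro h
    exact ⟨_, h, by rw [← pt_sub, add_sub_cancel]⟩

theorem cosetAt_zero (L : AddSubgroup Space) : cosetAt L 0 0 = L := by
  ext z
  rw [← pt_eta z, pt_mem_cosetAt, sub_zero, sub_zero]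
  rfl

theorem cosetAt_eq {L : AddSubgroup Space} {v v' : Plane} {y y' : ℝ}
    (h : pt (v - v') (y - y') ∈ L) : cosetAt L v y = cosetAt L v' y' := by
  ext z
  rw [← pt_eta z, pt_mem_cosetAt, pt_mem_cosetAt]
  have e : pt (z.fst - v') (z.snd - y') =
      pt (z.fst - v) (z.snd - y) + pt (v - v') (y - y') := by
    rw [pt_add, sub_add_sub_cancel, sub_add_sub_cancel]
  rw [e, L.add_mem_cancel_right h]

theorem sigma_mem_straightLattice {a b : Plane} {c : ℝ} :
    ∀ z ∈ adaptedLattice a 0 b 0 c, sigma z ∈ adaptedLattice a 0 b 0 c := by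
  intro z hz
  rw [← pt_eta z, mem_straightLattice] at hz
  rw [← pt_eta z, sigma_pt, mem_straightLattice]
  obtain ⟨⟨n, hn⟩, h⟩ := hz
  exact ⟨⟨-n, by push_cast; linarith⟩, h⟩

theorem sigma_mem_centredLattice {a b : Plane} {c : ℝ} :
    ∀ z ∈ adaptedLattice a (c / 2) b 0 c, sigma z ∈ adaptedLattice a (c / 2) b 0 c := by
  intro z hz
  rw [← pt_eta z, mem_centredLattice] at hz
  rw [← pt_eta z, sigma_pt, mem_centredLattice]
  rcases hz with ⟨⟨n, hn⟩, h⟩ | ⟨⟨n, hn⟩, h⟩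
  · exact Or.inl ⟨⟨-n, by push_cast; linarith⟩, h⟩
  · exact Or.inr ⟨⟨-n - 1, by push_cast; linarith⟩, h⟩

/-! ### Groups with a given lattice and `σ`-coset -/

theorem motion_refl_mul (v w : Space) (δ : Space ≃ₗᵢ[ℝ] Space) :
    motion v (LinearIsometryEquiv.refl ℝ Space) * motion w δ = motion (v + w) δ := by
  rw [motion_mul]; rfl

theorem exists_group_of_isLattice {L : AddSubgroup Space} (hL : IsLattice L) :
    ∃ Γ : Subgroup EuclideanGroup,
      IsCrystallographic Γ ∧ latticeOf Γ = L ∧ sigmaCoset Γ = ∅ := by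
  let Γ : Subgroup EuclideanGroup :=
    { carrier := {γ | ∃ l ∈ L, γ = motion l (LinearIsometryEquiv.refl ℝ Space)}
      one_mem' := ⟨0, L.zero_mem, motion_zero_refl.symm⟩
      mul_mem' := by
        rintro _ _ ⟨l, hl, rfl⟩ ⟨l', hl', rfl⟩
        exact ⟨l + l', L.add_mem hl hl', motion_refl_mul _ _ _⟩
      inv_mem' := by
        rintro _ ⟨l, hl, rfl⟩
        exact ⟨-l, L.neg_mem hl, motion_inv _ _⟩ }
  have h1 : latticeOf Γ = L := by
    ext v
    constructor
    · rintro ⟨l, hl, h⟩; rw [(motion_inj.1 h).1]; exact hl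
    · intro hv; exact ⟨v, hv, rfl⟩
  refine ⟨Γ, ?_, h1, ?_⟩
  · rw [IsCrystallographic, h1]; exact hL
  · rw [Set.eq_empty_iff_forall_notMem]
    rintro v ⟨l, hl, h⟩
    exact sigma_ne_refl (motion_inj.1 h).2

/-- For `w = (v, y)`, the translations by `L` together with the motions `(w + l, σ)` are closed
under products because `σ L ⊆ L` and `w + σ w = (2 v, 0) ∈ L`. -/
theorem exists_group_of_cosetAt {L : AddSubgroup Space} (hL : IsLattice L)
    (hσ : ∀ z ∈ L, sigma z ∈ L) {v : Plane} (y : ℝ) (hv : pt ((2 : ℝ) • v) 0 ∈ L) :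
    ∃ Γ : Subgroup EuclideanGroup,
      IsCrystallographic Γ ∧ latticeOf Γ = L ∧ sigmaCoset Γ = cosetAt L v y := by
  have hw : pt v y + sigma (pt v y) ∈ L := by
    rw [sigma_pt, pt_add, add_neg_cancel, ← two_smul ℝ v]; exact hv
  let Γ : Subgroup EuclideanGroup :=
    { carrier := {γ | ∃ l ∈ L, γ = motion l (LinearIsometryEquiv.refl ℝ Space) ∨
        γ = motion (pt v y + l) sigma}
      one_mem' := ⟨0, L.zero_mem, Or.inl motion_zero_refl.symm⟩
      mul_mem' := by
        rintro _ _ ⟨l, hl, rfl | rfl⟩ ⟨l', hl', rfl | rfl⟩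
        · exact ⟨l + l', L.add_mem hl hl', Or.inl (motion_refl_mul _ _ _)⟩
        · exact ⟨l + l', L.add_mem hl hl',
            Or.inr ((motion_refl_mul _ _ _).trans (by rw [add_left_comm]))⟩
        · exact ⟨l + sigma l', L.add_mem hl (hσ _ hl'),
            Or.inr (by rw [motion_mul, add_assoc]; rfl)⟩
        · exact ⟨pt v y + sigma (pt v y) + (l + sigma l'),
            L.add_mem hw (L.add_mem hl (hσ _ hl')),
            Or.inl (by rw [motion_mul, sigma_trans_sigma, map_add, add_add_add_comm])⟩
      inv_mem' := by
        rintro _ ⟨l, hl, rfl | rfl⟩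
        · exact ⟨-l, L.neg_mem hl, Or.inl (motion_inv _ _)⟩
        -- The inverse has translation part `-σ (w + l)`, rewritten as `w + (-(w + σ w) - σ l)`.
        · refine ⟨-(pt v y + sigma (pt v y)) - sigma l, L.sub_mem (L.neg_mem hw) (hσ _ hl),
            Or.inr ?_⟩
          rw [motion_inv, sigma_symm, map_add]
          congr 1
          abel }
  have h1 : latticeOf Γ = L := by
    ext z
    constructor
    · rintro ⟨l, hl, h | h⟩
      · rw [(motion_inj.1 h).1]; exact hl
      · exact absurd (motion_inj.1 h).2.symm sigma_ne_refl
    · intro hz; exact ⟨z, hz, Or.inl rfl⟩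
  refine ⟨Γ, ?_, h1, ?_⟩
  · rw [IsCrystallographic, h1]; exact hL
  · ext z
    constructor
    · rintro ⟨l, hl, h | h⟩
      · exact absurd (motion_inj.1 h).2 sigma_ne_refl
      · exact ⟨l, hl, (motion_inj.1 h).1⟩
    · rintro ⟨l, hl, rfl⟩; exact ⟨l, hl, Or.inr rfl⟩

/-! ### Periods for the straight and the centred lattices -/

theorem bandTable_of_A {c y₁ y₀ : ℝ} (A B C O : AddSubgroup Plane)
    (h : ∃ n : ℤ, y₀ = n * c) : bandTable c y₁ A B C O y₀ = A := if_pos h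

theorem bandTable_of_B {c y₁ y₀ : ℝ} (A B C O : AddSubgroup Plane)
    (h : ¬ ∃ n : ℤ, y₀ = n * c) (h' : ∃ n : ℤ, y₀ = n * c + y₁) :
    bandTable c y₁ A B C O y₀ = B := by
  rw [bandTable, if_neg h, if_pos h']

theorem bandTable_of_C {c y₁ y₀ : ℝ} (A B C O : AddSubgroup Plane)
    (h : ¬ ∃ n : ℤ, y₀ = n * c) (h' : ¬ ∃ n : ℤ, y₀ = n * c + y₁)
    (h'' : ∃ n : ℤ, y₀ = n * c + c / 2 + y₁) :
    bandTable c y₁ A B C O y₀ = C := by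
  rw [bandTable, if_neg h, if_neg h', if_pos h'']

theorem bandTable_of_O {c y₁ y₀ : ℝ} (A B C O : AddSubgroup Plane)
    (h : ¬ ∃ n : ℤ, y₀ = n * c) (h' : ¬ ∃ n : ℤ, y₀ = n * c + y₁)
    (h'' : ¬ ∃ n : ℤ, y₀ = n * c + c / 2 + y₁) :
    bandTable c y₁ A B C O y₀ = O := by
  rw [bandTable, if_neg h, if_neg h', if_neg h'']

theorem atMultiples_pos {d y₀ : ℝ} (A O : AddSubgroup Plane) (h : ∃ n : ℤ, y₀ = n * d) :
    atMultiples d A O y₀ = A := if_pos h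

theorem atMultiples_neg {d y₀ : ℝ} (A O : AddSubgroup Plane) (h : ¬ ∃ n : ℤ, y₀ = n * d) :
    atMultiples d A O y₀ = O := if_neg h

theorem int_cast_ne_half (n : ℤ) : (n : ℝ) ≠ 1 / 2 := by
  intro h
  have : (2 * n : ℤ) = 1 := by
    have : (2 * n : ℝ) = 1 := by rw [h]; norm_num
    exact_mod_cast this
  omega

theorem not_centred_of_straight {c y₁ y₀ : ℝ} (hc : 0 < c) (h : ∃ n : ℤ, y₀ = n * c + y₁) :
    ¬ ∃ n : ℤ, y₀ = n * c + c / 2 + y₁ := by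
  rintro ⟨n, hn⟩
  obtain ⟨m, hm⟩ := h
  refine int_cast_ne_half (m - n) ?_
  have : ((m : ℝ) - n) * c = 1 / 2 * c := by linarith
  push_cast
  exact mul_right_cancel₀ hc.ne' this

/-- Modulo `c`, lowering `y₁` by `c / 2` exchanges the levels of rows `B` and `C`. Tables need no
normalization of `y₁`, so `y₁ - c / 2` may be negative. -/
theorem bandTable_shift {c : ℝ} (hc : 0 < c) (y₁ : ℝ) (A B C O : AddSubgroup Plane) :
    bandTable c (y₁ - c / 2) A B C O = bandTable c y₁ A C B O := by
  funext y₀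
  have e1 : (∃ n : ℤ, y₀ = n * c + (y₁ - c / 2)) ↔ ∃ n : ℤ, y₀ = n * c + c / 2 + y₁ := by
    constructor
    · rintro ⟨n, h⟩; exact ⟨n - 1, by push_cast; linarith⟩
    · rintro ⟨n, h⟩; exact ⟨n + 1, by push_cast; linarith⟩
  have e2 : (∃ n : ℤ, y₀ = n * c + c / 2 + (y₁ - c / 2)) ↔ ∃ n : ℤ, y₀ = n * c + y₁ := by
    simp only [add_add_sub_cancel]
  by_cases hA : ∃ n : ℤ, y₀ = n * c
  · rw [bandTable_of_A _ _ _ _ hA, bandTable_of_A _ _ _ _ hA]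
  by_cases hB : ∃ n : ℤ, y₀ = n * c + y₁
  · rw [bandTable_of_B _ _ _ _ hA hB, bandTable_of_C _ _ _ _ hA
      (by rw [e1]; exact not_centred_of_straight hc hB) (e2.2 hB)]
  by_cases hC : ∃ n : ℤ, y₀ = n * c + c / 2 + y₁
  · rw [bandTable_of_C _ _ _ _ hA hB hC, bandTable_of_B _ _ _ _ hA (e1.2 hC)]
  · rw [bandTable_of_O _ _ _ _ hA hB hC, bandTable_of_O _ _ _ _ hA (by rwa [e1]) (by rwa [e2])]

/-! ### The period criterion for adapted, straight and centred lattices. -/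

theorem commonPeriods_of_empty (hΓ : IsCrystallographic Γ) {a b : Plane} {a₃ b₃ c : ℝ}
    (hab : LinearIndependent ℝ ![a, b]) (hL : latticeOf Γ = adaptedLattice a a₃ b b₃ c)
    (hS : sigmaCoset Γ = ∅) {O : AddSubgroup Plane}
    (hO : ∀ p, p ∈ O ↔ pt p 0 ∈ adaptedLattice a a₃ b b₃ c) {y₀ : ℝ} (hy : 0 < y₀) :
    commonPeriods Γ y₀ = atMultiples c (gen2 a b) O y₀ := by
  have hOle : ∀ p ∈ O, p ∈ gen2 a b := fun p hp =>
    exists_pt_mem_adaptedLattice.1 ⟨0, (hO p).1 hp⟩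
  ext p
  rw [mem_commonPeriods_iff hΓ hy, hS, hL, vertical_mem_adaptedLattice hab, ← hO]
  simp only [Set.mem_empty_iff_false, or_false, false_or, exists_pt_mem_adaptedLattice]
  by_cases h : ∃ n : ℤ, y₀ = n * c
  · rw [atMultiples_pos _ _ h]
    exact ⟨fun h' => h'.elim (hOle p) And.right, fun h' => Or.inr ⟨h, h'⟩⟩
  · rw [atMultiples_neg _ _ h]
    exact ⟨fun h' => h'.elim id fun h' => absurd h'.1 h, Or.inl⟩

theorem commonPeriods_of_straight (hΓ : IsCrystallographic Γ) {a b v : Plane} {c y₁ : ℝ}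
    (hL : latticeOf Γ = adaptedLattice a 0 b 0 c)
    (hS : sigmaCoset Γ = cosetAt (adaptedLattice a 0 b 0 c) v y₁) {A : AddSubgroup Plane}
    (hA : ∀ p, p ∈ A ↔ p ∈ gen2 a b ∨ p - v ∈ gen2 a b) {y₀ : ℝ} (hy : 0 < y₀) :
    commonPeriods Γ y₀ = bandTable c y₁ A A (gen2 a b) (gen2 a b) y₀ := by
  have eB : (∃ n : ℤ, y₀ - y₁ = n * c) ↔ ∃ n : ℤ, y₀ = n * c + y₁ := by
    simp only [sub_eq_iff_eq_add]
  have h0 : (∃ n : ℤ, (0 : ℝ) = n * c) := ⟨0, by simp⟩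
  have hex : ∀ p, (∃ q, pt p q ∈ adaptedLattice a 0 b 0 c ∨
      pt p q ∈ cosetAt (adaptedLattice a 0 b 0 c) v y₁) ↔ p ∈ A := fun p => by
    rw [exists_or, exists_pt_mem_adaptedLattice, hA, ← exists_pt_mem_adaptedLattice (x := p - v)]
    simp only [pt_mem_cosetAt]
    exact or_congr Iff.rfl ⟨fun ⟨q, h⟩ => ⟨_, h⟩, fun ⟨q, h⟩ => ⟨q + y₁, by simpa using h⟩⟩
  ext p
  rw [mem_commonPeriods_iff hΓ hy, hS, hL, hex, pt_mem_cosetAt, hA]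
  simp only [mem_straightLattice, eB, zero_mem, and_true, h0, true_and]
  by_cases hAy : ∃ n : ℤ, y₀ = n * c
  · rw [bandTable_of_A _ _ _ _ hAy, hA]
    tauto
  by_cases hB : ∃ n : ℤ, y₀ = n * c + y₁
  · rw [bandTable_of_B _ _ _ _ hAy hB, hA]
    tauto
  · have : bandTable c y₁ A A (gen2 a b) (gen2 a b) y₀ = gen2 a b := by
      by_cases hC : ∃ n : ℤ, y₀ = n * c + c / 2 + y₁
      · exact bandTable_of_C _ _ _ _ hAy hB hC
      · exact bandTable_of_O _ _ _ _ hAy hB hC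
    rw [this]
    tauto

/-- When `y₀` is a vertical period, every projected vector counts, which is row `A`. Otherwise `(p -
v, y₀ - y₁)` must lie in the lattice unless `(p, 0)` does, and its level decides between `B` and
`C`; these are the unions of cosets in the hypotheses. -/
theorem commonPeriods_of_centred (hΓ : IsCrystallographic Γ) {a b v : Plane} {c y₁ : ℝ}
    (hc : 0 < c) (hab : LinearIndependent ℝ ![a, b])
    (hL : latticeOf Γ = adaptedLattice a (c / 2) b 0 c)
    (hS : sigmaCoset Γ = cosetAt (adaptedLattice a (c / 2) b 0 c) v y₁)
    {A B C : AddSubgroup Plane}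
    (hA : ∀ p, p ∈ A ↔ p ∈ gen2 a b ∨ p - v ∈ gen2 a b)
    (hB : ∀ p, p ∈ B ↔ p ∈ gen2 ((2 : ℝ) • a) b ∨ p - v ∈ gen2 ((2 : ℝ) • a) b)
    (hC : ∀ p, p ∈ C ↔ p ∈ gen2 ((2 : ℝ) • a) b ∨ p - v - a ∈ gen2 ((2 : ℝ) • a) b)
    {y₀ : ℝ} (hy : 0 < y₀) :
    commonPeriods Γ y₀ = bandTable c y₁ A B C (gen2 ((2 : ℝ) • a) b) y₀ := by
  have eB : (∃ n : ℤ, y₀ - y₁ = n * c) ↔ ∃ n : ℤ, y₀ = n * c + y₁ := by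
    simp only [sub_eq_iff_eq_add]
  have eC : (∃ n : ℤ, y₀ - y₁ = n * c + c / 2) ↔ ∃ n : ℤ, y₀ = n * c + c / 2 + y₁ := by
    simp only [sub_eq_iff_eq_add]
  have hle : ∀ p ∈ gen2 ((2 : ℝ) • a) b, p ∈ gen2 a b := fun p h =>
    (mem_gen2_iff_two_smul_left _ _ _).2 (Or.inl h)
  have hex : ∀ p, (∃ q, pt p q ∈ adaptedLattice a (c / 2) b 0 c ∨
      pt p q ∈ cosetAt (adaptedLattice a (c / 2) b 0 c) v y₁) ↔ p ∈ A := fun p => by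
    rw [exists_or, exists_pt_mem_adaptedLattice, hA, ← exists_pt_mem_adaptedLattice (x := p - v)]
    simp only [pt_mem_cosetAt]
    exact or_congr Iff.rfl ⟨fun ⟨q, h⟩ => ⟨_, h⟩, fun ⟨q, h⟩ => ⟨q + y₁, by simpa using h⟩⟩
  have e0 : ∀ p, pt p 0 ∈ adaptedLattice a (c / 2) b 0 c ↔ p ∈ gen2 ((2 : ℝ) • a) b := by
    intro p
    rw [mem_centredLattice]
    refine ⟨fun h => h.elim And.right fun h => absurd h.1 ?_, fun h => Or.inl ⟨⟨0, by simp⟩, h⟩⟩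
    have := not_centred_of_straight hc (y₁ := 0) (y₀ := 0) ⟨0, by simp⟩
    simpa using this
  ext p
  have hpA : p ∈ gen2 ((2 : ℝ) • a) b ∨ p - v ∈ gen2 ((2 : ℝ) • a) b ∨
      p - v - a ∈ gen2 ((2 : ℝ) • a) b → p ∈ A := by
    rw [hA]
    rintro (h | h | h)
    · exact Or.inl (hle p h)
    · exact Or.inr (hle _ h)
    · exact Or.inr ((mem_gen2_iff_two_smul_left _ _ _).2 (Or.inr h))
  rw [mem_commonPeriods_iff hΓ hy, hS, hL, hex, pt_mem_cosetAt, vertical_mem_adaptedLattice hab,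
    e0, mem_centredLattice, eB, eC]
  have hBC := not_centred_of_straight hc (y₁ := y₁) (y₀ := y₀)
  have hBp := hB p
  have hCp := hC p
  by_cases hAy : ∃ n : ℤ, y₀ = n * c
  · rw [bandTable_of_A _ _ _ _ hAy]
    clear hA hB hC hex hle e0 eB eC hBC hBp hCp hS hL
    simp only [hAy, true_and]
    constructor
    · rintro (h | (⟨-, h⟩ | ⟨-, h⟩) | h)
      exacts [hpA (Or.inl h), hpA (Or.inr (Or.inl h)), hpA (Or.inr (Or.inr h)), h]
    · exact fun h => Or.inr (Or.inr h)
  by_cases hBy : ∃ n : ℤ, y₀ = n * c + y₁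
  · rw [bandTable_of_B _ _ _ _ hAy hBy, hBp]
    simp only [hAy, hBy, hBC hBy, true_and, false_and, or_false]
  by_cases hCy : ∃ n : ℤ, y₀ = n * c + c / 2 + y₁
  · rw [bandTable_of_C _ _ _ _ hAy hBy hCy, hCp]
    simp only [hAy, hBy, hCy, true_and, false_and, or_false, false_or]
  · rw [bandTable_of_O _ _ _ _ hAy hBy hCy]
    simp only [hAy, hBy, hCy, false_and, or_false]

/-! ### Normal forms of the `σ`-invariant cases -/

theorem linearIndependent_pair_of_det {a b a₀ b₀ : Plane} (h : LinearIndependent ℝ ![a₀, b₀])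
    (r s r' s' : ℝ) (ha : a = r • a₀ + s • b₀) (hb : b = r' • a₀ + s' • b₀)
    (hdet : r * s' - s * r' ≠ 0) : LinearIndependent ℝ ![a, b] := by
  rw [LinearIndependent.pair_iff]
  intro x y hxy
  have e : (x * r + y * r') • a₀ + (x * s + y * s') • b₀ = 0 := by
    rw [← hxy, ha, hb]; module
  obtain ⟨h1, h2⟩ := h.eq_zero_of_pair e
  constructor
  · exact (mul_eq_zero.1 (show x * (r * s' - s * r') = 0 by linear_combination s' * h1 - r' * h2)
      ).resolve_right hdet
  · exact (mul_eq_zero.1 (show y * (r * s' - s * r') = 0 by linear_combination r * h2 - s * h1)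
      ).resolve_right hdet

theorem straightLattice_congr {a b a' b' : Plane} (h : gen2 a b = gen2 a' b') (c : ℝ) :
    adaptedLattice a 0 b 0 c = adaptedLattice a' 0 b' 0 c := by
  ext z
  rw [← pt_eta z, mem_straightLattice, mem_straightLattice, h]

/-- The `σ`-invariant lattices and their `σ`-cosets, up to the choice of generators of the
projected lattice, with the periods for every width. -/
inductive NormalCase (a b : Plane) (c : ℝ) :
    AddSubgroup Space → Set Space → (ℝ → AddSubgroup Plane) → Prop
  | straight_empty (L : AddSubgroup Space) (S : Set Space) (A : AddSubgroup Plane)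
      (hL : L = adaptedLattice a 0 b 0 c) (hS : S = ∅) (hA : A = gen2 a b) :
      NormalCase a b c L S (fun _ => A)
  | straight_zero (y₁ : ℝ) (L : AddSubgroup Space) (S : Set Space) (A : AddSubgroup Plane)
      (hL : L = adaptedLattice a 0 b 0 c) (hS : S = cosetAt L 0 y₁) (hA : A = gen2 a b) :
      NormalCase a b c L S (fun _ => A)
  | straight_half (v : Plane) (y₁ : ℝ) (L : AddSubgroup Space) (S : Set Space)
      (A O : AddSubgroup Plane) (hL : L = adaptedLattice a 0 b 0 c) (hS : S = cosetAt L v y₁)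
      (hv : a = (2 : ℝ) • v) (hA : A = gen2 v b) (hO : O = gen2 a b) :
      NormalCase a b c L S (bandTable c y₁ A A O O)
  | centred_empty (L : AddSubgroup Space) (S : Set Space) (A O : AddSubgroup Plane)
      (hL : L = adaptedLattice a (c / 2) b 0 c) (hS : S = ∅)
      (hA : A = gen2 a b) (hO : O = gen2 ((2 : ℝ) • a) b) :
      NormalCase a b c L S (atMultiples c A O)
  | centred_zero (y₁ : ℝ) (L : AddSubgroup Space) (S : Set Space) (A O : AddSubgroup Plane)
      (hL : L = adaptedLattice a (c / 2) b 0 c) (hS : S = cosetAt L 0 y₁)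
      (hA : A = gen2 a b) (hO : O = gen2 ((2 : ℝ) • a) b) :
      NormalCase a b c L S (bandTable c y₁ A O A O)
  | centred_half (v : Plane) (y₁ : ℝ) (L : AddSubgroup Space) (S : Set Space)
      (A B C O : AddSubgroup Plane)
      (hL : L = adaptedLattice a (c / 2) b 0 c) (hS : S = cosetAt L v y₁)
      (hv : b = (2 : ℝ) • v) (hA : A = gen2 a v) (hB : B = gen2 ((2 : ℝ) • a) v)
      (hC : C = gen2 ((2 : ℝ) • a) (a + v)) (hO : O = gen2 ((2 : ℝ) • a) b) :
      NormalCase a b c L S (bandTable c y₁ A B C O)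

theorem NormalCase.exists_group {a b : Plane} {c : ℝ} {L : AddSubgroup Space} {S : Set Space}
    {P : ℝ → AddSubgroup Plane} (h : NormalCase a b c L S P) (hc : 0 < c)
    (hab : LinearIndependent ℝ ![a, b]) :
    ∃ Γ : Subgroup EuclideanGroup, IsCrystallographic Γ ∧ latticeOf Γ = L ∧ sigmaCoset Γ = S := by
  have hl : ∀ a₃, IsLattice (adaptedLattice a a₃ b 0 c) := fun a₃ =>
    isLattice_adaptedLattice hab hc.ne' _ _
  have h0 : (∃ n : ℤ, (0 : ℝ) = n * c) := ⟨0, by simp⟩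
  cases h with
  | straight_empty _ _ _ hL hS hA =>
    subst hL hS
    exact exists_group_of_isLattice (hl 0)
  | straight_zero y₁ _ _ _ hL hS hA =>
    subst hL hS
    refine exists_group_of_cosetAt (hl 0) sigma_mem_straightLattice y₁ ?_
    rw [smul_zero]; exact zero_mem _
  | straight_half v y₁ _ _ _ _ hL hS hv hA hO =>
    subst hL hS
    refine exists_group_of_cosetAt (hl 0) sigma_mem_straightLattice y₁ ?_
    rw [← hv, mem_straightLattice]; exact ⟨h0, left_mem_gen2 _ _⟩
  | centred_empty _ _ _ _ hL hS hA hO =>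
    subst hL hS
    exact exists_group_of_isLattice (hl _)
  | centred_zero y₁ _ _ _ _ hL hS hA hO =>
    subst hL hS
    refine exists_group_of_cosetAt (hl _) sigma_mem_centredLattice y₁ ?_
    rw [smul_zero]; exact zero_mem _
  | centred_half v y₁ _ _ _ _ _ _ hL hS hv hA hB hC hO =>
    subst hL hS
    refine exists_group_of_cosetAt (hl _) sigma_mem_centredLattice y₁ ?_
    rw [← hv, mem_centredLattice]; exact Or.inl ⟨h0, right_mem_gen2 _ _⟩

theorem NormalCase.commonPeriods_eq {a b : Plane} {c : ℝ} {P : ℝ → AddSubgroup Plane}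
    (hΓ : IsCrystallographic Γ) (h : NormalCase a b c (latticeOf Γ) (sigmaCoset Γ) P) (hc : 0 < c)
    (hab : LinearIndependent ℝ ![a, b]) {y₀ : ℝ} (hy : 0 < y₀) :
    commonPeriods Γ y₀ = P y₀ := by
  have h0 : (∃ n : ℤ, (0 : ℝ) = n * c) := ⟨0, by simp⟩
  cases h with
  | straight_empty _ _ _ hL hS hA =>
    rw [commonPeriods_of_empty hΓ hab hL hS (O := gen2 a b) (fun p => ?_) hy, hA]
    · unfold atMultiples; split_ifs <;> rfl
    · rw [mem_straightLattice]; exact (and_iff_right h0).symm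
  | straight_zero y₁ _ _ _ hL hS hA =>
    rw [hL] at hS
    rw [commonPeriods_of_straight hΓ hL hS (A := gen2 a b) (fun p => ?_) hy, hA]
    · unfold bandTable; split_ifs <;> rfl
    · rw [sub_zero, or_self]
  | straight_half v y₁ _ _ _ _ hL hS hv hA hO =>
    rw [hL] at hS
    subst hA hO
    exact commonPeriods_of_straight hΓ hL hS
      (fun p => by rw [hv]; exact mem_gen2_iff_two_smul_left _ _ _) hy
  | centred_empty _ _ _ _ hL hS hA hO =>
    subst hA
    refine commonPeriods_of_empty hΓ hab hL hS (fun p => ?_) hy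
    have : ¬ ∃ n : ℤ, 0 = n * c + c / 2 := by
      simpa using not_centred_of_straight hc (y₁ := 0) (y₀ := 0) ⟨0, by simp⟩
    rw [mem_centredLattice, hO]
    simp only [this, h0, true_and, false_and, or_false]
  | centred_zero y₁ _ _ _ _ hL hS hA hO =>
    rw [hL] at hS
    subst hO hA
    exact commonPeriods_of_centred hΓ hc hab hL hS (fun p => by rw [sub_zero, or_self])
      (fun p => by rw [sub_zero, or_self])
      (fun p => by rw [sub_zero]; exact mem_gen2_iff_two_smul_left _ _ _) hy
  | centred_half v y₁ _ _ _ _ _ _ hL hS hv hA hB hC hO =>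
    rw [hL] at hS
    subst hO hA hB hC
    refine commonPeriods_of_centred hΓ hc hab hL hS
      (fun p => by rw [hv]; exact mem_gen2_iff_two_smul_right _ _ _)
      (fun p => by rw [hv]; exact mem_gen2_iff_two_smul_right _ _ _)
      (fun p => ?_) hy
    -- Here `2 (a + v) = 2 a + b`, so doubling the second generator of row `C` recovers row `O`.
    have e : gen2 ((2 : ℝ) • a) ((2 : ℝ) • (a + v)) = gen2 ((2 : ℝ) • a) b :=
      gen2_eq_of_det 1 0 1 1 (by norm_num) (by push_cast; module) (by rw [hv]; push_cast; module)
    rw [mem_gen2_iff_two_smul_right, e, sub_sub, add_comm v a]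

/-! ### Rational compatibility of the tabulated periods. -/

theorem RationallyCompatible.trans {A B C : AddSubgroup Plane} (h : RationallyCompatible A B)
    (h' : RationallyCompatible B C) : RationallyCompatible A C := by
  obtain ⟨m, hm, h⟩ := h
  obtain ⟨n, hn, h'⟩ := h'
  refine ⟨n * m, mul_ne_zero hn hm, fun x hx => ?_⟩
  rw [mul_smul]
  exact h' _ (h x hx)

theorem rationallyCompatible_gen2 {a b : Plane} {B : AddSubgroup Plane}
    (ha : (2 : ℝ) • a ∈ B) (hb : (2 : ℝ) • b ∈ B) : RationallyCompatible (gen2 a b) B := by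
  refine ⟨2, two_ne_zero, fun x hx => ?_⟩
  obtain ⟨m, n, rfl⟩ := mem_gen2.1 hx
  have e : (2 : ℤ) • ((m : ℝ) • a + (n : ℝ) • b) = m • (2 : ℝ) • a + n • (2 : ℝ) • b := by
    rw [← Int.cast_smul_eq_zsmul ℝ, ← Int.cast_smul_eq_zsmul ℝ, ← Int.cast_smul_eq_zsmul ℝ]
    push_cast; module
  rw [e]
  exact B.add_mem (B.zsmul_mem ha m) (B.zsmul_mem hb n)

theorem isLattice_and_compatible_of_det {a b a' b' : Plane} (hab : LinearIndependent ℝ ![a, b])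
    (r s r' s' : ℝ) (ha : a' = r • a + s • b) (hb : b' = r' • a + s' • b)
    (hdet : r * s' - s * r' ≠ 0)
    (h1 : (2 : ℝ) • a' ∈ gen2 a b) (h2 : (2 : ℝ) • b' ∈ gen2 a b)
    (h3 : (2 : ℝ) • a ∈ gen2 a' b') (h4 : (2 : ℝ) • b ∈ gen2 a' b') :
    IsLattice (gen2 a' b') ∧ RationallyCompatible (gen2 a' b') (gen2 a b) ∧
      RationallyCompatible (gen2 a b) (gen2 a' b') :=
  ⟨isLattice_gen2 (linearIndependent_pair_of_det hab r s r' s' ha hb hdet),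
    rationallyCompatible_gen2 h1 h2, rationallyCompatible_gen2 h3 h4⟩

/-- Every entry of a table contains twice the module `gen2 a b` and becomes part of it when doubled,
so the factor `2` works both ways. -/
theorem NormalCase.isLattice_and_compatible {a b : Plane} {c : ℝ} {L : AddSubgroup Space}
    {S : Set Space} {P : ℝ → AddSubgroup Plane} (h : NormalCase a b c L S P)
    (hab : LinearIndependent ℝ ![a, b]) (y₀ : ℝ) :
    IsLattice (P y₀) ∧ RationallyCompatible (P y₀) (gen2 a b) ∧
      RationallyCompatible (gen2 a b) (P y₀) := by
  have mem : ∀ {u w z : Plane} (m n : ℤ), z = (m : ℝ) • u + (n : ℝ) • w → z ∈ gen2 u w :=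
    fun m n h => mem_gen2.2 ⟨m, n, h⟩
  have hself : IsLattice (gen2 a b) ∧ RationallyCompatible (gen2 a b) (gen2 a b) ∧
      RationallyCompatible (gen2 a b) (gen2 a b) :=
    ⟨isLattice_gen2 hab, ⟨1, one_ne_zero, fun x hx => by rwa [one_smul]⟩,
      ⟨1, one_ne_zero, fun x hx => by rwa [one_smul]⟩⟩
  have h2a : IsLattice (gen2 ((2 : ℝ) • a) b) ∧
      RationallyCompatible (gen2 ((2 : ℝ) • a) b) (gen2 a b) ∧
      RationallyCompatible (gen2 a b) (gen2 ((2 : ℝ) • a) b) :=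
    isLattice_and_compatible_of_det hab 2 0 0 1 (by module) (by module) (by norm_num)
      (mem 4 0 (by push_cast; module)) (mem 0 2 (by push_cast; module))
      (mem 1 0 (by push_cast; module)) (mem 0 2 (by push_cast; module))
  cases h with
  | straight_empty _ _ _ hL hS hA => rw [hA]; exact hself
  | straight_zero y₁ _ _ _ hL hS hA => rw [hA]; exact hself
  | straight_half v y₁ _ _ _ _ hL hS hv hA hO =>
    subst hA hO hv
    have := isLattice_and_compatible_of_det hab (a' := v) (b' := b) (1 / 2) 0 0 1 (by module)
      (by module) (by norm_num) (mem 1 0 (by push_cast; module)) (mem 0 2 (by push_cast; module))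
      (mem 4 0 (by push_cast; module)) (mem 0 2 (by push_cast; module))
    unfold bandTable
    split_ifs <;> assumption
  | centred_empty _ _ _ _ hL hS hA hO =>
    subst hA hO
    unfold atMultiples
    split_ifs <;> assumption
  | centred_zero y₁ _ _ _ _ hL hS hA hO =>
    subst hA hO
    unfold bandTable
    split_ifs <;> assumption
  | centred_half v y₁ _ _ _ _ _ _ hL hS hv hA hB hC hO =>
    subst hA hB hC hO hv
    have e1 := isLattice_and_compatible_of_det hab (a' := a) (b' := v) 1 0 0 (1 / 2) (by module)
      (by module) (by norm_num) (mem 2 0 (by push_cast; module)) (mem 0 1 (by push_cast; module))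
      (mem 2 0 (by push_cast; module)) (mem 0 4 (by push_cast; module))
    have e2 := isLattice_and_compatible_of_det hab (a' := (2 : ℝ) • a) (b' := v) 2 0 0 (1 / 2)
      (by module) (by module) (by norm_num) (mem 4 0 (by push_cast; module))
      (mem 0 1 (by push_cast; module)) (mem 1 0 (by push_cast; module))
      (mem 0 4 (by push_cast; module))
    have e3 := isLattice_and_compatible_of_det hab (a' := (2 : ℝ) • a) (b' := a + v) 2 0 1 (1 / 2)
      (by module) (by module) (by norm_num) (mem 4 0 (by push_cast; module))
      (mem 2 1 (by push_cast; module)) (mem 1 0 (by push_cast; module))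
      (mem (-2) 4 (by push_cast; module))
    unfold bandTable
    split_ifs <;> assumption

/-! ### The listed cases: normal forms and widths with the given periods -/

theorem IsShift.pos {L : AddSubgroup Space} {c y₁ : ℝ} {v : Plane} (h : IsShift L c v y₁) :
    0 < c := h.1.trans_lt h.2.1

/-- The excluded widths are countable, so their complement is dense. -/
theorem exists_generic_width {c : ℝ} (y₁ : ℝ) :
    ∃ y₀ : ℝ, 0 < y₀ ∧ (¬ ∃ n : ℤ, y₀ = n * c) ∧ (¬ ∃ n : ℤ, y₀ = n * c + y₁) ∧
      ¬ ∃ n : ℤ, y₀ = n * c + c / 2 + y₁ := by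
  have hcount : (Set.range (fun n : ℤ => (n : ℝ) * c) ∪ Set.range (fun n : ℤ => (n : ℝ) * c + y₁) ∪
      Set.range (fun n : ℤ => (n : ℝ) * c + c / 2 + y₁)).Countable :=
    ((Set.countable_range _).union (Set.countable_range _)).union (Set.countable_range _)
  obtain ⟨y₀, h, h0⟩ := (hcount.dense_compl ℝ).exists_mem_open (isOpen_Ioi (a := (0 : ℝ))) ⟨1, one_pos (α := ℝ)⟩
  refine ⟨y₀, h0, ?_, ?_, ?_⟩ <;> rintro ⟨n, hn⟩ <;> apply h
  · exact Or.inl (Or.inl ⟨n, hn.symm⟩)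
  · exact Or.inl (Or.inr ⟨n, hn.symm⟩)
  · exact Or.inr ⟨n, hn.symm⟩

theorem not_multiple_of_between {c y : ℝ} (m : ℤ) (h1 : m * c < y)
    (h2 : y < (m + 1) * c) : ¬ ∃ n : ℤ, y = n * c := by
  rintro ⟨n, rfl⟩
  have hc : 0 < c := by nlinarith
  have h1 := lt_of_mul_lt_mul_right h1 hc.le
  have h2 := lt_of_mul_lt_mul_right h2 hc.le
  norm_cast at h1 h2
  omega

theorem exists_width_O {c : ℝ} (y₁ : ℝ) (A B C O : AddSubgroup Plane) :
    ∃ y₀ : ℝ, 0 < y₀ ∧ bandTable c y₁ A B C O y₀ = O := by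
  obtain ⟨y₀, h, h1, h2, h3⟩ := exists_generic_width (c := c) y₁
  exact ⟨y₀, h, bandTable_of_O _ _ _ _ h1 h2 h3⟩

theorem exists_width_A {c : ℝ} (hc : 0 < c) (y₁ : ℝ) (A B C O : AddSubgroup Plane) :
    ∃ y₀ : ℝ, 0 < y₀ ∧ bandTable c y₁ A B C O y₀ = A :=
  ⟨c, hc, bandTable_of_A _ _ _ _ ⟨1, by simp⟩⟩

theorem exists_width_B {c y₁ : ℝ} (h0 : 0 ≤ y₁) (h1 : y₁ < c) (h : y₁ ≠ 0)
    (A B C O : AddSubgroup Plane) : ∃ y₀ : ℝ, 0 < y₀ ∧ bandTable c y₁ A B C O y₀ = B := by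
  have : 0 < y₁ := lt_of_le_of_ne h0 h.symm
  refine ⟨y₁, this, bandTable_of_B _ _ _ _ ?_ ⟨0, by simp⟩⟩
  exact not_multiple_of_between 0 (by push_cast; linarith) (by push_cast; linarith)

theorem exists_width_C {c y₁ : ℝ} (h0 : 0 ≤ y₁) (h1 : y₁ < c) (h : y₁ ≠ c / 2)
    (A B C O : AddSubgroup Plane) : ∃ y₀ : ℝ, 0 < y₀ ∧ bandTable c y₁ A B C O y₀ = C := by
  have hc : 0 < c := h0.trans_lt h1
  have hC : ∃ n : ℤ, c / 2 + y₁ = n * c + c / 2 + y₁ := ⟨0, by simp⟩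
  -- This width lies strictly between `0` and `c` or between `c` and `2 c`; at `y₁ = c / 2` it would
  -- be `c` and belong to row `A`.
  refine ⟨c / 2 + y₁, by linarith, bandTable_of_C _ _ _ _ ?_
    (fun hB => not_centred_of_straight hc hB hC) hC⟩
  rcases lt_or_gt_of_ne h with h | h
  · exact not_multiple_of_between 0 (by push_cast; linarith) (by push_cast; linarith)
  · exact not_multiple_of_between 1 (by push_cast; linarith) (by push_cast; linarith)

theorem exists_width_atMultiples {c : ℝ} (hc : 0 < c) (A O : AddSubgroup Plane) :
    ∃ y₀ : ℝ, 0 < y₀ ∧ atMultiples c A O y₀ = A :=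
  ⟨c, hc, atMultiples_pos _ _ ⟨1, by simp⟩⟩

theorem exists_width_not_atMultiples {c : ℝ} (hc : 0 < c) (A O : AddSubgroup Plane) :
    ∃ y₀ : ℝ, 0 < y₀ ∧ atMultiples c A O y₀ = O :=
  ⟨c / 2, half_pos hc, atMultiples_neg _ _
    (not_multiple_of_between 0 (by push_cast; linarith) (by push_cast; linarith))⟩

/-- Each table has an inhabited row equal to `gen2 a₀ b₀`. The conditions `y₁ ≠ 0` and `y₁ ≠ c / 2`
of cases 5.3 and 5.4 are what keeps that row inhabited. -/
theorem ListedCase.exists_width {a₀ b₀ : Plane} {k : CaseName} {L : AddSubgroup Space}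
    {S : Set Space} {P : ℝ → AddSubgroup Plane} (h : ListedCase a₀ b₀ k L S P) :
    ∃ y₀ : ℝ, 0 < y₀ ∧ P y₀ = gen2 a₀ b₀ := by
  cases h with
  | c1 => exact ⟨1, one_pos, rfl⟩
  | c21 a₃ b₃ c L S h => exact exists_width_atMultiples h.1 _ _
  | c22 a b a₃ b₃ c L S h => exact exists_width_not_atMultiples h.1 _ _
  | c31 => exact ⟨1, one_pos, rfl⟩
  | c32_empty c hc => exact exists_width_atMultiples hc _ _
  | c32_full c hc => exact exists_width_atMultiples (half_pos hc) _ _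
  | c33_empty c hc => exact exists_width_not_atMultiples hc _ _
  | c33_full c hc => exact exists_width_not_atMultiples (half_pos hc) _ _
  | c41_zero => exact ⟨1, one_pos, rfl⟩
  | c41_a => exact exists_width_O _ _ _ _ _
  | c41_b => exact exists_width_O _ _ _ _ _
  | c41_ab => exact exists_width_O _ _ _ _ _
  | c42 c y₁ L S hL hv => exact exists_width_A hv.pos _ _ _ _ _
  | c43 c y₁ L S hL hv => exact exists_width_A hv.pos _ _ _ _ _
  | c51_zero c y₁ L S hL hv => exact exists_width_A hv.pos _ _ _ _ _
  | c51_a c y₁ L S hL hv => exact exists_width_A hv.pos _ _ _ _ _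
  | c52_b c y₁ L S hL hv => exact exists_width_A hv.pos _ _ _ _ _
  | c52_ab c y₁ L S hL hv => exact exists_width_A hv.pos _ _ _ _ _
  | c53_b c y₁ L S hL hv hS hy => exact exists_width_C hv.1 hv.2.1 hy _ _ _ _
  | c53_a c y₁ L S hL hv hS hy => exact exists_width_B hv.1 hv.2.1 hy _ _ _ _
  | c54_b c y₁ L S hL hv hS hy => exact exists_width_B hv.1 hv.2.1 hy _ _ _ _
  | c54_ab c y₁ L S hL hv hS hy => exact exists_width_C hv.1 hv.2.1 hy _ _ _ _
  | c55_zero => exact exists_width_O _ _ _ _ _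
  | c55_a => exact exists_width_O _ _ _ _ _
  | c55_b => exact exists_width_O _ _ _ _ _
  | c55_ab => exact exists_width_O _ _ _ _ _

/-- A `σ`-coset equal to the lattice is the coset with shift `0`. Rows `A` and `C` of its table are
then the even and the odd multiples of `c / 2`, and row `B` is absorbed by `A`. -/
theorem atMultiples_half_eq_bandTable (c : ℝ) (A O : AddSubgroup Plane) :
    atMultiples (c / 2) A O = bandTable c 0 A O A O := by
  funext y₀
  have e : (∃ n : ℤ, y₀ = n * (c / 2)) ↔
      (∃ n : ℤ, y₀ = n * c) ∨ ∃ n : ℤ, y₀ = n * c + c / 2 + 0 := by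
    constructor
    · rintro ⟨n, rfl⟩
      rcases Int.even_or_odd' n with ⟨k, rfl | rfl⟩
      · exact Or.inl ⟨k, by push_cast; ring⟩
      · exact Or.inr ⟨k, by push_cast; ring⟩
    · rintro (⟨k, rfl⟩ | ⟨k, rfl⟩)
      · exact ⟨2 * k, by push_cast; ring⟩
      · exact ⟨2 * k + 1, by push_cast; ring⟩
  have e0 : (∃ n : ℤ, y₀ = n * c + 0) ↔ ∃ n : ℤ, y₀ = n * c := by simp
  by_cases hA : ∃ n : ℤ, y₀ = n * c
  · rw [atMultiples_pos _ _ (e.2 (Or.inl hA)), bandTable_of_A _ _ _ _ hA]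
  by_cases hC : ∃ n : ℤ, y₀ = n * c + c / 2 + 0
  · rw [atMultiples_pos _ _ (e.2 (Or.inr hC)), bandTable_of_C _ _ _ _ hA (by rwa [e0]) hC]
  · rw [atMultiples_neg _ _ (fun h => (e.1 h).elim hA hC),
      bandTable_of_O _ _ _ _ hA (by rwa [e0]) hC]

/-- The vector `(a, c / 2)` is in the lattice, so the summand `a` of `v'` can be traded for a shift
of the height. With `bandTable_shift` this pairs the cases of type 5. -/
theorem NormalCase.centred_translate {a b v v' : Plane} {c y₁ : ℝ} {S : Set Space}
    {L : AddSubgroup Space} (hL : L = adaptedLattice a (c / 2) b 0 c)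
    (hS : S = cosetAt L v' y₁) (hv' : v' = a + v) : S = cosetAt L v (y₁ - c / 2) := by
  rw [hS]
  refine cosetAt_eq ?_
  rw [hv', add_sub_cancel_right, sub_sub_cancel, hL, mem_adaptedLattice]
  exact ⟨1, 0, 0, by simp, by simp⟩

/-- The listed generators of `M` are expressed through generators adapted to the lattice; unimodular
changes identify the entries of the tables. -/
theorem ListedCase.exists_normalCase {a₀ b₀ : Plane} {k : CaseName} {L : AddSubgroup Space}
    {S : Set Space} {P : ℝ → AddSubgroup Plane} (h : ListedCase a₀ b₀ k L S P)
    (h₀ : LinearIndependent ℝ ![a₀, b₀])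
    (hk : k ≠ .case1 ∧ k ≠ .case21 ∧ k ≠ .case22) :
    ∃ a b c, 0 < c ∧ LinearIndependent ℝ ![a, b] ∧ NormalCase a b c L S P := by
  have h2b : LinearIndependent ℝ ![a₀, (2 : ℝ) • b₀] :=
    linearIndependent_pair_of_det h₀ 1 0 0 2 (by module) (by module) (by norm_num)
  have hha : LinearIndependent ℝ ![(1 / 2 : ℝ) • a₀, b₀] :=
    linearIndependent_pair_of_det h₀ (1 / 2) 0 0 1 (by module) (by module) (by norm_num)
  have hba : LinearIndependent ℝ ![b₀, a₀] :=
    linearIndependent_pair_of_det h₀ 0 1 1 0 (by module) (by module) (by norm_num)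
  cases h with
  | c1 => exact absurd rfl hk.1
  | c21 => exact absurd rfl hk.2.1
  | c22 => exact absurd rfl hk.2.2
  | c31 c hc _ _ hL hS =>
    refine ⟨a₀, b₀, c, hc, h₀, ?_⟩
    rcases hS with hS | hS
    · exact .straight_empty _ _ _ hL hS rfl
    · exact .straight_zero 0 _ _ _ hL (by rw [cosetAt_zero, hS]) rfl
  | c32_empty c hc _ _ hL hS => exact ⟨a₀, b₀, c, hc, h₀, .centred_empty _ _ _ _ hL hS rfl rfl⟩
  | c32_full c hc _ _ hL hS =>
    refine ⟨a₀, b₀, c, hc, h₀, ?_⟩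
    rw [atMultiples_half_eq_bandTable]
    exact .centred_zero 0 _ _ _ _ hL (by rw [cosetAt_zero, hS]) rfl rfl
  | c33_empty c hc _ _ hL hS =>
    exact ⟨_, b₀, c, hc, hha,
      .centred_empty _ _ _ _ hL hS rfl (by rw [two_smul_half_smul])⟩
  | c33_full c hc _ _ hL hS =>
    refine ⟨_, b₀, c, hc, hha, ?_⟩
    rw [atMultiples_half_eq_bandTable]
    exact .centred_zero 0 _ _ _ _ hL (by rw [cosetAt_zero, hS]) rfl (by rw [two_smul_half_smul])
  | c41_zero c y₁ _ _ hL hv hS =>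
    exact ⟨a₀, b₀, c, hv.pos, h₀, .straight_zero y₁ _ _ _ hL hS rfl⟩
  | c41_a c y₁ _ _ hL hv hS =>
    exact ⟨a₀, b₀, c, hv.pos, h₀,
      .straight_half _ y₁ _ _ _ _ hL hS (two_smul_half_smul _).symm rfl rfl⟩
  | c41_b c y₁ _ _ hL hv hS =>
    exact ⟨b₀, a₀, c, hv.pos, hba,
      .straight_half _ y₁ _ _ _ _ (hL.trans (straightLattice_congr (gen2_comm _ _) c)) hS
        (two_smul_half_smul _).symm (gen2_comm _ _) (gen2_comm _ _)⟩
  | c41_ab c y₁ _ _ hL hv hS =>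
    have e : gen2 a₀ b₀ = gen2 (a₀ + b₀) b₀ :=
      gen2_eq_of_det 1 (-1) 0 1 (by norm_num) (by push_cast; module) (by push_cast; module)
    refine ⟨a₀ + b₀, b₀, c, hv.pos, linearIndependent_pair_of_det h₀ 1 1 0 1 (by module)
      (by module) (by norm_num), .straight_half _ y₁ _ _ _ _ (hL.trans (straightLattice_congr e c))
        hS (two_smul_half_smul _).symm ?_ e⟩
    exact gen2_eq_of_det 2 (-1) 1 0 (by norm_num) (by push_cast; module) (by push_cast; module)
  | c42 c y₁ _ _ hL hv hS =>
    exact ⟨(2 : ℝ) • a₀, b₀, c, hv.pos, linearIndependent_pair_of_det h₀ 2 0 0 1 (by module)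
      (by module) (by norm_num), .straight_half _ y₁ _ _ _ _ hL hS rfl rfl rfl⟩
  | c43 c y₁ _ _ hL hv hS =>
    exact ⟨(2 : ℝ) • b₀, a₀, c, hv.pos, linearIndependent_pair_of_det h₀ 0 2 1 0 (by module)
      (by module) (by norm_num), .straight_half _ y₁ _ _ _ _
        (hL.trans (straightLattice_congr (gen2_comm _ _) c)) hS rfl (gen2_comm _ _)
        (gen2_comm _ _)⟩
  | c51_zero c y₁ _ _ hL hv hS =>
    exact ⟨a₀, b₀, c, hv.pos, h₀, .centred_zero y₁ _ _ _ _ hL hS rfl rfl⟩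
  | c51_a c y₁ _ _ hL hv hS =>
    refine ⟨a₀, b₀, c, hv.pos, h₀, ?_⟩
    -- The coset at `a₀` is the coset at `0` lowered by `c / 2`, which swaps rows `B` and `C`.
    rw [← bandTable_shift hv.pos]
    exact .centred_zero _ _ _ _ _ hL (NormalCase.centred_translate hL hS (by module)) rfl rfl
  | c52_b c y₁ _ _ hL hv hS =>
    exact ⟨a₀, _, c, hv.pos, h2b, .centred_half b₀ y₁ _ _ _ _ _ _ hL hS rfl rfl rfl rfl rfl⟩
  | c52_ab c y₁ _ _ hL hv hS =>
    refine ⟨a₀, _, c, hv.pos, h2b, ?_⟩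
    rw [← bandTable_shift hv.pos]
    exact .centred_half b₀ _ _ _ _ _ _ _ hL (NormalCase.centred_translate hL hS (by module))
      rfl rfl rfl rfl rfl
  | c53_b c y₁ _ _ hL hv hS hy =>
    refine ⟨_, b₀, c, hv.pos, linearIndependent_pair_of_det h₀ 1 (-(1 / 2)) 0 1 (by module)
      (by module) (by norm_num), .centred_half ((1 / 2 : ℝ) • b₀) y₁ _ _ _ _ _ _ hL hS
        (two_smul_half_smul _).symm ?_ ?_ ?_ ?_⟩
    -- With `a = a₀ - b₀ / 2` and `v = b₀ / 2` one has `a + v = a₀` and `2 a = 2 a₀ - b₀`; the four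
    -- determinants match rows `A`, `B`, `C`, `O`.
    · exact gen2_eq_of_det 1 1 0 1 (by norm_num) (by push_cast; module) (by push_cast; module)
    · exact gen2_eq_of_det 1 2 0 1 (by norm_num) (by push_cast; module) (by push_cast; module)
    · exact gen2_eq_of_det 0 1 (-1) 2 (by norm_num) (by push_cast; module) (by push_cast; module)
    · exact gen2_eq_of_det 1 1 0 1 (by norm_num) (by push_cast; module) (by push_cast; module)
  | c53_a c y₁ _ _ hL hv hS hy =>
    refine ⟨a₀ - (1 / 2 : ℝ) • b₀, b₀, c, hv.pos, linearIndependent_pair_of_det h₀ 1 (-(1 / 2)) 0 1 (by module)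
      (by module) (by norm_num), ?_⟩
    rw [← bandTable_shift hv.pos]
    refine .centred_half ((1 / 2 : ℝ) • b₀) _ _ _ _ _ _ _ hL
      (NormalCase.centred_translate hL hS (by module)) (two_smul_half_smul _).symm ?_ ?_ ?_ ?_
    · exact gen2_eq_of_det 1 1 0 1 (by norm_num) (by push_cast; module) (by push_cast; module)
    · exact gen2_eq_of_det 1 2 0 1 (by norm_num) (by push_cast; module) (by push_cast; module)
    · exact gen2_eq_of_det 0 1 (-1) 2 (by norm_num) (by push_cast; module) (by push_cast; module)
    · exact gen2_eq_of_det 1 1 0 1 (by norm_num) (by push_cast; module) (by push_cast; module)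
  | c54_b c y₁ _ _ hL hv hS hy =>
    refine ⟨_, _, c, hv.pos, linearIndependent_pair_of_det h₀ (1 / 2) 0 0 2 (by module)
      (by module) (by norm_num), .centred_half b₀ y₁ _ _ _ _ _ _ hL hS rfl rfl ?_ ?_ ?_⟩ <;>
    rw [two_smul_half_smul]
  | c54_ab c y₁ _ _ hL hv hS hy =>
    refine ⟨(1 / 2 : ℝ) • a₀, (2 : ℝ) • b₀, c, hv.pos, linearIndependent_pair_of_det h₀ (1 / 2) 0 0 2 (by module)
      (by module) (by norm_num), ?_⟩
    rw [← bandTable_shift hv.pos]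
    refine .centred_half b₀ _ _ _ _ _ _ _ hL
      (NormalCase.centred_translate hL hS (by module)) rfl rfl ?_ ?_ ?_ <;>
    rw [two_smul_half_smul]
  | c55_zero c y₁ _ _ hL hv hS =>
    exact ⟨_, b₀, c, hv.pos, hha,
      .centred_zero y₁ _ _ _ _ hL hS rfl (by rw [two_smul_half_smul])⟩
  | c55_a c y₁ _ _ hL hv hS =>
    refine ⟨_, b₀, c, hv.pos, hha, ?_⟩
    rw [← bandTable_shift hv.pos]
    exact .centred_zero _ _ _ _ _ hL (NormalCase.centred_translate hL hS (by module)) rfl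
      (by rw [two_smul_half_smul])
  | c55_b c y₁ _ _ hL hv hS =>
    refine ⟨_, b₀, c, hv.pos, hha, .centred_half ((1 / 2 : ℝ) • b₀) y₁ _ _ _ _ _ _ hL hS
        (two_smul_half_smul _).symm rfl ?_ ?_ ?_⟩ <;>
    rw [two_smul_half_smul]
    rw [smul_add]
  | c55_ab c y₁ _ _ hL hv hS =>
    refine ⟨_, b₀, c, hv.pos, hha, ?_⟩
    rw [← bandTable_shift hv.pos]
    refine .centred_half ((1 / 2 : ℝ) • b₀) _ _ _ _ _ _ _ hL
      (NormalCase.centred_translate hL hS (by module)) (two_smul_half_smul _).symm rfl ?_ ?_ ?_ <;>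
    rw [two_smul_half_smul]
    rw [smul_add]

/-! ### The cases that are not `σ`-invariant -/

theorem mem_obliqueLattice {a b c₀ x : Plane} {c₃ y : ℝ} :
    pt x y ∈ gen3 (pt a 0) (pt b 0) (pt c₀ c₃) ↔
      ∃ m n k : ℤ, x = (m : ℝ) • a + (n : ℝ) • b + (k : ℝ) • c₀ ∧ y = k * c₃ := by
  simp only [mem_gen3, pt_smul, pt_add, pt_inj, mul_zero, zero_add]

/-- A vertical lattice vector `(0, y₀)` would place a nonzero multiple of `c₀` in `gen2 a₀ b₀`. Only
the alternative `(p, 0) ∈ L` remains, and it has no component along `(c₀, c₃)`. -/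
theorem Case1.commonPeriods_eq (hΓ : IsCrystallographic Γ) {a₀ b₀ c₀ : Plane} {c₃ : ℝ}
    (h : Case1 a₀ b₀ c₀ c₃ (latticeOf Γ) (sigmaCoset Γ)) {y₀ : ℝ} (hy : 0 < y₀) :
    commonPeriods Γ y₀ = gen2 a₀ b₀ := by
  obtain ⟨hc, hn, hL, hS⟩ := h
  ext p
  have h0 : pt 0 y₀ ∉ gen3 (pt a₀ 0) (pt b₀ 0) (pt c₀ c₃) := by
    rw [mem_obliqueLattice]
    rintro ⟨m, n, k, hx, rfl⟩
    have hk : k ≠ 0 := by rintro rfl; simp at hy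
    refine hn k hk (mem_gen2.2 ⟨-m, -n, ?_⟩)
    rw [← Int.cast_smul_eq_zsmul ℝ, ← sub_eq_zero, hx]
    push_cast; module
  rw [mem_commonPeriods_iff hΓ hy, hL, hS]
  simp only [Set.mem_empty_iff_false, h0, false_and, or_false]
  rw [mem_obliqueLattice, mem_gen2]
  constructor
  · rintro ⟨m, n, k, rfl, hk⟩
    have hk : (k : ℝ) = 0 := by simpa [hc] using hk.symm
    exact ⟨m, n, by rw [hk]; module⟩
  · rintro ⟨m, n, rfl⟩
    exact ⟨m, n, 0, by push_cast; module, by simp⟩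

theorem mem_combinations {a b p : Plane} {D : AddSubgroup (ℤ × ℤ)} :
    p ∈ combinations a b D ↔ ∃ d ∈ D, p = (d.1 : ℝ) • a + (d.2 : ℝ) • b := by
  simp only [combinations, AddSubgroup.mem_map, AddMonoidHom.coprod_apply, zmultiplesHom_apply,
    Int.cast_smul_eq_zsmul, eq_comm]

theorem mem_diophantineModule {a₃ b₃ c : ℝ} {d : ℤ × ℤ} :
    d ∈ diophantineModule a₃ b₃ c ↔ ∃ k : ℤ, (d.1 : ℝ) * a₃ + (d.2 : ℝ) * b₃ = k * c := Iff.rfl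

theorem mem_combinations_diophantine {a b p : Plane} {a₃ b₃ c : ℝ} :
    p ∈ combinations a b (diophantineModule a₃ b₃ c) ↔ pt p 0 ∈ adaptedLattice a a₃ b b₃ c := by
  simp only [mem_combinations, mem_adaptedLattice, mem_diophantineModule]
  constructor
  · rintro ⟨⟨m, n⟩, ⟨k, hk⟩, rfl⟩
    exact ⟨m, n, -k, rfl, by push_cast; linear_combination -hk⟩
  · rintro ⟨m, n, k, rfl, hk⟩
    exact ⟨(m, n), ⟨-k, by push_cast; linear_combination -hk⟩, rfl⟩

theorem combinations_gen2 (a b : Plane) (d e : ℤ × ℤ) :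
    combinations a b (gen2 d e) = gen2 (d.1 • a + d.2 • b) (e.1 • a + e.2 • b) := by
  rw [combinations, gen2, AddMonoidHom.map_closure, Set.image_pair]
  rfl

theorem Case21.commonPeriods_eq (hΓ : IsCrystallographic Γ) {a₀ b₀ : Plane} {a₃ b₃ c : ℝ}
    (hab : LinearIndependent ℝ ![a₀, b₀])
    (h : Case21 a₀ b₀ a₃ b₃ c (latticeOf Γ) (sigmaCoset Γ)) {y₀ : ℝ} (hy : 0 < y₀) :
    commonPeriods Γ y₀ =
      atMultiples c (gen2 a₀ b₀) (combinations a₀ b₀ (diophantineModule a₃ b₃ c)) y₀ := by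
  obtain ⟨-, -, -, hL, -, hS⟩ := h
  exact commonPeriods_of_empty hΓ hab hL hS (fun p => mem_combinations_diophantine) hy

theorem Case22.combinations_eq {a₀ b₀ a b : Plane} {a₃ b₃ c : ℝ} {L : AddSubgroup Space}
    {S : Set Space} (h : Case22 a₀ b₀ a b a₃ b₃ c L S) :
    combinations a b (diophantineModule a₃ b₃ c) = gen2 a₀ b₀ := by
  obtain ⟨-, -, -, -, -, -, -, m₁, m₂, n₁, n₂, -, hD, ha, hb⟩ := h
  rw [hD, combinations_gen2, ← ha, ← hb]

theorem Case22.commonPeriods_eq (hΓ : IsCrystallographic Γ) {a₀ b₀ a b : Plane} {a₃ b₃ c : ℝ}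
    (h : Case22 a₀ b₀ a b a₃ b₃ c (latticeOf Γ) (sigmaCoset Γ)) {y₀ : ℝ} (hy : 0 < y₀) :
    commonPeriods Γ y₀ = atMultiples c (gen2 a b) (gen2 a₀ b₀) y₀ := by
  rw [← h.combinations_eq]
  obtain ⟨-, -, -, hab, hL, -, hS, -⟩ := h
  exact commonPeriods_of_empty hΓ hab hL hS (fun p => mem_combinations_diophantine) hy

/-- If `(1, 0)` and `(0, 1)` both belonged, `a₃` and `b₃` would be multiples of `c` in `[0, c)`,
hence `0`; the lattice would be straight and so `σ`-invariant. -/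
theorem exists_not_mem_diophantineModule {a b : Plane} {a₃ b₃ c : ℝ}
    (ha : a₃ ∈ Set.Ico 0 c) (hb : b₃ ∈ Set.Ico 0 c)
    (hσ : SigmaBreaks (adaptedLattice a a₃ b b₃ c)) :
    ∃ d, d ∉ diophantineModule a₃ b₃ c := by
  by_contra! hall
  have hc : 0 < c := ha.1.trans_lt ha.2
  have key : ∀ z ∈ Set.Ico 0 c, (∃ k : ℤ, z = k * c) → z = 0 := by
    intro z hz hk
    by_contra h
    have : 0 < z := lt_of_le_of_ne hz.1 (Ne.symm h)
    exact not_multiple_of_between 0 (by push_cast; linarith) (by push_cast; linarith [hz.2]) hk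
  have h1 : a₃ = 0 := key _ ha (by simpa [mem_diophantineModule] using hall (1, 0))
  have h2 : b₃ = 0 := key _ hb (by simpa [mem_diophantineModule] using hall (0, 1))
  rw [h1, h2] at hσ
  exact hσ sigma_mem_straightLattice

theorem combinations_lt {a b : Plane} {a₃ b₃ c : ℝ} (hab : LinearIndependent ℝ ![a, b])
    (ha : a₃ ∈ Set.Ico 0 c) (hb : b₃ ∈ Set.Ico 0 c)
    (hσ : SigmaBreaks (adaptedLattice a a₃ b b₃ c)) :
    combinations a b (diophantineModule a₃ b₃ c) < gen2 a b := by
  rw [SetLike.lt_iff_le_and_exists]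
  constructor
  · intro p hp
    obtain ⟨d, -, rfl⟩ := mem_combinations.1 hp
    exact mem_gen2.2 ⟨_, _, rfl⟩
  · obtain ⟨d, hd⟩ := exists_not_mem_diophantineModule ha hb hσ
    refine ⟨(d.1 : ℝ) • a + (d.2 : ℝ) • b, mem_gen2.2 ⟨_, _, rfl⟩, fun h => hd ?_⟩
    obtain ⟨e, he, h⟩ := mem_combinations.1 h
    obtain ⟨h1, h2⟩ := hab.eq_of_pair h
    have : d = e := Prod.ext (by exact_mod_cast h1) (by exact_mod_cast h2)
    rwa [this]

/-- Cramer's rule: the determinant is a valid multiplier. -/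
theorem rationallyCompatible_of_det {a b : Plane} {H : AddSubgroup Plane} {d e : ℤ × ℤ}
    (hd : (d.1 : ℝ) • a + (d.2 : ℝ) • b ∈ H) (he : (e.1 : ℝ) • a + (e.2 : ℝ) • b ∈ H)
    (hdet : d.1 * e.2 - d.2 * e.1 ≠ 0) : RationallyCompatible (gen2 a b) H := by
  refine ⟨_, hdet, fun x hx => ?_⟩
  obtain ⟨m, n, rfl⟩ := mem_gen2.1 hx
  have e : (d.1 * e.2 - d.2 * e.1) • ((m : ℝ) • a + (n : ℝ) • b) =
      (m * e.2 - n * e.1) • ((d.1 : ℝ) • a + (d.2 : ℝ) • b) +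
      (n * d.1 - m * d.2) • ((e.1 : ℝ) • a + (e.2 : ℝ) • b) := by
    rw [← Int.cast_smul_eq_zsmul ℝ, ← Int.cast_smul_eq_zsmul ℝ, ← Int.cast_smul_eq_zsmul ℝ]
    push_cast; module
  rw [e]
  exact H.add_mem (H.zsmul_mem hd _) (H.zsmul_mem he _)

theorem rationallyCompatible_of_le {A B : AddSubgroup Plane} (h : A ≤ B) :
    RationallyCompatible A B :=
  ⟨1, one_ne_zero, fun x hx => by rw [one_smul]; exact h hx⟩

theorem Case22.isLattice_and_compatible {a₀ b₀ a b : Plane} {a₃ b₃ c : ℝ}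
    {L : AddSubgroup Space} {S : Set Space} (h : Case22 a₀ b₀ a b a₃ b₃ c L S)
    (h₀ : LinearIndependent ℝ ![a₀, b₀]) (y₀ : ℝ) :
    IsLattice (atMultiples c (gen2 a b) (gen2 a₀ b₀) y₀) ∧
      RationallyCompatible (atMultiples c (gen2 a b) (gen2 a₀ b₀) y₀) (gen2 a₀ b₀) ∧
      RationallyCompatible (gen2 a₀ b₀) (atMultiples c (gen2 a b) (gen2 a₀ b₀) y₀) := by
  obtain ⟨-, -, -, hab, -, -, -, m₁, m₂, n₁, n₂, hdet, -, ha, hb⟩ := h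
  rw [← Int.cast_smul_eq_zsmul ℝ, ← Int.cast_smul_eq_zsmul ℝ] at ha hb
  unfold atMultiples
  split_ifs
  · refine ⟨isLattice_gen2 hab, ?_, rationallyCompatible_of_le
      (gen2_le (mem_gen2.2 ⟨_, _, ha⟩) (mem_gen2.2 ⟨_, _, hb⟩))⟩
    exact rationallyCompatible_of_det (d := (m₁, m₂)) (e := (n₁, n₂)) (ha ▸ left_mem_gen2 a₀ b₀)
      (hb ▸ right_mem_gen2 a₀ b₀) hdet
  · exact ⟨isLattice_gen2 h₀, rationallyCompatible_of_le le_rfl, rationallyCompatible_of_le le_rfl⟩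

/-! ### Subgroups and images of lattices -/

/-- An integer basis of `H` spans `E` over the reals. Having at most `dim E` members, it has exactly
that many and is linearly independent. -/
theorem isLattice_of_finrank_le {E : Type*} [AddCommGroup E] [Module ℝ E]
    [FiniteDimensional ℝ E] (H : Submodule ℤ E) [Module.Finite ℤ H]
    (hrank : Module.finrank ℤ H ≤ Module.finrank ℝ E)
    (hspan : Submodule.span ℝ (H : Set E) = ⊤) : IsLattice H.toAddSubgroup := by
  have : IsAddTorsionFree E := ⟨fun n hn x y h => by
    refine smul_right_injective E (Nat.cast_ne_zero (R := ℝ).2 hn) ?_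
    simpa only [Nat.cast_smul_eq_nsmul] using h⟩
  have : Module.Free ℤ H := Module.free_of_finite_type_torsion_free'
  let b := Module.finBasis ℤ H
  have hr : Submodule.span ℤ (Set.range fun i => (b i : E)) = H := by
    have := b.span_eq
    apply_fun Submodule.map H.subtype at this
    rw [Submodule.map_span, Submodule.map_top, Submodule.range_subtype, ← Set.range_comp] at this
    exact this
  have hs : ⊤ ≤ Submodule.span ℝ (Set.range fun i => (b i : E)) := by
    rw [← hspan, Submodule.span_le]
    intro x hx
    rw [SetLike.mem_coe, ← hr] at hx
    exact Submodule.span_le_restrictScalars ℤ ℝ _ hx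
  have hn : Module.finrank ℝ E = Module.finrank ℤ H := by
    refine le_antisymm ?_ hrank
    have := finrank_range_le_card (R := ℝ) fun i => (b i : E)
    rw [Set.finrank, top_le_iff.1 hs, finrank_top, Fintype.card_fin] at this
    exact this
  rw [isLattice_iff hn]
  refine ⟨fun i => b i, linearIndependent_of_top_le_span_of_card_eq_finrank hs
    (by rw [Fintype.card_fin, hn]), ?_⟩
  rw [← Submodule.span_int_eq_addSubgroupClosure, hr]

theorem IsLattice.span_eq_top {E : Type*} [AddCommGroup E] [Module ℝ E]
    [FiniteDimensional ℝ E] {L : AddSubgroup E} (hL : IsLattice L) :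
    Submodule.span ℝ (L : Set E) = ⊤ := by
  obtain ⟨l, hl, rfl⟩ := hL
  rw [← top_le_iff, ← hl.span_eq_top_of_card_eq_finrank' (Fintype.card_fin _)]
  exact Submodule.span_mono AddSubgroup.subset_closure

theorem IsLattice.exists_submodule {E : Type*} [AddCommGroup E] [Module ℝ E]
    [FiniteDimensional ℝ E] {L : AddSubgroup E} (hL : IsLattice L) :
    ∃ N : Submodule ℤ E, N.toAddSubgroup = L ∧ Module.Finite ℤ N ∧
      Module.finrank ℤ N = Module.finrank ℝ E := by
  obtain ⟨l, hl, rfl⟩ := hL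
  have hz : LinearIndependent ℤ l := hl.restrict_scalars' ℤ
  refine ⟨Submodule.span ℤ (Set.range l), Submodule.span_int_eq_addSubgroupClosure _,
    Module.Finite.span_of_finite ℤ (Set.finite_range l), ?_⟩
  rw [finrank_span_eq_card hz, Fintype.card_fin]

/-- The rank is bounded by that of the larger lattice, and `u`, `v` provide the real span. -/
theorem isLattice_of_le {L H : AddSubgroup Plane} (hL : IsLattice L) (hH : H ≤ L) {u v : Plane}
    (huv : LinearIndependent ℝ ![u, v]) (hu : u ∈ H) (hv : v ∈ H) : IsLattice H := by
  obtain ⟨N, rfl, hfin, hrank⟩ := hL.exists_submodule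
  let K : Submodule ℤ Plane := AddSubgroup.toIntSubmodule H
  have hKN : K ≤ N := hH
  have : IsNoetherian ℤ N := isNoetherian_of_isNoetherianRing_of_finite ℤ N
  have hK : Module.Finite ℤ K :=
    Module.Finite.of_injective (Submodule.inclusion hKN) (Submodule.inclusion_injective hKN)
  refine isLattice_of_finrank_le K ?_ ?_
  · rw [← hrank]; exact Submodule.finrank_mono hKN
  · rw [← top_le_iff, ← huv.span_eq_top_of_card_eq_finrank' (by simp)]
    refine Submodule.span_mono ?_
    rintro _ ⟨i, rfl⟩
    fin_cases i
    · exact hu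
    · exact hv

/-- The kernel of `φ` on the lattice contains `m` independent vectors, so by rank and nullity the
image has rank at most `3 - m`, the dimension of `F`; it spans `F` because `φ` is surjective. -/
theorem IsLattice.map {F : Type*} [AddCommGroup F] [Module ℝ F] [FiniteDimensional ℝ F]
    {L : AddSubgroup Space} (hL : IsLattice L) (φ : Space →ₗ[ℝ] F)
    (hφ : Function.Surjective φ) {m : ℕ} (hm : Module.finrank ℝ F + m = 3) (v : Fin m → Space)
    (hv : LinearIndependent ℝ v) (hvL : ∀ i, v i ∈ L) (hvφ : ∀ i, φ (v i) = 0) :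
    IsLattice (L.map (φ : Space →+ F)) := by
  obtain ⟨N, rfl, hfin, hrank⟩ := hL.exists_submodule
  rw [finrank_space] at hrank
  let f : N →ₗ[ℤ] F := (φ.restrictScalars ℤ) ∘ₗ N.subtype
  have hsum := (LinearMap.ker f).finrank_quotient_add_finrank
  rw [f.quotKerEquivRange.finrank_eq, hrank] at hsum
  have hker : m ≤ Module.finrank ℤ (LinearMap.ker f) := by
    let w : Fin m → LinearMap.ker f := fun i => ⟨⟨v i, hvL i⟩, hvφ i⟩
    have hw : LinearIndependent ℤ w := by
      refine LinearIndependent.of_comp (N.subtype ∘ₗ (LinearMap.ker f).subtype) ?_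
      exact hv.restrict_scalars' ℤ
    have : IsNoetherian ℤ N := isNoetherian_of_isNoetherianRing_of_finite ℤ N
    have : Module.Finite ℤ (LinearMap.ker f) := Module.IsNoetherian.finite ℤ _
    simpa using hw.fintype_card_le_finrank
  have e : N.toAddSubgroup.map (φ : Space →+ F) = (LinearMap.range f).toAddSubgroup := by
    ext x
    constructor
    · rintro ⟨y, hy, rfl⟩; exact ⟨⟨y, hy⟩, rfl⟩
    · rintro ⟨⟨y, hy⟩, rfl⟩; exact ⟨y, hy, rfl⟩
  have hspan := hL.span_eq_top
  rw [e]
  refine isLattice_of_finrank_le _ (by omega) ?_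
  have : (LinearMap.range f : Set F) = φ '' (N : Set Space) := by
    ext x
    constructor
    · rintro ⟨⟨y, hy⟩, rfl⟩; exact ⟨y, hy, rfl⟩
    · rintro ⟨y, hy, rfl⟩; exact ⟨⟨y, hy⟩, rfl⟩
  rw [this, ← Submodule.map_span]
  erw [hspan]
  rw [Submodule.map_top, LinearMap.range_eq_top.2 hφ]

theorem Case21.isLattice_iff {a b : Plane} (hab : LinearIndependent ℝ ![a, b])
    (D : AddSubgroup (ℤ × ℤ)) :
    IsLattice (combinations a b D) ↔ ∃ d ∈ D, ∃ e ∈ D, d.1 * e.2 - d.2 * e.1 ≠ 0 := by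
  constructor
  · intro h
    obtain ⟨u, v, huv, he⟩ := h.exists_areGenerators
    obtain ⟨d, hd, hu⟩ := mem_combinations.1 (he ▸ left_mem_gen2 u v)
    obtain ⟨e, he, hv⟩ := mem_combinations.1 (he ▸ right_mem_gen2 u v)
    refine ⟨d, hd, e, he, fun hdet => ?_⟩
    have hdet' : (d.1 : ℝ) * e.2 - d.2 * e.1 = 0 := by exact_mod_cast hdet
    -- By Cramer's rule these combinations of `u` and `v` are the determinant times `a` and `b`. If
    -- it vanishes, independence of `u`, `v` kills the coefficients of `v`.
    have h1 : (e.2 : ℝ) • u + (-d.2 : ℝ) • v = 0 := by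
      rw [hu, hv]
      calc _ = ((d.1 : ℝ) * e.2 - d.2 * e.1) • a := by module
        _ = 0 := by rw [hdet', zero_smul]
    have h2 : (-e.1 : ℝ) • u + (d.1 : ℝ) • v = 0 := by
      rw [hu, hv]
      calc _ = ((d.1 : ℝ) * e.2 - d.2 * e.1) • b := by module
        _ = 0 := by rw [hdet', zero_smul]
    obtain ⟨h3, h4⟩ := huv.eq_zero_of_pair h1
    obtain ⟨h5, h6⟩ := huv.eq_zero_of_pair h2
    have : v = 0 := by rw [hv, h3, neg_eq_zero.1 h5]; simp
    exact huv.ne_zero 1 this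
  · rintro ⟨d, hd, e, he, hdet⟩
    have hdet' : (d.1 : ℝ) * e.2 - d.2 * e.1 ≠ 0 := by exact_mod_cast hdet
    refine isLattice_of_le (isLattice_gen2 hab) ?_
      (linearIndependent_pair_of_det hab d.1 d.2 e.1 e.2 rfl rfl hdet')
      (mem_combinations.2 ⟨d, hd, rfl⟩) (mem_combinations.2 ⟨e, he, rfl⟩)
    intro p hp
    obtain ⟨d, -, rfl⟩ := mem_combinations.1 hp
    exact mem_gen2.2 ⟨_, _, rfl⟩

/-! ### The structure of lattices in three-space -/

/-- The projection onto the plane. -/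
def horizontalPart : Space →ₗ[ℝ] Plane where
  toFun := WithLp.fst
  map_add' _ _ := rfl
  map_smul' _ _ := rfl

/-- The vertical coordinate. -/
def verticalPart : Space →ₗ[ℝ] ℝ where
  toFun := WithLp.snd
  map_add' _ _ := rfl
  map_smul' _ _ := rfl

theorem adaptedLattice_le {L : AddSubgroup Space} {a b : Plane} {a₃ b₃ c : ℝ}
    (ha : pt a a₃ ∈ L) (hb : pt b b₃ ∈ L) (hc : pt 0 c ∈ L) : adaptedLattice a a₃ b b₃ c ≤ L :=
  gen3_le ha hb hc

theorem zsmul_pt_mem {L : AddSubgroup Space} {x : Plane} {y : ℝ} (h : pt x y ∈ L) (n : ℤ) :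
    pt ((n : ℝ) • x) (n * y) ∈ L := by
  rw [← pt_smul, Int.cast_smul_eq_zsmul]; exact L.zsmul_mem h n

/-- Reduction of the vertical coordinate modulo `c`. -/
theorem exists_Ico_of_pos {c : ℝ} (hc : 0 < c) (y : ℝ) :
    ∃ n : ℤ, y - n * c ∈ Set.Ico 0 c := by
  refine ⟨⌊y / c⌋, ?_, ?_⟩
  · have := mul_le_mul_of_nonneg_right (Int.floor_le (y / c)) hc.le
    rw [div_mul_cancel₀ _ hc.ne'] at this
    linarith
  · have := mul_lt_mul_of_pos_right (Int.lt_floor_add_one (y / c)) hc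
    rw [div_mul_cancel₀ _ hc.ne'] at this
    linarith

/-- The vector `(0, c)` lies in the kernel of the horizontal projection, so the image is a planar
lattice. Its generators are lifted with heights reduced modulo `c`; what remains of a lattice vector
is a vertical translation. -/
theorem IsLattice.exists_adaptedLattice {L : AddSubgroup Space} (hL : IsLattice L) {c : ℝ}
    (hc : 0 < c) (hV : ∀ q : ℝ, pt 0 q ∈ L ↔ ∃ n : ℤ, q = n * c) :
    ∃ (a b : Plane) (a₃ b₃ : ℝ), LinearIndependent ℝ ![a, b] ∧ a₃ ∈ Set.Ico 0 c ∧
      b₃ ∈ Set.Ico 0 c ∧ L = adaptedLattice a a₃ b b₃ c := by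
  have hcL : pt 0 c ∈ L := (hV c).2 ⟨1, by simp⟩
  have hlat := hL.map horizontalPart (fun x => ⟨pt x 0, rfl⟩) (m := 1) (by rw [finrank_plane])
    ![pt 0 c] (by
      refine LinearIndependent.of_subsingleton (0 : Fin 1) ?_
      intro h
      exact hc.ne' (congrArg WithLp.snd h)) (by simpa using hcL) (by intro i; fin_cases i; rfl)
  obtain ⟨a, b, hab, he⟩ := hlat.exists_areGenerators
  have lift : ∀ x ∈ L.map (horizontalPart : Space →+ Plane), ∃ y ∈ Set.Ico 0 c, pt x y ∈ L := by
    rintro _ ⟨z, hz, rfl⟩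
    obtain ⟨n, hn⟩ := exists_Ico_of_pos hc z.snd
    refine ⟨_, hn, ?_⟩
    have := L.sub_mem hz (zsmul_pt_mem hcL n)
    rw [← pt_eta z, smul_zero, pt_sub, sub_zero] at this
    exact this
  obtain ⟨a₃, ha₃, ha⟩ := lift a (he ▸ left_mem_gen2 a b)
  obtain ⟨b₃, hb₃, hb⟩ := lift b (he ▸ right_mem_gen2 a b)
  refine ⟨a, b, a₃, b₃, hab, ha₃, hb₃, le_antisymm ?_ (adaptedLattice_le ha hb hcL)⟩
  intro z hz
  have hz' : z.fst ∈ gen2 a b := he ▸ ⟨z, hz, rfl⟩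
  obtain ⟨m, n, h⟩ := mem_gen2.1 hz'
  have h1 := L.sub_mem hz (L.add_mem (zsmul_pt_mem ha m) (zsmul_pt_mem hb n))
  rw [pt_add, ← h, ← pt_eta z, pt_sub, pt_fst, sub_self, hV] at h1
  obtain ⟨k, hk⟩ := h1
  rw [← pt_eta z, mem_adaptedLattice]
  refine ⟨m, n, k, h, ?_⟩
  linarith

/-- The vertical coordinate maps the lattice onto a cyclic group, since `(a, 0)` and `(b, 0)` lie in
its kernel. A preimage of a generator serves as `(c₀, c₃)`. -/
theorem IsLattice.exists_obliqueLattice {L : AddSubgroup Space} (hL : IsLattice L)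
    (hV : ∀ q : ℝ, pt 0 q ∈ L → q = 0) {a b : Plane} (hab : LinearIndependent ℝ ![a, b])
    (h0 : ∀ p, p ∈ gen2 a b ↔ pt p 0 ∈ L) : ∃ c₀ c₃, Case1 a b c₀ c₃ L ∅ := by
  have ha : pt a 0 ∈ L := (h0 a).1 (left_mem_gen2 a b)
  have hb : pt b 0 ∈ L := (h0 b).1 (right_mem_gen2 a b)
  have hlat := hL.map verticalPart (fun y => ⟨pt 0 y, rfl⟩) (m := 2)
    (by rw [Module.finrank_self]) ![pt a 0, pt b 0] (by
      rw [LinearIndependent.pair_iff]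
      intro r s h
      rw [pt_smul, pt_smul, pt_add, ← pt_zero, pt_inj] at h
      exact hab.eq_zero_of_pair h.1) (by
      intro i; fin_cases i
      · exact ha
      · exact hb) (by intro i; fin_cases i <;> rfl)
  obtain ⟨l, hl, he⟩ := (isLattice_iff (Module.finrank_self ℝ)).1 hlat
  rw [Set.range_unique] at he
  have hc₃ : l default ≠ 0 := hl.ne_zero default
  obtain ⟨z, hz, hz₃⟩ : l default ∈ L.map (verticalPart : Space →+ ℝ) := by
    rw [he]; exact AddSubgroup.mem_closure_singleton_self _
  replace hz₃ : z.snd = l default := hz₃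
  replace hz : pt z.fst z.snd ∈ L := hz
  refine ⟨z.fst, z.snd, by rwa [hz₃], ?_, le_antisymm ?_ (gen3_le ha hb hz), rfl⟩
  -- If `n c₀` were in the planar lattice, subtracting it would leave the vertical vector `(0, n
  -- c₃)`, which is excluded.
  · intro n hn hmem
    have h1 := L.sub_mem (zsmul_pt_mem hz n) ((h0 _).1 hmem)
    rw [pt_sub, Int.cast_smul_eq_zsmul, sub_self, sub_zero] at h1
    have h2 := hV _ h1
    rw [hz₃] at h2
    exact (mul_ne_zero (Int.cast_ne_zero.2 hn) hc₃) h2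
  · intro w hw
    have hw' : w.snd ∈ L.map (verticalPart : Space →+ ℝ) := ⟨w, hw, rfl⟩
    rw [he] at hw'
    obtain ⟨k, hk⟩ := AddSubgroup.mem_closure_singleton.1 hw'
    rw [← hz₃, zsmul_eq_mul] at hk
    have h1 := L.sub_mem hw (zsmul_pt_mem hz k)
    rw [← pt_eta w, pt_sub, hk, sub_self, ← h0] at h1
    obtain ⟨m, n, h⟩ := mem_gen2.1 h1
    rw [← pt_eta w, mem_obliqueLattice]
    exact ⟨m, n, k, by rw [← h, sub_add_cancel], hk.symm⟩

theorem adaptedLattice_swap (a b : Plane) (a₃ b₃ c : ℝ) :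
    adaptedLattice a a₃ b b₃ c = adaptedLattice b b₃ a a₃ c := by
  ext z
  rw [← pt_eta z, mem_adaptedLattice, mem_adaptedLattice]
  constructor <;> rintro ⟨m, n, k, h, h'⟩ <;>
    exact ⟨n, m, k, by rw [h, add_comm], by rw [h', add_comm (_ * _) (_ * _)]⟩

theorem adaptedLattice_sub (a b : Plane) (a₃ b₃ c : ℝ) :
    adaptedLattice a a₃ b b₃ c = adaptedLattice a a₃ (b - a) (b₃ - a₃) c := by
  ext z
  rw [← pt_eta z, mem_adaptedLattice, mem_adaptedLattice]
  constructor <;> rintro ⟨m, n, k, h, h'⟩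
  · exact ⟨m + n, n, k, by rw [h]; push_cast; module, by rw [h']; push_cast; ring⟩
  · exact ⟨m - n, n, k, by rw [h]; push_cast; module, by rw [h']; push_cast; ring⟩

/-- A `σ`-invariant lattice with vertical period `c` is straight or centred. -/
theorem exists_straight_or_centred {L : AddSubgroup Space} {c : ℝ} {a b : Plane} {a₃ b₃ : ℝ}
    (hab : LinearIndependent ℝ ![a, b]) (ha₃ : a₃ ∈ Set.Ico 0 c) (hb₃ : b₃ ∈ Set.Ico 0 c)
    (hL : L = adaptedLattice a a₃ b b₃ c) (hσ : ∀ z ∈ L, sigma z ∈ L) :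
    ∃ a b : Plane, LinearIndependent ℝ ![a, b] ∧
      (L = adaptedLattice a 0 b 0 c ∨ L = adaptedLattice a (c / 2) b 0 c) := by
  have hc : 0 < c := ha₃.1.trans_lt ha₃.2
  -- The vector `z - σ z = (0, 2 y)` is a vertical translation, so `2 y` is a multiple of `c` in
  -- `[0, 2 c)`.
  have half : ∀ x y, y ∈ Set.Ico 0 c → pt x y ∈ L → y = 0 ∨ y = c / 2 := by
    intro x y hy h
    have h1 := L.sub_mem h (hσ _ h)
    rw [sigma_pt, pt_sub, sub_self, hL, vertical_mem_adaptedLattice hab] at h1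
    obtain ⟨n, hn⟩ := h1
    have h2 : (-1 : ℝ) < n := by
      by_contra! hcon
      nlinarith [hy.1]
    have h3 : (n : ℝ) < 2 := by
      by_contra! hcon
      nlinarith [hy.2]
    norm_cast at h2 h3
    have : n = 0 ∨ n = 1 := by
      have : (-1 : ℤ) < n := by exact_mod_cast h2
      omega
    rcases this with rfl | rfl
    · left; push_cast at hn; linarith
    · right; push_cast at hn; linarith
  have ha := half a a₃ ha₃ (by rw [hL, mem_adaptedLattice]; exact ⟨1, 0, 0, by simp, by simp⟩)
  have hb := half b b₃ hb₃ (by rw [hL, mem_adaptedLattice]; exact ⟨0, 1, 0, by simp, by simp⟩)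
  rcases ha with rfl | rfl <;> rcases hb with rfl | rfl
  · exact ⟨a, b, hab, Or.inl hL⟩
  · exact ⟨b, a, linearIndependent_pair_of_det hab 0 1 1 0 (by module) (by module) (by norm_num),
      Or.inr (by rw [hL, adaptedLattice_swap])⟩
  · exact ⟨a, b, hab, Or.inr hL⟩
  -- Both heights are `c / 2`, so the difference of the generators is horizontal.
  · exact ⟨a, b - a, linearIndependent_pair_of_det hab 1 0 (-1) 1 (by module) (by module)
      (by norm_num), Or.inr (by rw [hL, adaptedLattice_sub, sub_self])⟩

/-! ### Normalization of the `σ`-coset. -/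

theorem cosetAt_reduce {L : AddSubgroup Space} {c : ℝ} (hc : 0 < c) (hcL : pt 0 c ∈ L)
    (v : Plane) (y : ℝ) : ∃ y₁ ∈ Set.Ico 0 c, cosetAt L v y = cosetAt L v y₁ := by
  obtain ⟨n, hn⟩ := exists_Ico_of_pos hc y
  refine ⟨_, hn, cosetAt_eq ?_⟩
  have := zsmul_pt_mem hcL n
  rwa [sub_self, sub_sub_cancel, ← smul_zero (n : ℝ)]

theorem vertical_period_mem (a b : Plane) (a₃ b₃ c : ℝ) :
    pt 0 c ∈ adaptedLattice a a₃ b b₃ c :=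
  mem_adaptedLattice.2 ⟨0, 0, 1, by simp, by simp⟩

theorem two_smul_mem_of_sigmaCoset {v : Plane} {y : ℝ} (h : pt v y ∈ sigmaCoset Γ) :
    pt ((2 : ℝ) • v) 0 ∈ latticeOf Γ := by
  have := add_sigma_mem_latticeOf h h
  rwa [sigma_pt, pt_add, add_neg_cancel, ← two_smul ℝ v] at this

/-- Twice the horizontal part of the coset is in the projected lattice, so it is one of four half
periods modulo that lattice. A nonzero one is half of a generator, which a change of basis puts
first. -/
theorem exists_straight_coset {a b : Plane} {c : ℝ} (hc : 0 < c)
    (hab : LinearIndependent ℝ ![a, b]) (hL : latticeOf Γ = adaptedLattice a 0 b 0 c)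
    (hS : (sigmaCoset Γ).Nonempty) :
    ∃ a b : Plane, LinearIndependent ℝ ![a, b] ∧ latticeOf Γ = adaptedLattice a 0 b 0 c ∧
      ∃ y₁ ∈ Set.Ico 0 c, sigmaCoset Γ = cosetAt (latticeOf Γ) 0 y₁ ∨
        sigmaCoset Γ = cosetAt (latticeOf Γ) ((1 / 2 : ℝ) • a) y₁ := by
  obtain ⟨z, hz⟩ := hS
  rw [← pt_eta z] at hz
  have h2 := two_smul_mem_of_sigmaCoset hz
  have hS := sigmaCoset_eq_cosetAt hz
  obtain ⟨y₁, hy₁, hy⟩ := cosetAt_reduce (L := latticeOf Γ) hc (by rw [hL]; exact vertical_period_mem a b 0 0 c) z.fst z.snd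
  rw [hy] at hS
  rw [hL, mem_straightLattice] at h2
  obtain ⟨i, j, hij⟩ := mem_gen2.1 h2.2
  have hv : z.fst = (1 / 2 : ℝ) • ((i : ℝ) • a + (j : ℝ) • b) := by
    rw [← hij, half_smul_two_smul]
  have hmem : ∀ {x y : Plane} (m n : ℤ), x - y = (m : ℝ) • a + (n : ℝ) • b →
      pt (x - y) (y₁ - y₁) ∈ latticeOf Γ := fun m n h => by
    rw [hL, mem_straightLattice]
    exact ⟨⟨0, by simp⟩, mem_gen2.2 ⟨m, n, h⟩⟩
  rcases Int.even_or_odd' i with ⟨i', rfl | rfl⟩ <;> rcases Int.even_or_odd' j with ⟨j', rfl | rfl⟩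
  · refine ⟨a, b, hab, hL, y₁, hy₁, Or.inl ?_⟩
    rw [hS]
    exact cosetAt_eq (hmem i' j' (by rw [hv]; push_cast; module))
  · refine ⟨b, a, linearIndependent_pair_of_det hab 0 1 1 0 (by module) (by module) (by norm_num),
      hL.trans (adaptedLattice_swap _ _ _ _ _), y₁, hy₁, Or.inr ?_⟩
    rw [hS]
    exact cosetAt_eq (hmem i' j' (by rw [hv]; push_cast; module))
  · refine ⟨a, b, hab, hL, y₁, hy₁, Or.inr ?_⟩
    rw [hS]
    exact cosetAt_eq (hmem i' j' (by rw [hv]; push_cast; module))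
  · refine ⟨a + b, b, linearIndependent_pair_of_det hab 1 1 0 1 (by module) (by module)
      (by norm_num), hL.trans (straightLattice_congr ?_ c), y₁, hy₁, Or.inr ?_⟩
    · exact gen2_eq_of_det 1 (-1) 0 1 (by norm_num) (by push_cast; module) (by push_cast; module)
    · rw [hS]
      exact cosetAt_eq (hmem i' j' (by rw [hv]; push_cast; module))

/-- Since `(2 v, 0)` is in the lattice at level `0`, its coefficient of `(a, c / 2)` is even. Hence
`v` is an integer multiple of `a` plus a half multiple of `b`, and the multiple of `a` is removed by
changing the height. -/
theorem exists_centred_coset {a b : Plane} {c : ℝ} (hc : 0 < c)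
    (hL : latticeOf Γ = adaptedLattice a (c / 2) b 0 c) (hS : (sigmaCoset Γ).Nonempty) :
    ∃ y₁ ∈ Set.Ico 0 c, sigmaCoset Γ = cosetAt (latticeOf Γ) 0 y₁ ∨
        sigmaCoset Γ = cosetAt (latticeOf Γ) ((1 / 2 : ℝ) • b) y₁ := by
  obtain ⟨z, hz⟩ := hS
  rw [← pt_eta z] at hz
  have h2 := two_smul_mem_of_sigmaCoset hz
  have hS := sigmaCoset_eq_cosetAt hz
  have hcL : pt 0 c ∈ latticeOf Γ := by
    rw [hL]; exact vertical_period_mem a b (c / 2) 0 c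
  rw [hL, mem_adaptedLattice] at h2
  obtain ⟨i, j, k, hij, hk⟩ := h2
  -- The height equation is `0 = i (c / 2) + k c`.
  have hi : (i : ℝ) = -2 * k := by
    have : ((i : ℝ) + 2 * k) * c = 0 := by linarith
    have := (mul_eq_zero.1 this).resolve_right hc.ne'
    linarith
  have hv : z.fst = (1 / 2 : ℝ) • ((i : ℝ) • a + (j : ℝ) • b) := by
    rw [← hij, half_smul_two_smul]
  rw [hi] at hv
  have hmem : ∀ {x y : Plane} (m n : ℤ), x - y = (m : ℝ) • a + (n : ℝ) • b →
      pt (x - y) (z.snd - (z.snd - m * (c / 2))) ∈ latticeOf Γ := fun m n h => by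
    rw [hL, mem_adaptedLattice]
    exact ⟨m, n, 0, h, by simp⟩
  rcases Int.even_or_odd' j with ⟨j', rfl | rfl⟩
  · obtain ⟨y₁, hy₁, hy⟩ := cosetAt_reduce hc hcL 0 (z.snd - (-k : ℤ) * (c / 2))
    refine ⟨y₁, hy₁, Or.inl ?_⟩
    rw [hS, ← hy]
    exact cosetAt_eq (hmem (-k) j' (by rw [hv]; push_cast; module))
  · obtain ⟨y₁, hy₁, hy⟩ := cosetAt_reduce hc hcL ((1 / 2 : ℝ) • b) (z.snd - (-k : ℤ) * (c / 2))
    refine ⟨y₁, hy₁, Or.inr ?_⟩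
    rw [hS, ← hy]
    exact cosetAt_eq (hmem (-k) j' (by rw [hv]; push_cast; module))

/-! ### Every group with a period lattice is in the list -/

/-- The group `Γ` is in one of the cases of the list for the planar lattice `M`. -/
def IsListed (Γ : Subgroup EuclideanGroup) (M : AddSubgroup Plane) : Prop :=
  ∃ (a₀ b₀ : Plane) (k : CaseName) (P : ℝ → AddSubgroup Plane),
    AreGenerators a₀ b₀ M ∧ ListedCase a₀ b₀ k (latticeOf Γ) (sigmaCoset Γ) P

theorem half_smul_not_mem_gen2 {a b : Plane} (hab : LinearIndependent ℝ ![a, b]) :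
    (1 / 2 : ℝ) • a ∉ gen2 a b := by
  rw [mem_gen2]
  rintro ⟨m, n, h⟩
  have : (1 / 2 : ℝ) • a + (0 : ℝ) • b = (m : ℝ) • a + (n : ℝ) • b := by rw [← h]; module
  exact int_cast_ne_half m (hab.eq_of_pair this).1.symm

theorem not_multiple_of_mem_Ico {c y : ℝ} (hy : y ∈ Set.Ico 0 c) (h : y ≠ 0) :
    ¬ ∃ n : ℤ, y = n * c := by
  have : 0 < y := lt_of_le_of_ne hy.1 h.symm
  exact not_multiple_of_between 0 (by push_cast; linarith) (by push_cast; linarith [hy.2])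

/-- The width decides which entry of the table is the period lattice. A coset at a half period is
case 4.2 if that entry is the larger lattice and case 4.1 if it is the smaller one. -/
theorem isListed_of_straight (hΓ : IsCrystallographic Γ) {a b : Plane} {c : ℝ} (hc : 0 < c)
    (hab : LinearIndependent ℝ ![a, b]) (hL : latticeOf Γ = adaptedLattice a 0 b 0 c)
    {y₀ : ℝ} (hy : 0 < y₀) : IsListed Γ (commonPeriods Γ y₀) := by
  rcases (sigmaCoset Γ).eq_empty_or_nonempty with hS | hS
  · have hN := NormalCase.straight_empty _ _ _ hL hS rfl
    rw [hN.commonPeriods_eq hΓ hc hab hy]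
    exact ⟨a, b, _, _, ⟨hab, rfl⟩, .c31 c hc _ _ hL (Or.inl hS)⟩
  obtain ⟨a, b, hab, hL, y₁, hy₁, hS | hS⟩ := exists_straight_coset hc hab hL hS
  · have hN := NormalCase.straight_zero y₁ _ _ _ hL hS rfl
    rw [hN.commonPeriods_eq hΓ hc hab hy]
    by_cases h : y₁ = 0
    · rw [h, cosetAt_zero] at hS
      exact ⟨a, b, _, _, ⟨hab, rfl⟩, .c31 c hc _ _ hL (Or.inr hS)⟩
    · refine ⟨a, b, _, _, ⟨hab, rfl⟩, .c41_zero c y₁ _ _ hL ⟨hy₁.1, hy₁.2, ?_⟩ hS⟩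
      rw [hL, vertical_mem_adaptedLattice hab]
      exact not_multiple_of_mem_Ico hy₁ h
  · have hN := NormalCase.straight_half _ y₁ _ _ _ _ hL hS (two_smul_half_smul a).symm rfl rfl
    rw [hN.commonPeriods_eq hΓ hc hab hy]
    have hv : IsShift (latticeOf Γ) c ((1 / 2 : ℝ) • a) y₁ := by
      refine ⟨hy₁.1, hy₁.2, ?_⟩
      rw [hL, mem_straightLattice]
      exact fun h => half_smul_not_mem_gen2 hab h.2
    have h1 : IsListed Γ (gen2 ((1 / 2 : ℝ) • a) b) :=
      ⟨_, b, _, _, ⟨linearIndependent_pair_of_det hab (1 / 2) 0 0 1 (by module) (by module)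
        (by norm_num), rfl⟩, .c42 c y₁ _ _ (by rw [hL, two_smul_half_smul]) hv hS⟩
    have h2 : IsListed Γ (gen2 a b) := ⟨a, b, _, _, ⟨hab, rfl⟩, .c41_a c y₁ _ _ hL hv hS⟩
    unfold bandTable
    split_ifs <;> assumption

theorem isListed_of_centred (hΓ : IsCrystallographic Γ) {a b : Plane} {c : ℝ} (hc : 0 < c)
    (hab : LinearIndependent ℝ ![a, b]) (hL : latticeOf Γ = adaptedLattice a (c / 2) b 0 c)
    {y₀ : ℝ} (hy : 0 < y₀) : IsListed Γ (commonPeriods Γ y₀) := by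
  have h2a : LinearIndependent ℝ ![(2 : ℝ) • a, b] :=
    linearIndependent_pair_of_det hab 2 0 0 1 (by module) (by module) (by norm_num)
  have hL2 : latticeOf Γ = adaptedLattice ((1 / 2 : ℝ) • (2 : ℝ) • a) (c / 2) b 0 c := by
    rw [hL, half_smul_two_smul]
  rcases (sigmaCoset Γ).eq_empty_or_nonempty with hS | hS
  · have hN := NormalCase.centred_empty _ _ _ _ hL hS rfl rfl
    rw [hN.commonPeriods_eq hΓ hc hab hy]
    have h1 : IsListed Γ (gen2 a b) := ⟨a, b, _, _, ⟨hab, rfl⟩, .c32_empty c hc _ _ hL hS⟩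
    have h2 : IsListed Γ (gen2 ((2 : ℝ) • a) b) :=
      ⟨_, b, _, _, ⟨h2a, rfl⟩, .c33_empty c hc _ _ hL2 hS⟩
    unfold atMultiples
    split_ifs <;> assumption
  obtain ⟨y₁, hy₁, hS | hS⟩ := exists_centred_coset hc hL hS
  · have hN := NormalCase.centred_zero y₁ _ _ _ _ hL hS rfl rfl
    rw [hN.commonPeriods_eq hΓ hc hab hy]
    obtain ⟨h1, h2⟩ : IsListed Γ (gen2 a b) ∧ IsListed Γ (gen2 ((2 : ℝ) • a) b) := by
      by_cases h : y₁ = 0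
      · rw [h, cosetAt_zero] at hS
        exact ⟨⟨a, b, _, _, ⟨hab, rfl⟩, .c32_full c hc _ _ hL hS⟩,
          ⟨_, b, _, _, ⟨h2a, rfl⟩, .c33_full c hc _ _ hL2 hS⟩⟩
      · have hv : IsShift (latticeOf Γ) c 0 y₁ := by
          refine ⟨hy₁.1, hy₁.2, ?_⟩
          rw [hL, vertical_mem_adaptedLattice hab]
          exact not_multiple_of_mem_Ico hy₁ h
        exact ⟨⟨a, b, _, _, ⟨hab, rfl⟩, .c51_zero c y₁ _ _ hL hv hS⟩,
          ⟨_, b, _, _, ⟨h2a, rfl⟩, .c55_zero c y₁ _ _ hL2 hv hS⟩⟩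
    unfold bandTable
    split_ifs <;> assumption
  · have hN := NormalCase.centred_half _ y₁ _ _ _ _ _ _ hL hS (two_smul_half_smul b).symm
      rfl rfl rfl rfl
    rw [hN.commonPeriods_eq hΓ hc hab hy]
    have hv : IsShift (latticeOf Γ) c ((1 / 2 : ℝ) • b) y₁ := by
      refine ⟨hy₁.1, hy₁.2, fun h => ?_⟩
      rw [hL] at h
      have h1 := exists_pt_mem_adaptedLattice.1 ⟨_, h⟩
      rw [gen2_comm] at h1
      exact half_smul_not_mem_gen2 (linearIndependent_pair_of_det hab 0 1 1 0 (by module)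
        (by module) (by norm_num)) h1
    unfold bandTable
    -- Rows `A`, `B`, `C`, `O` of the one normal case are read as cases 5.2, 5.4, 5.3, 5.5. The side
    -- conditions on `y₁` hold because row `A` takes precedence over `B` and `C`.
    split_ifs with hA hB hC
    · exact ⟨a, _, _, _, ⟨linearIndependent_pair_of_det hab 1 0 0 (1 / 2) (by module) (by module)
        (by norm_num), rfl⟩, .c52_b c y₁ _ _ (by rw [hL, two_smul_half_smul]) hv hS⟩
    · refine ⟨_, _, _, _, ⟨linearIndependent_pair_of_det hab 2 0 0 (1 / 2) (by module) (by module)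
        (by norm_num), rfl⟩, .c54_b c y₁ _ _ (by rw [hL2, two_smul_half_smul]) hv hS ?_⟩
      rintro rfl
      exact hA (by simpa using hB)
    · refine ⟨a + (1 / 2 : ℝ) • b, b, _, _, ⟨linearIndependent_pair_of_det hab 1 (1 / 2) 0 1
        (by module) (by module) (by norm_num), ?_⟩,
        .c53_b c y₁ _ _ (by rw [hL, add_sub_cancel_right]) hv hS ?_⟩
      · exact gen2_eq_of_det 2 (-1) 1 0 (by norm_num) (by push_cast; module) (by push_cast; module)
      · rintro rfl
        obtain ⟨n, hn⟩ := hC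
        exact hA ⟨n + 1, by push_cast; linarith⟩
    · exact ⟨_, b, _, _, ⟨h2a, rfl⟩, .c55_b c y₁ _ _ hL2 hv hS⟩

/-- A nonempty `σ`-coset would make the lattice `σ`-invariant. At multiples of `c` the periods are
the projected lattice, case 2.1; at other widths generators of the period lattice yield generators
of the diophantine module, case 2.2. -/
theorem isListed_of_sigmaBreaks (hΓ : IsCrystallographic Γ) {a b : Plane} {a₃ b₃ c : ℝ}
    (hab : LinearIndependent ℝ ![a, b]) (ha₃ : a₃ ∈ Set.Ico 0 c) (hb₃ : b₃ ∈ Set.Ico 0 c)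
    (hL : latticeOf Γ = adaptedLattice a a₃ b b₃ c) (hσ : SigmaBreaks (latticeOf Γ))
    {y₀ : ℝ} (hy : 0 < y₀) (hM : IsLattice (commonPeriods Γ y₀)) :
    IsListed Γ (commonPeriods Γ y₀) := by
  have hc : 0 < c := ha₃.1.trans_lt ha₃.2
  have hS : sigmaCoset Γ = ∅ := by
    by_contra h
    obtain ⟨s, hs⟩ := Set.nonempty_iff_ne_empty.2 h
    exact hσ fun z hz => sigma_mem_latticeOf hs hz
  have h21 : Case21 a b a₃ b₃ c (latticeOf Γ) (sigmaCoset Γ) := ⟨hc, ha₃, hb₃, hL, hσ, hS⟩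
  have e := h21.commonPeriods_eq hΓ hab hy
  by_cases hA : ∃ n : ℤ, y₀ = n * c
  · rw [e, atMultiples_pos _ _ hA]
    exact ⟨a, b, _, _, ⟨hab, rfl⟩, .c21 a₃ b₃ c _ _ h21⟩
  · rw [atMultiples_neg _ _ hA] at e
    obtain ⟨a₀, b₀, h₀, he⟩ := hM.exists_areGenerators
    obtain ⟨d, hd, ha⟩ := mem_combinations.1 (e ▸ he ▸ left_mem_gen2 a₀ b₀)
    obtain ⟨f, hf, hb⟩ := mem_combinations.1 (e ▸ he ▸ right_mem_gen2 a₀ b₀)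
    refine ⟨a₀, b₀, _, _, ⟨h₀, he⟩, .c22 a b a₃ b₃ c _ _ ⟨hc, ha₃, hb₃, hab, hL, hσ, hS,
      d.1, d.2, f.1, f.2, ?_, le_antisymm ?_ (gen2_le hd hf), ?_, ?_⟩⟩
    -- As in `Case21.isLattice_iff`, a vanishing determinant would give relations forcing `b₀ = 0`.
    · intro hdet
      have hdet' : (d.1 : ℝ) * f.2 - d.2 * f.1 = 0 := by exact_mod_cast hdet
      have h1 : (f.2 : ℝ) • a₀ + (-d.2 : ℝ) • b₀ = 0 := by
        rw [ha, hb]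
        calc _ = ((d.1 : ℝ) * f.2 - d.2 * f.1) • a := by module
          _ = 0 := by rw [hdet', zero_smul]
      have h2 : (-f.1 : ℝ) • a₀ + (d.1 : ℝ) • b₀ = 0 := by
        rw [ha, hb]
        calc _ = ((d.1 : ℝ) * f.2 - d.2 * f.1) • b := by module
          _ = 0 := by rw [hdet', zero_smul]
      have h3 := (h₀.eq_zero_of_pair h1).1
      have h4 := neg_eq_zero.1 (h₀.eq_zero_of_pair h2).1
      exact h₀.ne_zero 1 (by change b₀ = 0; rw [hb, h3, h4]; simp)
    · intro g hg
      have hmem : (g.1 : ℝ) • a + (g.2 : ℝ) • b ∈ gen2 a₀ b₀ := by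
        rw [← he, e]; exact mem_combinations.2 ⟨g, hg, rfl⟩
      obtain ⟨m, n, h⟩ := mem_gen2.1 hmem
      rw [ha, hb] at h
      have h' : (g.1 : ℝ) • a + (g.2 : ℝ) • b =
          ((m : ℝ) * d.1 + n * f.1) • a + ((m : ℝ) * d.2 + n * f.2) • b := by rw [h]; module
      obtain ⟨h1, h2⟩ := hab.eq_of_pair h'
      refine AddSubgroup.mem_closure_pair.2 ⟨m, n, Prod.ext ?_ ?_⟩
      · simp only [Prod.fst_add, Prod.smul_fst, smul_eq_mul]; exact_mod_cast h1.symm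
      · simp only [Prod.snd_add, Prod.smul_snd, smul_eq_mul]; exact_mod_cast h2.symm
    · rw [ha, Int.cast_smul_eq_zsmul, Int.cast_smul_eq_zsmul]
    · rw [hb, Int.cast_smul_eq_zsmul, Int.cast_smul_eq_zsmul]

theorem isListed_commonPeriods (hΓ : IsCrystallographic Γ) {y₀ : ℝ} (hy : 0 < y₀)
    (hM : IsLattice (commonPeriods Γ y₀)) : IsListed Γ (commonPeriods Γ y₀) := by
  obtain ⟨c, hc0, hV⟩ := hΓ.exists_vertical
  rcases hc0.eq_or_lt with rfl | hc
  · have hV' : ∀ q : ℝ, pt 0 q ∈ latticeOf Γ → q = 0 := fun q hq => by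
      obtain ⟨n, hn⟩ := (hV q).1 hq
      simpa using hn
    have hS : sigmaCoset Γ = ∅ := by
      by_contra h
      obtain ⟨s, hs⟩ := Set.nonempty_iff_ne_empty.2 h
      -- The vertical vector `z - σ z = (0, 2 z.snd)` must vanish, so the whole lattice would be
      -- horizontal and could not span.
      have h0 : ∀ z ∈ latticeOf Γ, z ∈ LinearMap.ker verticalPart := fun z hz => by
        have h1 := (latticeOf Γ).sub_mem hz (sigma_mem_latticeOf hs hz)
        rw [← pt_eta z, sigma_pt, pt_sub, sub_self] at h1
        have h2 := hV' _ h1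
        change z.snd = 0
        linarith
      have h1 : (⊤ : Submodule ℝ Space) ≤ LinearMap.ker verticalPart := by
        rw [← IsLattice.span_eq_top hΓ, Submodule.span_le]
        exact h0
      have h2 : (1 : ℝ) = 0 := h1 (Submodule.mem_top (x := pt 0 1))
      exact one_ne_zero h2
    obtain ⟨a₀, b₀, h₀, he⟩ := hM.exists_areGenerators
    obtain ⟨c₀, c₃, h⟩ := IsLattice.exists_obliqueLattice hΓ hV' h₀ fun p => by
      rw [← he, mem_commonPeriods_iff hΓ hy, hS]
      have : pt 0 y₀ ∉ latticeOf Γ := fun h => hy.ne' (hV' _ h)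
      simp only [Set.mem_empty_iff_false, this, false_and, or_false]
    exact ⟨a₀, b₀, _, _, ⟨h₀, he⟩, .c1 c₀ c₃ _ _ (by rw [hS]; exact h)⟩
  · obtain ⟨a, b, a₃, b₃, hab, ha₃, hb₃, hL⟩ := IsLattice.exists_adaptedLattice hΓ hc hV
    by_cases hσ : SigmaBreaks (latticeOf Γ)
    · exact isListed_of_sigmaBreaks hΓ hab ha₃ hb₃ hL hσ hy hM
    · obtain ⟨a, b, hab, hL | hL⟩ :=
        exists_straight_or_centred hab ha₃ hb₃ hL (not_not.1 hσ)
      · exact isListed_of_straight hΓ hc hab hL hy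
      · exact isListed_of_centred hΓ hc hab hL hy

/-! ### Realization and periods of the listed cases -/

theorem ListedCase.exists_group {a₀ b₀ : Plane} {k : CaseName} {L : AddSubgroup Space}
    {S : Set Space} {P : ℝ → AddSubgroup Plane} (h : ListedCase a₀ b₀ k L S P)
    (h₀ : LinearIndependent ℝ ![a₀, b₀]) :
    ∃ Γ : Subgroup EuclideanGroup, IsCrystallographic Γ ∧ latticeOf Γ = L ∧ sigmaCoset Γ = S := by
  by_cases hk : k ≠ .case1 ∧ k ≠ .case21 ∧ k ≠ .case22
  · obtain ⟨a, b, c, hc, hab, hN⟩ := h.exists_normalCase h₀ hk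
    exact hN.exists_group hc hab
  · cases h with
    | c1 c₀ c₃ _ _ h =>
      obtain ⟨hc, -, rfl, rfl⟩ := h
      exact exists_group_of_isLattice (isLattice_oblique h₀ hc)
    | c21 a₃ b₃ c _ _ h =>
      obtain ⟨hc, -, -, rfl, -, rfl⟩ := h
      exact exists_group_of_isLattice (isLattice_adaptedLattice h₀ hc.ne' _ _)
    | c22 a b a₃ b₃ c _ _ h =>
      obtain ⟨hc, -, -, hab, rfl, -, rfl, -⟩ := h
      exact exists_group_of_isLattice (isLattice_adaptedLattice hab hc.ne' _ _)
    | _ => simp at hk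

theorem ListedCase.commonPeriods_eq (hΓ : IsCrystallographic Γ) {a₀ b₀ : Plane} {k : CaseName}
    {P : ℝ → AddSubgroup Plane} (h : ListedCase a₀ b₀ k (latticeOf Γ) (sigmaCoset Γ) P)
    (h₀ : LinearIndependent ℝ ![a₀, b₀]) {y₀ : ℝ} (hy : 0 < y₀) : commonPeriods Γ y₀ = P y₀ := by
  by_cases hk : k ≠ .case1 ∧ k ≠ .case21 ∧ k ≠ .case22
  · obtain ⟨a, b, c, hc, hab, hN⟩ := h.exists_normalCase h₀ hk
    exact hN.commonPeriods_eq hΓ hc hab hy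
  · cases h with
    | c1 c₀ c₃ _ _ h => exact h.commonPeriods_eq hΓ hy
    | c21 a₃ b₃ c _ _ h => exact h.commonPeriods_eq hΓ h₀ hy
    | c22 a b a₃ b₃ c _ _ h => exact h.commonPeriods_eq hΓ hy
    | _ => simp at hk

/-- In the `σ`-invariant cases every row is compatible with the module of the normal case, and `gen2
a₀ b₀` is itself the row attained at some width; transitivity through that module concludes. -/
theorem ListedCase.isLattice_and_compatible {a₀ b₀ : Plane} {k : CaseName} {L : AddSubgroup Space}
    {S : Set Space} {P : ℝ → AddSubgroup Plane} (h : ListedCase a₀ b₀ k L S P)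
    (h₀ : LinearIndependent ℝ ![a₀, b₀]) (h21 : k ≠ .case21) (y₀ : ℝ) :
    IsLattice (P y₀) ∧ RationallyCompatible (P y₀) (gen2 a₀ b₀) ∧
      RationallyCompatible (gen2 a₀ b₀) (P y₀) := by
  by_cases hk : k ≠ .case1 ∧ k ≠ .case21 ∧ k ≠ .case22
  · obtain ⟨y, -, hyM⟩ := h.exists_width
    obtain ⟨a, b, c, -, hab, hN⟩ := h.exists_normalCase h₀ hk
    obtain ⟨-, h1, h2⟩ := hN.isLattice_and_compatible hab y
    obtain ⟨h3, h4, h5⟩ := hN.isLattice_and_compatible hab y₀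
    rw [hyM] at h1 h2
    exact ⟨h3, h4.trans h2, h1.trans h5⟩
  · cases h with
    | c1 => exact ⟨isLattice_gen2 h₀, rationallyCompatible_of_le le_rfl,
        rationallyCompatible_of_le le_rfl⟩
    | c21 => exact absurd rfl h21
    | c22 a b a₃ b₃ c _ _ h => exact h.isLattice_and_compatible h₀ y₀
    | _ => simp at hk

end

/-! ### The main theorem. -/

theorem mainTheorem2 (M : AddSubgroup Plane) (hM : IsLattice M) :
    -- the groups with period lattice `M` for some width are exactly those in the list
    (∀ Γ : Subgroup EuclideanGroup, IsCrystallographic Γ →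
      ((∃ y₀ : ℝ, 0 < y₀ ∧ commonPeriods Γ y₀ = M) ↔
        ∃ (a₀ b₀ : Plane) (k : CaseName) (P : ℝ → AddSubgroup Plane),
          AreGenerators a₀ b₀ M ∧ ListedCase a₀ b₀ k (latticeOf Γ) (sigmaCoset Γ) P)) ∧
    -- every lattice and `σ`-coset in the list is that of a crystallographic group
    (∀ (a₀ b₀ : Plane) (k : CaseName) (L : AddSubgroup Space) (S : Set Space)
        (P : ℝ → AddSubgroup Plane), AreGenerators a₀ b₀ M → ListedCase a₀ b₀ k L S P →
      ∃ Γ : Subgroup EuclideanGroup,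
        IsCrystallographic Γ ∧ latticeOf Γ = L ∧ sigmaCoset Γ = S) ∧
    -- the periods for every width, and rational compatibility with `M`
    (∀ (Γ : Subgroup EuclideanGroup) (a₀ b₀ : Plane) (k : CaseName)
        (P : ℝ → AddSubgroup Plane), IsCrystallographic Γ → AreGenerators a₀ b₀ M →
        ListedCase a₀ b₀ k (latticeOf Γ) (sigmaCoset Γ) P →
      ∀ y₀ : ℝ, 0 < y₀ →
        commonPeriods Γ y₀ = P y₀ ∧
        (k ≠ CaseName.case21 →
          IsLattice (commonPeriods Γ y₀) ∧
          RationallyCompatible (commonPeriods Γ y₀) M ∧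
          RationallyCompatible M (commonPeriods Γ y₀))) ∧
    -- case 2.1: the periods form a proper submodule of `M` unless `y₀` is a multiple of `c`
    (∀ (Γ : Subgroup EuclideanGroup) (a₀ b₀ : Plane) (a₃ b₃ c : ℝ),
        IsCrystallographic Γ → AreGenerators a₀ b₀ M →
        Case21 a₀ b₀ a₃ b₃ c (latticeOf Γ) (sigmaCoset Γ) →
      ∀ y₀ : ℝ, 0 < y₀ → (∀ n : ℤ, y₀ ≠ n * c) →
        commonPeriods Γ y₀ < M ∧
        (IsLattice (commonPeriods Γ y₀) ↔
          ∃ d ∈ diophantineModule a₃ b₃ c, ∃ e ∈ diophantineModule a₃ b₃ c,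
            d.1 * e.2 - d.2 * e.1 ≠ 0) ∧
        (IsLattice (commonPeriods Γ y₀) → RationallyCompatible M (commonPeriods Γ y₀))) ∧
    -- case 2.2: the periods properly contain `M` when `y₀` is a multiple of `c`
    (∀ (Γ : Subgroup EuclideanGroup) (a₀ b₀ a b : Plane) (a₃ b₃ c : ℝ),
        IsCrystallographic Γ → AreGenerators a₀ b₀ M →
        Case22 a₀ b₀ a b a₃ b₃ c (latticeOf Γ) (sigmaCoset Γ) →
      ∀ y₀ : ℝ, 0 < y₀ → (∃ n : ℤ, y₀ = n * c) → M < commonPeriods Γ y₀) := by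
  refine ⟨fun Γ hΓ => ⟨?_, ?_⟩, ?_, ?_, ?_, ?_⟩
  · rintro ⟨y₀, hy, rfl⟩
    exact isListed_commonPeriods hΓ hy hM
  · rintro ⟨a₀, b₀, k, P, ⟨h₀, rfl⟩, h⟩
    obtain ⟨y₀, hy, hP⟩ := h.exists_width
    exact ⟨y₀, hy, (h.commonPeriods_eq hΓ h₀ hy).trans hP⟩
  · intro a₀ b₀ k L S P h₀ h
    exact h.exists_group h₀.1
  · rintro Γ a₀ b₀ k P hΓ ⟨h₀, rfl⟩ h y₀ hy
    have e := h.commonPeriods_eq hΓ h₀ hy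
    exact ⟨e, fun hk => e ▸ h.isLattice_and_compatible h₀ hk y₀⟩
  · rintro Γ a₀ b₀ a₃ b₃ c hΓ ⟨h₀, rfl⟩ h y₀ hy hne
    have e := h.commonPeriods_eq hΓ h₀ hy
    rw [atMultiples_neg _ _ (not_exists.2 hne)] at e
    obtain ⟨-, ha₃, hb₃, hL, hσ, -⟩ := h
    rw [hL] at hσ
    have hiff := Case21.isLattice_iff h₀ (diophantineModule a₃ b₃ c)
    rw [e]
    refine ⟨combinations_lt h₀ ha₃ hb₃ hσ, hiff, fun hlat => ?_⟩
    obtain ⟨d, hd, f, hf, hdet⟩ := hiff.1 hlat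
    exact rationallyCompatible_of_det (mem_combinations.2 ⟨d, hd, rfl⟩)
      (mem_combinations.2 ⟨f, hf, rfl⟩) hdet
  · rintro Γ a₀ b₀ a b a₃ b₃ c hΓ ⟨h₀, rfl⟩ h y₀ hy hA
    rw [h.commonPeriods_eq hΓ hy, atMultiples_pos _ _ hA, ← h.combinations_eq]
    obtain ⟨-, ha₃, hb₃, hab, hL, hσ, -⟩ := h
    rw [hL] at hσ
    exact combinations_lt hab ha₃ hb₃ hσ
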